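/- \textbf{Definitions.} A \emph{clutter} $\mathcal{C}$ over a finite \emph{ground set} $V$ is a family of subsets of $V$ (its \emph{members}), none of which contains another. A \emph{cover} is a set $B\subseteq V$ that intersects every member; the \emph{covering number} of $\mathcal{C}$ is the minimum cardinality of a cover, and a \emph{minimum cover} is a cover of that cardinality. The \emph{blocker} of $\mathcal{C}$ is the clutter over $V$ whose members are the inclusion-wise minimal covers of $\mathcal{C}$. A \emph{minor} of $\mathcal{C}$ is a clutter $\mathcal{C}\setminus I/J$, for disjoint $I,J\subseteq V$, over ground set $V-(I\cup J)$, whose members are the inclusion-wise minimal sets in $\{C-J : C\in\mathcal{C},\ C\cap I=\emptyset\}$. A \emph{delta} is a clutter over a ground set $\{a_1,\dots,a_n\}$ of $n\ge 3$ elements whose members are $\{a_2,\dots,a_n\}$ and $\{a_1,a_i\}$, $i=2,\dots,n$. An \emph{extended odd hole} is a clutter over a ground set $\{a_1,\dots,a_n\}$ of $n$ elements, $n\ge 5$ odd, whose minimum cardinality members are exactly $\{a_1,a_2\},\{a_2,a_3\},\dots,\{a_{n-1},a_n\},\{a_n,a_1\}$. A clutter is \emph{clean} if none of its minors is a delta or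 the blocker of an extended odd hole. A clutter is \emph{tangled} if its covering number is two and every element belongs to a minimum cover. Let $\mathcal{C}$ be a clean tangled clutter over $V$. Its \emph{rank} is the number of connected components of the graph with vertex set $V$ whose edges are the minimum covers of $\mathcal{C}$. A \emph{fractional packing} of $\mathcal{C}$ is a vector $y\in\mathbb{R}^{\mathcal{C}}_{+}$ with $\sum_{C\in\mathcal{C}:\,v\in C}y_C\le 1$ for every $v\in V$; its \emph{value} is $\sum_{C\in\mathcal{C}}y_C$. The \emph{core} of $\mathcal{C}$ is the clutter over $V$ whose members are the $C\in\mathcal{C}$ with $y_C>0$ for some fractional packing $y$ of value two. For $S\subseteq\{0,1\}^n$, $\mathrm{cuboid}(S)$ is the clutter over $\{1,\dots,2n\}$ whose members are the sets with incidence vectors $(p_1,1-p_1,\dots,p_n,1-p_n)$, $p\in S$. A \emph{duplication} of a clutter is obtained from it, up to relabelling elements, by replacing every element $w$ by a nonempty set of copies of $w$ in all members containing it. The \emph{setcore} of $\mathcal{C}$ is the set $S\subseteq\{0,1\}^r$, where $r=\mathrm{rank}(\mathcal{C})$, such that the core of $\mathcal{C}$ is a duplication of $\mathrm{cuboid}(S)$;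 such a set exists and is unique up to permuting coordinates and replacing some coordinates $x_i$ by $1-x_i$. Finally, let $$\mathbb{L}_7=\big\{\{1,2,3\},\{1,4,5\},\{1,6,7\},\{2,5,6\},\{2,4,7\},\{3,4,6\},\{3,5,7\}\big\},$$ the clutter over $\{1,\dots,7\}$ of the lines of the Fano plane. \textbf{Theorem.} Let $\mathcal{C}$ be a clean tangled clutter such that the convex hull of the setcore of $\mathcal{C}$ is a simplex. If $\mathrm{rank}(\mathcal{C})>3$, then $\mathcal{C}$ has a minor that equals $\mathbb{L}_7$ up to relabelling elements. -/

import Mathlib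

/-- A clutter: a finite ground set together with a family of subsets of it, the members,
none of which contains another one. -/
structure Clutter (α : Type*) where
  ground : Finset α
  members : Finset (Finset α)
  subset_ground : ∀ A ∈ members, A ⊆ ground
  antichain : IsAntichain (· ⊆ ·) (members : Set (Finset α))

/-- The inclusion-wise minimal sets of a finite family of finite sets. -/
def minimalSets {α : Type*} [DecidableEq α] (F : Finset (Finset α)) : Finset (Finset α) :=
  F.filter (fun A => ∀ B ∈ F, B ⊆ A → B = A)

theorem minimalSets_antichain {α : Type*} [DecidableEq α] (F : Finset (Finset α)) :
    IsAntichain (· ⊆ ·) (minimalSets F : Set (Finset α)) := by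
  intro A hA B hB hne hAB
  rw [Finset.mem_coe, minimalSets, Finset.mem_filter] at hA hB
  exact hne (hB.2 A hA.1 hAB)

namespace Clutter

/-- A cover: a set of elements that meets every member. -/
def IsCover {α : Type*} [DecidableEq α] (C : Clutter α) (B : Finset α) : Prop :=
  B ⊆ C.ground ∧ ∀ A ∈ C.members, (A ∩ B).Nonempty

/-- The covering number, i.e. the minimum cardinality of a cover (`⊤` if there is no cover). -/
noncomputable def coveringNumber {α : Type*} [DecidableEq α] (C : Clutter α) : ℕ∞ :=
  ⨅ B : {B : Finset α // C.IsCover B}, (B.1.card : ℕ∞)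

/-- A minimum cover: a cover of minimum cardinality. -/
def IsMinimumCover {α : Type*} [DecidableEq α] (C : Clutter α) (B : Finset α) : Prop :=
  C.IsCover B ∧ (B.card : ℕ∞) = C.coveringNumber

/-- The blocker `b(C)`: the clutter of the (inclusion-wise) minimal covers. -/
noncomputable def blocker {α : Type*} [DecidableEq α] (C : Clutter α) : Clutter α := by
  classical
  exact
  { ground := C.ground
    members := minimalSets (C.ground.powerset.filter (fun B => C.IsCover B))
    subset_ground := by
      intro A hA
      rw [minimalSets, Finset.mem_filter, Finset.mem_filter, Finset.mem_powerset] at hA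
      exact hA.1.1
    antichain := minimalSets_antichain _ }

/-- The clutter `C \ I / J` obtained by deleting `I` and contracting `J`. -/
def minor {α : Type*} [DecidableEq α] (C : Clutter α) (I J : Finset α) : Clutter α where
  ground := C.ground \ (I ∪ J)
  members := minimalSets ((C.members.filter (fun A => Disjoint A I)).image (fun A => A \ J))
  subset_ground := by
    intro A hA
    rw [minimalSets, Finset.mem_filter, Finset.mem_image] at hA
    obtain ⟨⟨B, hB, rfl⟩, -⟩ := hA
    rw [Finset.mem_filter] at hB
    intro x hx
    rw [Finset.mem_sdiff] at hx
    rw [Finset.mem_sdiff, Finset.mem_union]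
    refine ⟨C.subset_ground B hB.1 hx.1, ?_⟩
    rintro (h | h)
    · exact Finset.disjoint_left.mp hB.2 hx.1 h
    · exact hx.2 h
  antichain := minimalSets_antichain _

/-- `D` is a minor of `C`. -/
def IsMinor {α : Type*} [DecidableEq α] (D C : Clutter α) : Prop :=
  ∃ I J : Finset α, I ⊆ C.ground ∧ J ⊆ C.ground ∧ Disjoint I J ∧ D = C.minor I J

/-- A delta: at least three elements `a = a₁, a₂, …, aₙ`, with members `{a₂, …, aₙ}` and
`{a₁, aᵢ}` for `i = 2, …, n`. -/
def IsDelta {α : Type*} [DecidableEq α] (C : Clutter α) : Prop :=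
  3 ≤ C.ground.card ∧ ∃ a ∈ C.ground,
    C.members = insert (C.ground.erase a) ((C.ground.erase a).image (fun b => {a, b}))

/-- An extended odd hole: the elements are `aᵢ` (`i` modulo an odd `n ≥ 5`), and the members of
minimum cardinality are exactly the sets `{aᵢ, aᵢ₊₁}`. -/
def IsExtendedOddHole {α : Type*} [DecidableEq α] (C : Clutter α) : Prop :=
  ∃ n : ℕ, 5 ≤ n ∧ Odd n ∧ ∃ a : ZMod n → α,
    Function.Injective a ∧ Set.range a = (C.ground : Set α) ∧
    ∀ A : Finset α, (A ∈ C.members ∧ ∀ B ∈ C.members, A.card ≤ B.card) ↔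
      ∃ i : ZMod n, A = {a i, a (i + 1)}

/-- A clutter is clean if no minor of it is a delta or the blocker of an extended odd hole. -/
def IsClean {α : Type*} [DecidableEq α] (C : Clutter α) : Prop :=
  ∀ D : Clutter α, D.IsMinor C →
    ¬ D.IsDelta ∧ ¬ ∃ H : Clutter α, H.IsExtendedOddHole ∧ D = H.blocker

/-- A clutter is tangled if it has covering number two and every element is in a minimum cover. -/
def IsTangled {α : Type*} [DecidableEq α] (C : Clutter α) : Prop :=
  C.coveringNumber = 2 ∧ ∀ v ∈ C.ground, ∃ B : Finset α, C.IsMinimumCover B ∧ v ∈ B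

/-- The graph `G(C)` on the ground set; the edges are the minimum covers (meant for clutters of
covering number two). -/
def coverGraph {α : Type*} [DecidableEq α] (C : Clutter α) : SimpleGraph C.ground where
  Adj u v := u ≠ v ∧ C.IsMinimumCover {u.1, v.1}
  symm := ⟨fun u v h => ⟨h.1.symm, by rw [Finset.pair_comm]; exact h.2⟩⟩
  loopless := ⟨fun _ h => h.1 rfl⟩

/-- The rank: the number of connected components of `G(C)`. -/
noncomputable def rank {α : Type*} [DecidableEq α] (C : Clutter α) : ℕ :=
  Nat.card C.coverGraph.ConnectedComponent

/-- A fractional packing: nonnegative weights on the members such that the members through any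
given element have total weight at most one. Values of `y` off the members are irrelevant. -/
def IsFractionalPacking {α : Type*} [DecidableEq α] (C : Clutter α) (y : Finset α → ℝ) : Prop :=
  (∀ A ∈ C.members, 0 ≤ y A) ∧
    ∀ v ∈ C.ground, ∑ A ∈ C.members.filter (fun A => v ∈ A), y A ≤ 1

/-- The core: the members of positive weight in some fractional packing of value two. -/
noncomputable def core {α : Type*} [DecidableEq α] (C : Clutter α) : Clutter α := by
  classical
  exact
  { ground := C.ground
    members := C.members.filter (fun A => ∃ y : Finset α → ℝ,
      C.IsFractionalPacking y ∧ ∑ B ∈ C.members, y B = 2 ∧ 0 < y A)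
    subset_ground := fun A hA => C.subset_ground A (Finset.mem_filter.mp hA).1
    antichain := C.antichain.subset (Finset.coe_subset.mpr (Finset.filter_subset _ _)) }

/-- `D` is, up to relabelling, a duplication of `E`: the map `f` sends every element of `D` to the
element of `E` that it is a copy of (each element of `E` has at least one copy), and the members
of `D` are obtained from those of `E` by replacing every element with all its copies. -/
def IsDuplication {α β : Type*} [DecidableEq α] [DecidableEq β]
    (D : Clutter α) (E : Clutter β) : Prop :=
  ∃ f : α → β, Set.MapsTo f D.ground E.ground ∧ Set.SurjOn f D.ground E.ground ∧
    D.members = E.members.image (fun A => D.ground.filter (fun v => f v ∈ A))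

/-- `D` and `E` are equal up to relabelling the elements. -/
def IsIsomorphic {α β : Type*} [DecidableEq α] [DecidableEq β] [Nonempty β]
    (D : Clutter α) (E : Clutter β) : Prop :=
  ∃ f : α → β, Set.BijOn f D.ground E.ground ∧
    E.members = D.members.image (fun A => A.image f)

/-- The cuboid of a set `S` of 0-1 points in dimension `n`. The two elements `(i, true)`,
`(i, false)` stand for `2i - 1`, `2i`, so that the member of `p` has incidence vector
`(p₁, 1 - p₁, …, pₙ, 1 - pₙ)`. -/
def cuboid {n : ℕ} (S : Finset (Fin n → Bool)) : Clutter (Fin n × Bool) where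
  ground := Finset.univ
  members := S.image (fun p => Finset.univ.filter (fun x : Fin n × Bool => p x.1 = x.2))
  subset_ground := fun _ _ => Finset.subset_univ _
  antichain := by
    intro A hA B hB hne hAB
    rw [Finset.mem_coe, Finset.mem_image] at hA hB
    obtain ⟨p, -, rfl⟩ := hA
    obtain ⟨q, -, rfl⟩ := hB
    apply hne
    have hpq : p = q := by
      funext i
      have h := hAB (Finset.mem_filter.mpr ⟨Finset.mem_univ (i, p i), rfl⟩)
      exact (Finset.mem_filter.mp h).2.symm
    rw [hpq]

/-- `S` is the setcore of `C`: a set of 0-1 points, in dimension the rank of `C`, such that the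
core of `C` is a duplication of the cuboid of `S`. For a clean tangled clutter such a set
exists and is unique up to relabelling and twisting (replacing `xᵢ` by `1 - xᵢ`) coordinates. -/
def IsSetcore {α : Type*} [DecidableEq α] (C : Clutter α) (S : Finset (Fin C.rank → Bool)) :
    Prop :=
  C.core.IsDuplication (cuboid S)

/-- The clutter `𝕃₇` of the lines of the Fano plane. -/
def fanoLines : Clutter ℕ where
  ground := {1, 2, 3, 4, 5, 6, 7}
  members := {{1, 2, 3}, {1, 4, 5}, {1, 6, 7}, {2, 5, 6}, {2, 4, 7}, {3, 4, 6}, {3, 5, 7}}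
  subset_ground := by decide
  antichain := by
    have h : ∀ A ∈ ({{1, 2, 3}, {1, 4, 5}, {1, 6, 7}, {2, 5, 6}, {2, 4, 7}, {3, 4, 6},
        {3, 5, 7}} : Finset (Finset ℕ)), ∀ B ∈ ({{1, 2, 3}, {1, 4, 5}, {1, 6, 7}, {2, 5, 6},
        {2, 4, 7}, {3, 4, 6}, {3, 5, 7}} : Finset (Finset ℕ)), A ≠ B → ¬ A ⊆ B := by decide
    exact fun A hA B hB hne => h A hA B hB hne

end Clutter

/-- The set of real points with 0-1 coordinates given by a set of Boolean vectors. -/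
def realPoints {n : ℕ} (S : Finset (Fin n → Bool)) : Set (Fin n → ℝ) :=
  (fun (p : Fin n → Bool) (i : Fin n) => if p i then (1 : ℝ) else 0) '' (S : Set (Fin n → Bool))

/-- A simplex: the convex hull of finitely many (at least one) affinely independent points. -/
def IsSimplex {n : ℕ} (P : Set (Fin n → ℝ)) : Prop :=
  ∃ (m : ℕ) (s : Affine.Simplex ℝ (Fin n → ℝ) m), P = convexHull ℝ (Set.range s.points)

namespace Clutter

/-! Everything is phrased through covers. After deleting `K`, the pairs that together with `K` meet
every member form a graph. Cleanness makes this graph bipartite (`IsClean.no_odd_closed_walk`) and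
forbids certain alternating walks (`IsClean.no_alternating_walk`). Hence deleting one side of a
component and contracting the other leaves a tangled clutter (`IsTangledOn.delete_side`). Averaging
the two choices recursively yields a centred probability vector: every element lies in a random
member with probability 1/2.

If the setcore spans a simplex, the core is affinely independent, so the centred vector is unique
and its support is the set of all alternating members. Encode membership by signs ±1. By uniqueness,
the vector is the average of two slices, one for each side of any given component, so the signs of
different components are pairwise uncorrelated. Three components with no alternating member missing
all three chosen sides must then have sign product 1: they form a `Line`. Any two components lie on
a line, since otherwise the four double slices, taken with alternating signs, would be an affine
dependence (`IsSimplicial.exists_line`). Four components therefore generate a Fano plane of seven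
components.

It remains to pick one element per component so that every Fano line is a cover and no complement of
a line is one; contracting everything else then gives 𝕃₇, which is its own blocker. The union of the
three sides on a line is a cover (`IsSimplicial.meets_of_line`), and sides shrink to single elements
because a smallest cover uses at most one element of a side (`IsSimplicial.exists_mem_side`).
`Fano.meets_of_meets`, `Fano.meets_pair_side` and `Fano.meets_afg` make the choices for different
lines compatible. -/

theorem ext_of_mem {β : Type*} {D E : Clutter β} (hg : D.ground = E.ground)
    (hm : ∀ T, T ∈ D.members ↔ T ∈ E.members) : D = E := by
  obtain ⟨g, m, _, _⟩ := D
  obtain ⟨g', m', _, _⟩ := E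
  have : m = m' := Finset.ext hm
  subst this
  simp only at hg
  subst hg
  rfl

/-! ### Covers, minors, and the two forbidden minors -/

variable {α : Type*} [DecidableEq α] {C : Clutter α}

/-- The set `B` meets every member (it may contain elements outside of the ground set). -/
def Meets (C : Clutter α) (B : Finset α) : Prop := ∀ A ∈ C.members, (A ∩ B).Nonempty

theorem Meets.mono {B B' : Finset α} (h : C.Meets B) (hB : B ⊆ B') : C.Meets B' :=
  fun A hA => (h A hA).mono (Finset.inter_subset_inter_left hB)

theorem not_meets_iff {B : Finset α} : ¬ C.Meets B ↔ ∃ A ∈ C.members, Disjoint A B := by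
  simp only [Meets, not_forall, Finset.not_nonempty_iff_eq_empty, Finset.disjoint_iff_inter_eq_empty,
    exists_prop]

theorem Meets.of_insert {B : Finset α} {x : α} (h : C.Meets (insert x B)) (hx : x ∉ C.ground) :
    C.Meets B := by
  intro A hA
  obtain ⟨y, hy⟩ := h A hA
  rw [Finset.mem_inter, Finset.mem_insert] at hy
  obtain ⟨hy, rfl | hy'⟩ := hy
  · exact absurd (C.subset_ground A hA hy) hx
  · exact ⟨y, Finset.mem_inter.2 ⟨hy, hy'⟩⟩

theorem mem_minimalSets {F : Finset (Finset α)} {T : Finset α} :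
    T ∈ minimalSets F ↔ T ∈ F ∧ ∀ B ∈ F, B ⊆ T → B = T := by
  rw [minimalSets, Finset.mem_filter]

theorem exists_minimalSets_subset {F : Finset (Finset α)} {T : Finset α} (hT : T ∈ F) :
    ∃ B ∈ minimalSets F, B ⊆ T := by
  obtain ⟨B, hBT, hB⟩ := F.exists_le_minimal hT
  exact ⟨B, mem_minimalSets.2 ⟨hB.prop, fun B' hB' h => le_antisymm h (hB.le_of_le hB' h)⟩, hBT⟩

/-- The minor on the ground set `X` obtained by deleting `K`. -/
def minorOn (C : Clutter α) (K X : Finset α) : Clutter α :=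
  C.minor (K ∩ C.ground) (C.ground \ (K ∪ X))

section minorOn

variable {K X : Finset α}

theorem minorOn_isMinor (C : Clutter α) (K X : Finset α) : (C.minorOn K X).IsMinor C := by
  refine ⟨_, _, Finset.inter_subset_right, Finset.sdiff_subset, ?_, rfl⟩
  rw [Finset.disjoint_left]
  intro x hx hx'
  simp only [Finset.mem_inter, Finset.mem_sdiff, Finset.mem_union] at hx hx'
  tauto

theorem minorOn_ground (hX : X ⊆ C.ground) (hXK : Disjoint X K) :
    (C.minorOn K X).ground = X := by
  ext x
  have h1 := @hX x
  have h2 : x ∈ X → x ∉ K := fun h => Finset.disjoint_left.1 hXK h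
  simp only [minorOn, minor, Finset.mem_sdiff, Finset.mem_union, Finset.mem_inter]
  tauto

/-- A set `T ⊆ X` contains the trace on `X` of a member avoiding `K` exactly when `K ∪ X \ T` fails
to be a cover. This turns every later identification of a minor into a question about covers. -/
theorem mem_minorOn {T : Finset α} :
    T ∈ (C.minorOn K X).members ↔
      T ⊆ X ∧ ¬ C.Meets (K ∪ X \ T) ∧ ∀ T' ⊆ T, ¬ C.Meets (K ∪ X \ T') → T' = T := by
  set F := ((C.members.filter (fun A => Disjoint A (K ∩ C.ground))).image
    (fun A => A \ (C.ground \ (K ∪ X)))) with hF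
  have h1 : ∀ B ∈ F, B ⊆ X ∧ ¬ C.Meets (K ∪ X \ B) := by
    intro B hB
    rw [hF, Finset.mem_image] at hB
    obtain ⟨A, hA, rfl⟩ := hB
    rw [Finset.mem_filter] at hA
    have hAK : ∀ x ∈ A, x ∉ K := fun x hx hxK =>
      Finset.disjoint_left.1 hA.2 hx (Finset.mem_inter.2 ⟨hxK, C.subset_ground A hA.1 hx⟩)
    refine ⟨fun x hx => ?_, not_meets_iff.2 ⟨A, hA.1, Finset.disjoint_left.2 fun x hx hx' => ?_⟩⟩
    · have := C.subset_ground A hA.1 (Finset.mem_sdiff.1 hx).1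
      have := hAK x (Finset.mem_sdiff.1 hx).1
      simp only [Finset.mem_sdiff, Finset.mem_union] at hx
      tauto
    · have := hAK x hx
      simp only [Finset.mem_sdiff, Finset.mem_union] at hx'
      tauto
  have h2 : ∀ B ⊆ X, ¬ C.Meets (K ∪ X \ B) → ∃ B' ∈ F, B' ⊆ B := by
    intro B _ hB
    obtain ⟨A, hA, hAB⟩ := not_meets_iff.1 hB
    refine ⟨_, Finset.mem_image.2 ⟨A, Finset.mem_filter.2 ⟨hA, ?_⟩, rfl⟩, ?_⟩
    · exact hAB.mono_right (Finset.inter_subset_left.trans Finset.subset_union_left)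
    · intro x hx
      have h3 := Finset.disjoint_left.1 hAB (Finset.mem_sdiff.1 hx).1
      have h4 := C.subset_ground A hA (Finset.mem_sdiff.1 hx).1
      simp only [Finset.mem_sdiff, Finset.mem_union] at hx h3
      tauto
  change T ∈ minimalSets F ↔ _
  rw [mem_minimalSets]
  constructor
  · rintro ⟨hT, hmin⟩
    refine ⟨(h1 T hT).1, (h1 T hT).2, fun T' hT' hn => ?_⟩
    obtain ⟨B', hB', hB'T⟩ := h2 T' (hT'.trans (h1 T hT).1) hn
    have := hmin B' hB' (hB'T.trans hT')
    subst this
    exact hT'.antisymm hB'T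
  · rintro ⟨hTX, hT, hmin⟩
    obtain ⟨B', hB', hB'T⟩ := h2 T hTX hT
    have := hmin B' hB'T (h1 B' hB').2
    subst this
    exact ⟨hB', fun B hB hBT => hmin B hBT (h1 B hB).2⟩

end minorOn

/-- Adjacency in the graph of the pairs that, together with `K`, meet every member. -/
def AdjOn (C : Clutter α) (K : Finset α) (x y : α) : Prop := C.Meets (insert x (insert y K))

theorem AdjOn.symm {K : Finset α} {x y : α} (h : C.AdjOn K x y) : C.AdjOn K y x := by
  rwa [AdjOn, Finset.insert_comm]

theorem AdjOn.mono {K K' : Finset α} {x y : α} (h : C.AdjOn K x y) (hK : K ⊆ K') :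
    C.AdjOn K' x y :=
  Meets.mono h (Finset.insert_subset_insert _ (Finset.insert_subset_insert _ hK))

theorem AdjOn.mem_ground {K : Finset α} {x y : α} (h : C.AdjOn K x y)
    (hy : ¬ C.Meets (insert y K)) : x ∈ C.ground := by
  by_contra hx
  exact hy (Meets.of_insert h hx)

theorem AdjOn.notMem {K : Finset α} {x y : α} (h : C.AdjOn K x y)
    (hy : ¬ C.Meets (insert y K)) : x ∉ K := by
  intro hx
  apply hy
  rwa [AdjOn, Finset.insert_eq_of_mem (Finset.mem_insert_of_mem hx)] at h

theorem AdjOn.ne {K : Finset α} {x y : α} (h : C.AdjOn K x y)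
    (hy : ¬ C.Meets (insert y K)) : x ≠ y := by
  rintro rfl
  apply hy
  rwa [AdjOn, Finset.insert_idem] at h

/-- Delete `K` and contract everything outside `insert a M`. By `key`, a set contains a member of
this minor iff it meets `M` and contains either `a` or all of `M`; the minimal such sets form a
delta. -/
theorem IsClean.no_delta (hC : C.IsClean) {K M : Finset α} {a : α} (ha : a ∉ M)
    (hM : 2 ≤ M.card) (hKM : C.Meets (K ∪ M)) (haM : ∀ x ∈ M, C.AdjOn K a x)
    (haK : ¬ C.Meets (insert a K)) (hmin : ∀ x ∈ M, ¬ C.Meets (K ∪ M.erase x)) : False := by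
  have hMK : ∀ x ∈ M, x ∉ K := fun x hx => (haM x hx).symm.notMem haK
  have hMg : ∀ x ∈ M, x ∈ C.ground := fun x hx => (haM x hx).symm.mem_ground haK
  obtain ⟨x₀, hx₀⟩ : M.Nonempty := Finset.card_pos.1 (by omega)
  have hsing : ∀ x ∈ M, ¬ C.Meets (insert x K) := by
    intro x hx h
    obtain ⟨z, hz, hzx⟩ := Finset.exists_mem_ne (by omega : 1 < M.card) x
    refine hmin z hz (h.mono ?_)
    intro t ht
    rw [Finset.mem_insert] at ht
    rw [Finset.mem_union, Finset.mem_erase]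
    obtain rfl | ht := ht
    · exact Or.inr ⟨hzx.symm, hx⟩
    · exact Or.inl ht
  have hag : a ∈ C.ground := (haM x₀ hx₀).mem_ground (hsing x₀ hx₀)
  have haK' : a ∉ K := (haM x₀ hx₀).notMem (hsing x₀ hx₀)
  set X := insert a M with hXdef
  have hX : X ⊆ C.ground := by
    intro x hx
    obtain rfl | hx := Finset.mem_insert.1 hx
    exacts [hag, hMg x hx]
  have hXK : Disjoint X K := by
    rw [Finset.disjoint_left]
    intro x hx
    obtain rfl | hx := Finset.mem_insert.1 hx
    exacts [haK', hMK x hx]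
  have key : ∀ T ⊆ X, (¬ C.Meets (K ∪ X \ T) ↔ (∃ x ∈ M, x ∈ T) ∧ (a ∈ T ∨ M ⊆ T)) := by
    intro T _
    constructor
    · intro h
      constructor
      · by_contra! h'
        refine h (hKM.mono (Finset.union_subset_union_right fun x hx => ?_))
        exact Finset.mem_sdiff.2 ⟨Finset.mem_insert_of_mem hx, h' x hx⟩
      · by_contra! h'
        obtain ⟨x, hx, hxT⟩ := Finset.not_subset.1 h'.2
        refine h (Meets.mono (haM x hx) ?_)
        intro t ht
        simp only [Finset.mem_insert, Finset.mem_union, Finset.mem_sdiff, hXdef] at ht ⊢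
        obtain rfl | rfl | ht := ht
        · exact Or.inr ⟨Or.inl rfl, h'.1⟩
        · exact Or.inr ⟨Or.inr hx, hxT⟩
        · exact Or.inl ht
    · rintro ⟨⟨x, hx, hxT⟩, h2⟩ h
      obtain haT | hMT := h2
      · refine hmin x hx (h.mono (Finset.union_subset_union_right fun t ht => ?_))
        rw [Finset.mem_sdiff, hXdef, Finset.mem_insert] at ht
        obtain ⟨rfl | ht, ht'⟩ := ht
        · exact absurd haT ht'
        · exact Finset.mem_erase.2 ⟨fun h => ht' (h ▸ hxT), ht⟩
      · refine haK (h.mono fun t ht => ?_)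
        rw [Finset.mem_union, Finset.mem_sdiff, hXdef, Finset.mem_insert] at ht
        rw [Finset.mem_insert]
        obtain ht | ⟨ht | ht, ht'⟩ := ht
        · exact Or.inr ht
        · exact Or.inl ht
        · exact absurd (hMT ht) ht'
  refine (hC _ (minorOn_isMinor C K X)).1 ⟨?_, a, ?_, ?_⟩
  · rw [minorOn_ground hX hXK, hXdef, Finset.card_insert_of_notMem ha]
    omega
  · rw [minorOn_ground hX hXK]
    exact Finset.mem_insert_self _ _
  · have hXa : X.erase a = M := Finset.erase_insert ha
    ext T
    rw [minorOn_ground hX hXK, hXa, mem_minorOn, Finset.mem_insert, Finset.mem_image]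
    constructor
    · rintro ⟨hTX, hT, hTmin⟩
      obtain ⟨⟨x, hx, hxT⟩, haT | hMT⟩ := (key T hTX).1 hT
      · right
        have hs : ({a, x} : Finset α) ⊆ T := by
          simp [Finset.insert_subset_iff, haT, hxT]
        exact ⟨x, hx, hTmin _ hs ((key _ (hs.trans hTX)).2 ⟨⟨x, hx, by simp⟩, Or.inl (by simp)⟩)⟩
      · left
        exact (hTmin _ hMT ((key _ (hMT.trans hTX)).2 ⟨⟨x, hx, hx⟩, Or.inr subset_rfl⟩)).symm
    · rintro (rfl | ⟨x, hx, rfl⟩)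
      · refine ⟨Finset.subset_insert _ _, (key _ (Finset.subset_insert _ _)).2
          ⟨⟨x₀, hx₀, hx₀⟩, Or.inr subset_rfl⟩, fun T' hT' h => ?_⟩
        obtain ⟨-, h | h⟩ := (key _ (hT'.trans (Finset.subset_insert _ _))).1 h
        · exact absurd (hT' h) ha
        · exact hT'.antisymm h
      · have hs : ({a, x} : Finset α) ⊆ X := by
          simp [Finset.insert_subset_iff, hXdef, hx]
        refine ⟨hs, (key _ hs).2 ⟨⟨x, hx, by simp⟩, Or.inl (by simp)⟩, fun T' hT' h => ?_⟩
        obtain ⟨⟨z, hz, hzT⟩, h⟩ := (key _ (hT'.trans hs)).1 h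
        have hne : ∀ z ∈ M, z ∈ T' → z = x := by
          intro z hz hzT
          have := hT' hzT
          rw [Finset.mem_insert, Finset.mem_singleton] at this
          exact this.resolve_left (fun h => ha (h ▸ hz))
        obtain rfl := hne z hz hzT
        obtain h | h := h
        · exact hT'.antisymm (by simp [Finset.insert_subset_iff, h, hzT])
        · obtain ⟨z', hz', hzz'⟩ := Finset.exists_mem_ne (by omega : 1 < M.card) z
          exact absurd (hne z' hz' (h hz')) hzz'

/-- Let `H` consist of the minimal subsets of the cycle that complete `K` to a cover. Its smallest
members are the edges of the induced cycle, so it is an extended odd hole. A set `B` covers `H` iff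
`K ∪ X \ B` is not a cover, so the minor on the cycle is the blocker of `H`. -/
theorem IsClean.no_oddHole (hC : C.IsClean) {K : Finset α} {n : ℕ} (hn : 5 ≤ n) (hodd : Odd n)
    {a : ZMod n → α} (ha : Function.Injective a) (hadj : ∀ i, C.AdjOn K (a i) (a (i + 1)))
    (hsing : ∀ i, ¬ C.Meets (insert (a i) K))
    (hind : ∀ i j, C.AdjOn K (a i) (a j) → j = i + 1 ∨ i = j + 1) : False := by
  classical
  have : NeZero n := ⟨by omega⟩
  set X := Finset.univ.image a with hXdef
  have hmemX : ∀ x, x ∈ X ↔ ∃ i, a i = x := fun x => by simp [hXdef]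
  have hX : X ⊆ C.ground := by
    intro x hx
    obtain ⟨i, rfl⟩ := (hmemX x).1 hx
    exact (hadj i).mem_ground (hsing _)
  have hXK : Disjoint X K := by
    rw [Finset.disjoint_left]
    intro x hx
    obtain ⟨i, rfl⟩ := (hmemX x).1 hx
    exact (hadj i).notMem (hsing _)
  let F := X.powerset.filter (fun Y => C.Meets (K ∪ Y))
  have hF : ∀ Y, Y ∈ F ↔ Y ⊆ X ∧ C.Meets (K ∪ Y) := fun Y => by simp [F]
  let H : Clutter α :=
    { ground := X
      members := minimalSets F
      subset_ground := fun A hA => ((hF A).1 (mem_minimalSets.1 hA).1).1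
      antichain := minimalSets_antichain _ }
  have hone : (1 : ZMod n) ≠ 0 := by
    have : Fact (1 < n) := ⟨by omega⟩
    exact one_ne_zero
  have hpair : ∀ i, ({a i, a (i + 1)} : Finset α).card = 2 := fun i =>
    Finset.card_pair fun h => hone (by simpa using ha h)
  have hKpair : ∀ x y, K ∪ {x, y} = insert x (insert y K) := fun x y => by
    ext t
    simp only [Finset.mem_union, Finset.mem_insert, Finset.mem_singleton]
    tauto
  have hge : ∀ Y ∈ F, 2 ≤ Y.card := by
    intro Y hY
    obtain ⟨hYX, hYm⟩ := (hF Y).1 hY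
    by_contra! hlt
    obtain rfl | ⟨x, rfl⟩ : Y = ∅ ∨ ∃ x, Y = {x} := by
      rcases Nat.lt_succ_iff_lt_or_eq.1 hlt with h | h
      · left; exact Finset.card_eq_zero.1 (by omega)
      · right; exact Finset.card_eq_one.1 h
    · refine hsing 0 (hYm.mono ?_)
      rw [Finset.union_empty]
      exact Finset.subset_insert _ _
    · obtain ⟨i, rfl⟩ := (hmemX x).1 (hYX (Finset.mem_singleton_self x))
      refine hsing i (hYm.mono ?_)
      rw [Finset.union_comm, Finset.insert_eq]
  have hedge : ∀ i, ({a i, a (i + 1)} : Finset α) ∈ minimalSets F := by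
    intro i
    rw [mem_minimalSets]
    refine ⟨(hF _).2 ⟨?_, ?_⟩, fun B hB hBs => ?_⟩
    · intro x hx
      simp only [Finset.mem_insert, Finset.mem_singleton] at hx
      obtain rfl | rfl := hx <;> exact (hmemX _).2 ⟨_, rfl⟩
    · rw [hKpair]
      exact hadj i
    · exact Finset.eq_of_subset_of_card_le hBs (by rw [hpair]; exact hge B hB)
  have hH : H.IsExtendedOddHole := by
    refine ⟨n, hn, hodd, a, ha, ?_, ?_⟩
    · ext x
      simp [H, hmemX]
    · intro A
      constructor
      · rintro ⟨hA, hmin⟩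
        have hAF : A ∈ F := (mem_minimalSets.1 hA).1
        have hc : A.card = 2 :=
          le_antisymm ((hmin _ (hedge 0)).trans (hpair 0).le) (hge A hAF)
        obtain ⟨x, y, hxy, rfl⟩ := Finset.card_eq_two.1 hc
        obtain ⟨hAX, hAm⟩ := (hF _).1 hAF
        obtain ⟨i, rfl⟩ := (hmemX x).1 (hAX (by simp))
        obtain ⟨j, rfl⟩ := (hmemX y).1 (hAX (by simp))
        rw [hKpair] at hAm
        obtain rfl | rfl := hind i j hAm
        · exact ⟨i, rfl⟩
        · exact ⟨j, Finset.pair_comm _ _⟩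
      · rintro ⟨i, rfl⟩
        refine ⟨hedge i, fun B hB => ?_⟩
        rw [hpair]
        exact hge B (mem_minimalSets.1 hB).1
  refine (hC _ (minorOn_isMinor C K X)).2 ⟨H, hH, ?_⟩
  have hcov : ∀ B ⊆ X, (H.IsCover B ↔ ¬ C.Meets (K ∪ X \ B)) := by
    intro B hB
    constructor
    · rintro ⟨-, h⟩ hm
      obtain ⟨Y, hY, hYs⟩ := exists_minimalSets_subset ((hF (X \ B)).2 ⟨Finset.sdiff_subset, hm⟩)
      obtain ⟨x, hx⟩ := h Y hY
      rw [Finset.mem_inter] at hx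
      exact (Finset.mem_sdiff.1 (hYs hx.1)).2 hx.2
    · intro h
      refine ⟨hB, fun A hA => ?_⟩
      by_contra hne
      rw [Finset.not_nonempty_iff_eq_empty, ← Finset.disjoint_iff_inter_eq_empty] at hne
      obtain ⟨hAX, hAm⟩ := (hF A).1 (mem_minimalSets.1 hA).1
      refine h (hAm.mono (Finset.union_subset_union_right fun x hx => ?_))
      exact Finset.mem_sdiff.2 ⟨hAX hx, Finset.disjoint_left.1 hne hx⟩
  refine ext_of_mem (minorOn_ground hX hXK) fun T => ?_
  rw [mem_minorOn]
  simp only [blocker, mem_minimalSets, Finset.mem_filter, Finset.mem_powerset]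
  change _ ↔ (T ⊆ X ∧ H.IsCover T) ∧ ∀ B, B ⊆ X ∧ H.IsCover B → B ⊆ T → B = T
  constructor
  · rintro ⟨h1, h2, h3⟩
    exact ⟨⟨h1, (hcov T h1).2 h2⟩, fun B hB hBT => h3 B hBT ((hcov B hB.1).1 hB.2)⟩
  · rintro ⟨⟨h1, h2⟩, h3⟩
    exact ⟨h1, (hcov T h1).1 h2, fun B hBT hB =>
      h3 B ⟨hBT.trans h1, (hcov B (hBT.trans h1)).2 hB⟩ hBT⟩

end Clutter

/-! ### Bipartiteness and alternating walks -/

namespace Clutter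

variable {α : Type*} [DecidableEq α] {C : Clutter α}

/-- A shortest odd closed walk is a chordless cycle: length 1 would be a loop, length 3 gives a
delta, and length at least 5 gives the blocker of an extended odd hole. -/
theorem IsClean.no_odd_closed_walk (hC : C.IsClean) {K : Finset α} (n : ℕ) (hodd : Odd n)
    (w : ℕ → α) (hw : w n = w 0) (hadj : ∀ i < n, C.AdjOn K (w i) (w (i + 1)))
    (hsing : ∀ i ≤ n, ¬ C.Meets (insert (w i) K)) : False := by
  induction n using Nat.strong_induction_on generalizing w with
  | _ n ih =>
  obtain ⟨k, hk⟩ := hodd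
  obtain rfl | hn1 : n = 1 ∨ 3 ≤ n := by omega
  · exact (hadj 0 (by omega)).ne (hsing 1 le_rfl) (by rw [zero_add]; exact hw.symm)
  -- a chord splits off a shorter odd closed walk
  have hchord : ∀ i j, i < j → j < n → C.AdjOn K (w i) (w j) → j = i + 1 ∨ (i = 0 ∧ j + 1 = n) := by
    intro i j hij hjn hadj'
    by_contra! hne
    obtain ⟨hne1, hne2⟩ := hne
    have hs : ∀ i ≤ n, ¬ C.Meets (insert (w i) K) := hsing
    -- For even `j - i` the chord closes up the segment from `i` to `j`; for odd `j - i` it replaces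
    -- that segment. Both closed walks are odd and shorter.
    rcases Nat.even_or_odd (j - i) with hpar | hpar
    · obtain ⟨l, hl⟩ := hpar
      refine ih (j - i + 1) (by omega) ⟨l, by omega⟩
        (fun t => if t ≤ j - i then w (i + t) else w i) ?_ ?_ ?_
      · simp
      · intro t ht
        by_cases htj : t + 1 ≤ j - i
        · simp only [htj, (by omega : t ≤ j - i), if_true]
          exact hadj (i + t) (by omega)
        · have : t = j - i := by omega
          subst this
          simp only [le_refl, if_true, htj, if_false]
          rw [show i + (j - i) = j by omega]
          exact hadj'.symm
      · intro t _
        split_ifs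
        · exact hs _ (by omega)
        · exact hs _ (by omega)
    · obtain ⟨l, hl⟩ := hpar
      refine ih (n - (j - i) + 1) (by omega) ⟨k - l, by omega⟩
        (fun t => if t ≤ i then w t else w (t + (j - i) - 1)) ?_ ?_ ?_
      · rw [if_neg (by omega), if_pos (Nat.zero_le _), ← hw,
          show n - (j - i) + 1 + (j - i) - 1 = n by omega]
      · intro t ht
        by_cases hti : t + 1 ≤ i
        · rw [if_pos hti, if_pos (by omega)]
          exact hadj t (by omega)
        · by_cases hti' : t = i
          · subst hti'
            rw [if_pos le_rfl, if_neg hti, show t + 1 + (j - t) - 1 = j by omega]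
            exact hadj'
          · rw [if_neg hti, if_neg (by omega),
              show t + 1 + (j - i) - 1 = t + (j - i) - 1 + 1 by omega]
            exact hadj (t + (j - i) - 1) (by omega)
      · intro t _
        split_ifs
        · exact hs _ (by omega)
        · exact hs _ (by omega)
  -- At a repeated vertex, the walk edges leaving `w i` and `w j` would themselves be chords of the
  -- forbidden kind.
  have hinj : ∀ i j, i < j → j < n → w i ≠ w j := by
    intro i j hij hjn heq
    have h1 : C.AdjOn K (w i) (w (j + 1)) := heq ▸ hadj j hjn
    have h2 : j + 1 < n → False := fun h => by
      rcases hchord i (j + 1) (by omega) h h1 with h3 | h3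
      · omega
      · have h4 : C.AdjOn K (w j) (w (i + 1)) := heq ▸ hadj i (by omega)
        obtain h5 | h5 : i + 1 = j ∨ i + 1 < j := by omega
        · subst h5
          exact h4.ne (hsing _ (by omega)) rfl
        · rcases hchord (i + 1) j h5 hjn h4.symm with h6 | h6 <;> omega
    have hj : j + 1 = n := by
      by_contra h
      exact h2 (by omega)
    have h4 : C.AdjOn K (w j) (w (i + 1)) := heq ▸ hadj i (by omega)
    obtain h5 | h5 : i + 1 = j ∨ i + 1 < j := by omega
    · subst h5
      exact h4.ne (hsing _ (by omega)) rfl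
    · rcases hchord (i + 1) j h5 hjn h4.symm with h6 | h6
      · rw [hj, hw] at h1
        obtain rfl | h7 : i = 0 ∨ 0 < i := by omega
        · exact h1.ne (hsing _ (by omega)) rfl
        · rcases hchord 0 i h7 (by omega) h1.symm with h8 | h8 <;> omega
      · omega
  obtain rfl | hn5 : n = 3 ∨ 5 ≤ n := by omega
  · have h01 := hadj 0 (by omega)
    have h12 := hadj 1 (by omega)
    have h20 := hadj 2 (by omega)
    simp only [zero_add, Nat.reduceAdd, hw] at h01 h12 h20
    have hne12 := hinj 1 2 (by omega) (by omega)
    have hu : ∀ x y, K ∪ {x, y} = insert x (insert y K) := fun x y => by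
      ext t
      simp only [Finset.mem_union, Finset.mem_insert, Finset.mem_singleton]
      tauto
    have hu1 : ∀ x, K ∪ {x} = insert x K := fun x => by
      rw [Finset.union_comm, Finset.insert_eq]
    refine hC.no_delta (K := K) (M := {w 1, w 2}) (a := w 0) ?_ ?_ ?_ ?_ (hsing 0 (by omega)) ?_
    · simp only [Finset.mem_insert, Finset.mem_singleton, not_or]
      exact ⟨hinj 0 1 (by omega) (by omega), hinj 0 2 (by omega) (by omega)⟩
    · rw [Finset.card_pair hne12]
    · rw [hu]
      exact h12
    · intro x hx
      simp only [Finset.mem_insert, Finset.mem_singleton] at hx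
      obtain rfl | rfl := hx
      exacts [h01, h20.symm]
    · intro x hx
      simp only [Finset.mem_insert, Finset.mem_singleton] at hx
      obtain rfl | rfl := hx
      · rw [Finset.erase_insert (by simpa using hne12), hu1]
        exact hsing 2 (by omega)
      · rw [Finset.pair_comm, Finset.erase_insert (by simpa using hne12.symm), hu1]
        exact hsing 1 (by omega)
  · have : NeZero n := ⟨by omega⟩
    have : Fact (1 < n) := ⟨by omega⟩
    have hval : ∀ i : ZMod n, w (i + 1).val = w (i.val + 1) := by
      intro i
      have hlt := ZMod.val_lt i
      rw [ZMod.val_add, ZMod.val_one]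
      obtain h | h : i.val + 1 < n ∨ i.val + 1 = n := by omega
      · rw [Nat.mod_eq_of_lt h]
      · rw [h, Nat.mod_self, hw]
    have hsucc : ∀ i j : ZMod n, j.val = i.val + 1 → j = i + 1 := by
      intro i j h
      have := ZMod.val_lt j
      apply ZMod.val_injective
      rw [ZMod.val_add, ZMod.val_one, ← h, Nat.mod_eq_of_lt this]
    have hsucc' : ∀ i j : ZMod n, j.val = 0 → i.val + 1 = n → j = i + 1 := by
      intro i j hj h
      apply ZMod.val_injective
      rw [ZMod.val_add, ZMod.val_one, h, Nat.mod_self, hj]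
    refine hC.no_oddHole hn5 ⟨k, hk⟩ (a := fun z : ZMod n => w z.val) (K := K) ?_ ?_ ?_ ?_
    · intro i j hij
      apply ZMod.val_injective
      by_contra hne
      rcases Nat.lt_or_gt_of_ne hne with h | h
      · exact hinj _ _ h (ZMod.val_lt _) hij
      · exact hinj _ _ h (ZMod.val_lt _) hij.symm
    · intro i
      rw [hval]
      exact hadj _ (ZMod.val_lt _)
    · intro i
      exact hsing _ (ZMod.val_lt _).le
    · intro i j hij
      have hi := ZMod.val_lt i
      have hj := ZMod.val_lt j
      rcases lt_trichotomy i.val j.val with h | h | h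
      · rcases hchord _ _ h hj hij with h' | ⟨h', h''⟩
        · exact Or.inl (hsucc _ _ h')
        · exact Or.inr (hsucc' _ _ h' h'')
      · exact absurd (by rw [h]) (hij.ne (hsing _ hj.le))
      · rcases hchord _ _ h hi hij.symm with h' | ⟨h', h''⟩
        · exact Or.inr (hsucc _ _ h')
        · exact Or.inl (hsucc' _ _ h' h'')

/-- Two elements of a minimal set cannot have a common neighbour outside of the set. -/
theorem IsClean.no_common_neighbor (hC : C.IsClean) {K B : Finset α} {a x y : α} (ha : a ∉ B)
    (hx : x ∈ B) (hy : y ∈ B) (hxy : x ≠ y) (hB : C.Meets (K ∪ B))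
    (hmin : ∀ b ∈ B, ¬ C.Meets (K ∪ B.erase b)) (hax : C.AdjOn K a x) (hay : C.AdjOn K a y)
    (haK : ¬ C.Meets (insert a K)) : False := by
  classical
  -- Move into `K` a maximal part `K'` of `B` without `x`, `y` that keeps `a` from completing a
  -- cover. By maximality `a` is then adjacent to every remaining element of `B`, which yields a
  -- delta.
  obtain ⟨K', -, hK'⟩ := (((B.erase x).erase y).powerset.filter
    (fun K' => ¬ C.Meets (insert a (K ∪ K')))).exists_le_maximal (a := ∅) (by simpa using haK)
  have hK'1 := hK'.prop
  rw [Finset.mem_filter, Finset.mem_powerset] at hK'1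
  have hK'B : K' ⊆ B := fun t ht => by have := hK'1.1 ht; simp at this; tauto
  have hKu : K ∪ K' ∪ B \ K' = K ∪ B := by
    rw [Finset.union_assoc, Finset.union_sdiff_of_subset hK'B]
  have hxM : x ∈ B \ K' := Finset.mem_sdiff.2 ⟨hx, fun h => by have := hK'1.1 h; simp at this⟩
  have hyM : y ∈ B \ K' := Finset.mem_sdiff.2 ⟨hy, fun h => by have := hK'1.1 h; simp at this⟩
  refine hC.no_delta (K := K ∪ K') (M := B \ K') (a := a) ?_ ?_ ?_ ?_ hK'1.2 ?_
  · exact fun h => ha (Finset.mem_sdiff.1 h).1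
  · rw [← Finset.card_pair hxy]
    apply Finset.card_le_card
    simp [Finset.insert_subset_iff, hxM, hyM, -Finset.mem_sdiff]
  · rwa [hKu]
  · intro b hb
    by_cases hbx : b = x
    · subst hbx
      exact hax.mono Finset.subset_union_left
    by_cases hby : b = y
    · subst hby
      exact hay.mono Finset.subset_union_left
    rw [Finset.mem_sdiff] at hb
    by_contra hcon
    have := hK'.le_of_ge (y := insert b K') (Finset.mem_filter.2 ⟨?_, ?_⟩) (Finset.subset_insert _ _)
    · exact hb.2 (this (Finset.mem_insert_self _ _))
    · rw [Finset.mem_powerset, Finset.insert_subset_iff]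
      refine ⟨?_, hK'1.1⟩
      simp [hbx, hby, hb.1]
    · rwa [Finset.union_insert]
  · intro b hb h
    refine hmin b (Finset.mem_sdiff.1 hb).1 (h.mono ?_)
    intro t ht
    have h1 := @hK'B t
    simp only [Finset.mem_union, Finset.mem_erase, Finset.mem_sdiff] at ht hb ⊢
    obtain (ht | ht) | ht := ht
    · exact Or.inl ht
    · exact Or.inr ⟨fun h => hb.2 (h ▸ ht), h1 ht⟩
    · exact Or.inr ⟨ht.1, ht.2.1⟩

/-- Two elements of a smallest set inside `V` are not joined by a walk that alternates between
`V` and its complement. -/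
theorem IsClean.no_alternating_walk (hC : C.IsClean) (m : ℕ) {K V B : Finset α} (hBV : B ⊆ V)
    (hB : C.Meets (K ∪ B)) (hmin : ∀ N ⊆ V, C.Meets (K ∪ N) → B.card ≤ N.card)
    (p : ℕ → α) (h0 : p 0 ∈ B) (hm : p (2 * m) ∈ B) (hne : p 0 ≠ p (2 * m))
    (hadj : ∀ i < 2 * m, C.AdjOn K (p i) (p (i + 1)))
    (heven : ∀ i ≤ m, p (2 * i) ∈ V) (hodd : ∀ i < m, p (2 * i + 1) ∉ V)
    (hsing : ∀ i ≤ 2 * m, ¬ C.Meets (insert (p i) K)) : False := by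
  classical
  induction m using Nat.strong_induction_on generalizing K V B p with
  | _ m ih =>
  obtain rfl | hm0 := Nat.eq_zero_or_pos m
  · exact hne rfl
  obtain rfl | hm1 : m = 1 ∨ 2 ≤ m := by omega
  · have hodd0 := hodd 0 (by omega)
    simp only [mul_zero, zero_add, mul_one] at *
    refine hC.no_common_neighbor (a := p 1) (fun h => hodd0 (hBV h)) h0 hm hne hB
      (fun b hb h => ?_) (hadj 0 (by omega)).symm (hadj 1 (by omega)) (hsing 1 (by omega))
    have h1 := hmin _ ((Finset.erase_subset _ _).trans hBV) h
    have h2 := Finset.card_erase_lt_of_mem hb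
    omega
  set x := p 0 with hx
  set y := p (2 * m) with hy
  -- Again absorb as much of `B` as possible, now while no vertex of the walk completes a cover. The
  -- rest of `B` remains smallest relative to `K ∪ K'`.
  obtain ⟨K', -, hK'⟩ := (((B.erase x).erase y).powerset.filter
    (fun K' => ∀ i ≤ 2 * m, ¬ C.Meets (insert (p i) (K ∪ K')))).exists_le_maximal (a := ∅)
    (by simpa using hsing)
  have hK'1 := hK'.prop
  rw [Finset.mem_filter, Finset.mem_powerset] at hK'1
  obtain ⟨hK's, hK'n⟩ := hK'1
  have hK'B : K' ⊆ B := fun t ht => by have := hK's ht; simp at this; tauto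
  have hKu : K ∪ K' ∪ B \ K' = K ∪ B := by
    rw [Finset.union_assoc, Finset.union_sdiff_of_subset hK'B]
  have hxM : x ∈ B \ K' := Finset.mem_sdiff.2 ⟨h0, fun h => by have := hK's h; simp at this⟩
  have hyM : y ∈ B \ K' := Finset.mem_sdiff.2 ⟨hm, fun h => by have := hK's h; simp at this⟩
  -- If only `x` and `y` remain, they are adjacent and close the walk to an odd one, of length `2 *
  -- m + 1`.
  by_cases hfull : K' = (B.erase x).erase y
  · refine hC.no_odd_closed_walk (K := K ∪ K') (2 * m + 1) ⟨m, rfl⟩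
      (fun i => if i ≤ 2 * m then p i else p 0) ?_ ?_ ?_
    · simp
    · intro i hi
      by_cases him : i + 1 ≤ 2 * m
      · simp only [him, (by omega : i ≤ 2 * m), if_true]
        exact (hadj i (by omega)).mono Finset.subset_union_left
      · obtain rfl : i = 2 * m := by omega
        simp only [le_refl, if_true, him, if_false]
        refine hB.mono fun t ht => ?_
        rw [Finset.mem_union] at ht
        simp only [hfull, Finset.mem_insert, Finset.mem_union, Finset.mem_erase, ← hx, ← hy]
        tauto
    · intro i _
      split_ifs
      · exact hK'n _ (by omega)
      · exact hK'n _ (by omega)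
  obtain ⟨b, hb, hbK'⟩ : ∃ b ∈ (B.erase x).erase y, b ∉ K' := by
    by_contra! h
    exact hfull (hK's.antisymm h)
  have hb' := hb
  rw [Finset.mem_erase, Finset.mem_erase] at hb'
  obtain ⟨hby, hbx, hbB⟩ := hb'
  have hcard : K'.card + 3 ≤ B.card := by
    have h1 : insert b K' ⊆ (B.erase x).erase y := Finset.insert_subset hb hK's
    have h2 := Finset.card_le_card h1
    rw [Finset.card_insert_of_notMem hbK',
      Finset.card_erase_of_mem (Finset.mem_erase.2 ⟨hne.symm, hm⟩),
      Finset.card_erase_of_mem h0] at h2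
    omega
  obtain ⟨i, hi, hPi⟩ : ∃ i ≤ 2 * m, C.Meets (insert (p i) (K ∪ insert b K')) := by
    by_contra! hcon
    have := hK'.le_of_ge (y := insert b K')
      (Finset.mem_filter.2 ⟨Finset.mem_powerset.2 (Finset.insert_subset hb hK's), hcon⟩)
      (Finset.subset_insert _ _)
    exact hbK' (this (Finset.mem_insert_self _ _))
  -- A vertex in `V` would give a set of at most `K'.card + 2 < B.card` elements, against the choice
  -- of `B`. So the blocking vertex has odd index.
  have hiV : p i ∉ V := by
    intro hV
    have h1 := hmin (insert (p i) (insert b K'))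
      (Finset.insert_subset hV (Finset.insert_subset (hBV hbB) (hK'B.trans hBV)))
      (by rwa [Finset.union_insert])
    have h2 := Finset.card_insert_le (p i) (insert b K')
    have h3 := Finset.card_insert_le b K'
    omega
  obtain ⟨s, rfl⟩ : ∃ s, i = 2 * s + 1 := by
    rcases Nat.even_or_odd' i with ⟨s, rfl | rfl⟩
    · exact absurd (heven s (by omega)) hiV
    · exact ⟨s, rfl⟩
  have hadjb : C.AdjOn (K ∪ K') (p (2 * s + 1)) b := by
    rwa [Finset.union_insert] at hPi
  have hbsing : ¬ C.Meets (insert b (K ∪ K')) := by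
    intro h
    rw [← Finset.union_insert] at h
    have h1 := hmin _ (Finset.insert_subset (hBV hbB) (hK'B.trans hBV)) h
    have h3 := Finset.card_insert_le b K'
    omega
  have hmin' : ∀ N ⊆ V, C.Meets (K ∪ K' ∪ N) → (B \ K').card ≤ N.card := by
    intro N hN h
    rw [Finset.union_assoc] at h
    have h1 := hmin _ (Finset.union_subset (hK'B.trans hBV) hN) h
    have h2 := Finset.card_union_le K' N
    have h3 := Finset.card_sdiff_add_card_eq_card hK'B
    omega
  have hbM : b ∈ B \ K' := Finset.mem_sdiff.2 ⟨hbB, hbK'⟩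
  have hadj' : ∀ i < 2 * m, C.AdjOn (K ∪ K') (p i) (p (i + 1)) := fun i hi =>
    (hadj i hi).mono Finset.subset_union_left
  -- The vertex `p (2 * s + 1)` is adjacent to `b`, another element of the remaining set. Walking
  -- from `x` to it and on to `b` is shorter than the given walk, unless it is the last odd vertex;
  -- then the two-step walk from `b` to `y` is used.
  obtain hs | hs : s + 1 = m ∨ s + 1 < m := by omega
  · refine ih 1 (by omega) (K := K ∪ K') (V := V) (B := B \ K') (Finset.sdiff_subset.trans hBV)
      (by rwa [hKu]) hmin' (fun i => if i = 0 then b else p (2 * s + i)) ?_ ?_ ?_ ?_ ?_ ?_ ?_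
    · simpa using hbM
    · simpa [show 2 * s + 2 = 2 * m by omega] using hyM
    · simpa [show 2 * s + 2 = 2 * m by omega] using hby
    · intro i hi
      obtain rfl | rfl : i = 0 ∨ i = 1 := by omega
      · simpa using hadjb.symm
      · simpa using hadj' (2 * s + 1) (by omega)
    · intro i hi
      obtain rfl | rfl : i = 0 ∨ i = 1 := by omega
      · simpa using hBV hbB
      · simpa [show 2 * s + 2 = 2 * m by omega] using hBV hm
    · intro i hi
      obtain rfl : i = 0 := by omega
      simpa using hiV
    · intro i hi
      obtain rfl | hi0 := Nat.eq_zero_or_pos i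
      · simpa using hbsing
      · simp only [hi0.ne', if_false]
        exact hK'n _ (by omega)
  · refine ih (s + 1) (by omega) (K := K ∪ K') (V := V) (B := B \ K')
      (Finset.sdiff_subset.trans hBV) (by rwa [hKu]) hmin'
      (fun i => if i ≤ 2 * s + 1 then p i else b) ?_ ?_ ?_ ?_ ?_ ?_ ?_
    · simpa using hxM
    · simpa [show ¬ 2 * (s + 1) ≤ 2 * s + 1 by omega] using hbM
    · simp only [show ¬ 2 * (s + 1) ≤ 2 * s + 1 by omega, Nat.zero_le, if_true, if_false]
      exact fun h => hbx h.symm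
    · intro i hi
      by_cases his : i + 1 ≤ 2 * s + 1
      · simp only [his, (by omega : i ≤ 2 * s + 1), if_true]
        exact hadj' i (by omega)
      · obtain rfl : i = 2 * s + 1 := by omega
        simpa using hadjb
    · intro i hi
      split_ifs
      · exact heven i (by omega)
      · exact hBV hbB
    · intro i hi
      simp only [show 2 * i + 1 ≤ 2 * s + 1 by omega, if_true]
      exact hodd i (by omega)
    · intro i hi
      split_ifs
      · exact hK'n _ (by omega)
      · exact hbsing

end Clutter

/-! ### Sides of components and centred probability vectors -/

namespace Clutter

variable {α : Type*} [DecidableEq α] {C : Clutter α}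

/-- Reachability inside `X` by walks of even length. -/
def EvenReach (C : Clutter α) (K X : Finset α) : α → α → Prop :=
  Relation.ReflTransGen (fun x z => z ∈ X ∧ ∃ y ∈ X, C.AdjOn K x y ∧ C.AdjOn K y z)

open Classical in
/-- The elements of `X` that are reachable from `v` by walks of even length. -/
noncomputable def side (C : Clutter α) (K X : Finset α) (v : α) : Finset α :=
  X.filter (C.EvenReach K X v)

open Classical in
/-- The elements of `X` that have a neighbour on the side of `v`. -/
noncomputable def oside (C : Clutter α) (K X : Finset α) (v : α) : Finset α :=
  X.filter (fun u => ∃ y ∈ C.side K X v, C.AdjOn K y u)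

/-- The contraction to `X` of the deletion of `K` is tangled. -/
structure IsTangledOn (C : Clutter α) (K X : Finset α) : Prop where
  not_meets : ¬ C.Meets K
  single : ∀ x ∈ X, ¬ C.Meets (insert x K)
  nbr : ∀ x ∈ X, ∃ y ∈ X, C.AdjOn K x y

section sides

variable {K X : Finset α} {v x y z u : α}

theorem mem_side : x ∈ C.side K X v ↔ x ∈ X ∧ C.EvenReach K X v x := by
  classical
  rw [side, Finset.mem_filter]

theorem mem_oside : x ∈ C.oside K X v ↔ x ∈ X ∧ ∃ y ∈ C.side K X v, C.AdjOn K y x := by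
  classical
  rw [oside, Finset.mem_filter]

theorem side_subset : C.side K X v ⊆ X := fun _ h => (mem_side.1 h).1

theorem oside_subset : C.oside K X v ⊆ X := fun _ h => (mem_oside.1 h).1

theorem self_mem_side (hv : v ∈ X) : v ∈ C.side K X v := mem_side.2 ⟨hv, Relation.ReflTransGen.refl⟩

theorem mem_oside_of_adj (hx : x ∈ C.side K X v) (hy : y ∈ X) (h : C.AdjOn K x y) :
    y ∈ C.oside K X v := mem_oside.2 ⟨hy, x, hx, h⟩

theorem mem_side_of_adj (hx : x ∈ C.oside K X v) (hy : y ∈ X) (h : C.AdjOn K x y) :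
    y ∈ C.side K X v := by
  obtain ⟨hxX, z, hz, hzx⟩ := mem_oside.1 hx
  exact mem_side.2 ⟨hy, (mem_side.1 hz).2.tail ⟨hy, x, hxX, hzx, h⟩⟩

theorem EvenReach.symm (hx : x ∈ X) (h : C.EvenReach K X x y) : C.EvenReach K X y x := by
  suffices h : y ∈ X ∧ C.EvenReach K X y x from h.2
  induction h with
  | refl => exact ⟨hx, Relation.ReflTransGen.refl⟩
  | tail _ hbc ih =>
    obtain ⟨hc, t, ht, hbt, htc⟩ := hbc
    exact ⟨hc, Relation.ReflTransGen.head ⟨ih.1, t, ht, htc.symm, hbt.symm⟩ ih.2⟩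

theorem side_eq_of_mem (hv : v ∈ X) (h : x ∈ C.side K X v) : C.side K X x = C.side K X v := by
  ext t
  rw [mem_side] at h
  simp only [mem_side]
  exact and_congr_right fun _ => ⟨fun h' => h.2.trans h', fun h' => (h.2.symm hv).trans h'⟩

theorem oside_eq_of_mem (hv : v ∈ X) (h : x ∈ C.side K X v) : C.oside K X x = C.oside K X v := by
  ext t
  rw [mem_oside, mem_oside, side_eq_of_mem hv h]

theorem side_eq_of_mem_oside (hv : v ∈ X) (h : u ∈ C.oside K X v) :
    C.side K X u = C.oside K X v := by
  obtain ⟨huX, y, hy, hyu⟩ := mem_oside.1 h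
  ext t
  constructor
  · intro ht
    rw [mem_side] at ht
    obtain ⟨-, ht⟩ := ht
    induction ht with
    | refl => exact h
    | tail _ hbc ih =>
      obtain ⟨hc, s, hs, hbs, hsc⟩ := hbc
      exact mem_oside_of_adj (mem_side_of_adj ih hs hbs) hc hsc
  · intro ht
    obtain ⟨htX, z, hz, hzt⟩ := mem_oside.1 ht
    have hyz : C.EvenReach K X y z := ((mem_side.1 hy).2.symm hv).trans (mem_side.1 hz).2
    -- The invariant carried along the even walk from `y`: all neighbours of its current endpoint
    -- are on the side of `u`.
    have key : z ∈ X ∧ ∀ t ∈ X, C.AdjOn K z t → t ∈ C.side K X u := by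
      clear hz hzt
      induction hyz with
      | refl =>
        exact ⟨side_subset hy, fun t htX hzt => mem_side.2
          ⟨htX, Relation.ReflTransGen.single ⟨htX, y, side_subset hy, hyu.symm, hzt⟩⟩⟩
      | tail _ hbc ih =>
        obtain ⟨hc, s, hs, hbs, hsc⟩ := hbc
        exact ⟨hc, fun t htX hzt => mem_side.2
          ⟨htX, (mem_side.1 (ih.2 s hs hbs)).2.tail ⟨htX, _, hc, hsc, hzt⟩⟩⟩
    exact key.2 t htX hzt

theorem exists_walk (hx : x ∈ X) (h : C.EvenReach K X x y) :
    ∃ (m : ℕ) (p : ℕ → α), p 0 = x ∧ p (2 * m) = y ∧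
      (∀ i < 2 * m, C.AdjOn K (p i) (p (i + 1))) ∧ (∀ i ≤ m, p (2 * i) ∈ C.side K X x) ∧
      ∀ i < m, p (2 * i + 1) ∈ C.oside K X x := by
  induction h with
  | refl =>
    refine ⟨0, fun _ => x, rfl, rfl, by simp, fun i _ => self_mem_side hx, by simp⟩
  | tail hxb hbc ih =>
    rename_i b c
    obtain ⟨hc, s, hs, hbs, hsc⟩ := hbc
    obtain ⟨m, p, h0, hm, hadj, he, ho⟩ := ih
    have hb : b ∈ C.side K X x := hm ▸ he m le_rfl
    have hso := mem_oside_of_adj hb hs hbs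
    have hcs := mem_side_of_adj hso hc hsc
    refine ⟨m + 1, fun i => if i ≤ 2 * m then p i else if i = 2 * m + 1 then s else c,
      ?_, ?_, ?_, ?_, ?_⟩
    · simpa using h0
    · beta_reduce
      rw [if_neg (by omega), if_neg (by omega)]
    · intro i hi
      obtain h | rfl | rfl : i + 1 ≤ 2 * m ∨ i = 2 * m ∨ i = 2 * m + 1 := by omega
      all_goals beta_reduce
      · rw [if_pos h, if_pos (by omega)]
        exact hadj i (by omega)
      · rw [if_pos le_rfl, if_neg (by omega), if_pos rfl, hm]
        exact hbs
      · rw [if_neg (by omega), if_pos rfl, if_neg (by omega), if_neg (by omega)]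
        exact hsc
    · intro i hi
      obtain h | rfl : i ≤ m ∨ i = m + 1 := by omega
      all_goals beta_reduce
      · rw [if_pos (by omega)]
        exact he i h
      · rw [if_neg (by omega), if_neg (by omega)]
        exact hcs
    · intro i hi
      obtain h | rfl : i < m ∨ i = m := by omega
      all_goals beta_reduce
      · rw [if_pos (by omega)]
        exact ho i h
      · rw [if_neg (by omega), if_pos rfl]
        exact hso

/-- A common element would have an even walk to one of its own neighbours, hence an odd closed walk.
-/
theorem IsClean.disjoint_side_oside (hC : C.IsClean) (hX : ∀ x ∈ X, ¬ C.Meets (insert x K))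
    (hv : v ∈ X) : Disjoint (C.side K X v) (C.oside K X v) := by
  rw [Finset.disjoint_left]
  intro x hx hxo
  obtain ⟨hxX, y, hy, hyx⟩ := mem_oside.1 hxo
  have hxy : C.EvenReach K X x y :=
    ((mem_side.1 hx).2.symm hv).trans (mem_side.1 hy).2
  obtain ⟨m, p, h0, hm, hadj, he, ho⟩ := exists_walk hxX hxy
  refine hC.no_odd_closed_walk (K := K) (2 * m + 1) ⟨m, rfl⟩
      (fun i => if i ≤ 2 * m then p i else p 0) ?_ ?_ ?_
  · simp
  · intro i hi
    obtain h | rfl : i + 1 ≤ 2 * m ∨ i = 2 * m := by omega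
    · rw [if_pos h, if_pos (by omega)]
      exact hadj i (by omega)
    · rw [if_pos le_rfl, if_neg (by omega), hm, h0]
      exact hyx
  · intro i _
    split_ifs
    · rcases Nat.even_or_odd' i with ⟨s, rfl | rfl⟩
      · exact hX _ (side_subset (he s (by omega)))
      · exact hX _ (oside_subset (ho s (by omega)))
    · rw [h0]
      exact hX _ hxX

/-- A smallest set inside `V` has at most one element on a side contained in `V`. -/
theorem IsClean.eq_of_mem_side (hC : C.IsClean) (hX : ∀ x ∈ X, ¬ C.Meets (insert x K))
    (hv : v ∈ X) {V B : Finset α} (hsV : C.side K X v ⊆ V) (hoV : Disjoint (C.oside K X v) V)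
    (hBV : B ⊆ V) (hB : C.Meets (K ∪ B)) (hmin : ∀ N ⊆ V, C.Meets (K ∪ N) → B.card ≤ N.card)
    (hxB : x ∈ B) (hx : x ∈ C.side K X v) (hyB : y ∈ B) (hy : y ∈ C.side K X v) : x = y := by
  by_contra hxy
  have h : C.EvenReach K X x y := ((mem_side.1 hx).2.symm hv).trans (mem_side.1 hy).2
  obtain ⟨m, p, rfl, rfl, hadj, he, ho⟩ := exists_walk (mem_side.1 hx).1 h
  rw [side_eq_of_mem hv hx] at he
  rw [oside_eq_of_mem hv hx] at ho
  refine hC.no_alternating_walk m hBV hB hmin p hxB hyB hxy hadj (fun i hi => hsV (he i hi))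
    (fun i hi => Finset.disjoint_left.1 hoV (ho i hi)) fun i hi => ?_
  rcases Nat.even_or_odd' i with ⟨s, rfl | rfl⟩
  · exact hX _ (side_subset (he s (by omega)))
  · exact hX _ (oside_subset (ho s (by omega)))

end sides

theorem exists_smallest {K V : Finset α} (h : C.Meets (K ∪ V)) :
    ∃ B ⊆ V, C.Meets (K ∪ B) ∧ ∀ N ⊆ V, C.Meets (K ∪ N) → B.card ≤ N.card := by
  classical
  obtain ⟨B, hB, hmin⟩ := Finset.exists_min_image (V.powerset.filter (fun B => C.Meets (K ∪ B)))
    Finset.card ⟨V, by simpa using h⟩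
  simp only [Finset.mem_filter, Finset.mem_powerset] at hB hmin
  exact ⟨B, hB.1, hB.2, fun N h1 h2 => hmin N ⟨h1, h2⟩⟩

/-- Deleting one side of a component and contracting the other keeps the clutter tangled. -/
theorem IsTangledOn.delete_side (hC : C.IsClean) {K X : Finset α} (h : C.IsTangledOn K X) {v : α}
    (hv : v ∈ X) :
    C.IsTangledOn (K ∪ C.side K X v) (X \ (C.side K X v ∪ C.oside K X v)) := by
  have hdis := hC.disjoint_side_oside h.single hv
  -- A smallest completing set inside the side together with `w` has at most one element `x` of the
  -- side. So either `w` alone completes a cover, or `x` and `w` are adjacent and `w` is on the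
  -- opposite side. The case `w = v` shows that the deleted side itself does not complete a cover.
  have key : ∀ w ∈ insert v (X \ (C.side K X v ∪ C.oside K X v)),
      ¬ C.Meets (insert w (K ∪ C.side K X v)) := by
    intro w hw hm
    have hwo : w ∉ C.oside K X v := by
      obtain rfl | hw := Finset.mem_insert.1 hw
      · exact Finset.disjoint_left.1 hdis (self_mem_side hv)
      · intro h
        simp [h] at hw
    have hwX : w ∈ X := by
      obtain rfl | hw := Finset.mem_insert.1 hw
      exacts [hv, (Finset.mem_sdiff.1 hw).1]
    rw [← Finset.union_insert] at hm
    obtain ⟨B, hBV, hB, hmin⟩ := exists_smallest hm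
    have hodis : Disjoint (C.oside K X v) (insert w (C.side K X v)) := by
      rw [Finset.disjoint_left]
      intro t ht ht'
      obtain rfl | ht' := Finset.mem_insert.1 ht'
      exacts [hwo ht, Finset.disjoint_left.1 hdis ht' ht]
    have huniq : ∀ x ∈ B, ∀ y ∈ B, x ∈ C.side K X v → y ∈ C.side K X v → x = y :=
      fun x hx y hy hxs hys => hC.eq_of_mem_side h.single hv (Finset.subset_insert _ _) hodis hBV
        hB hmin hx hxs hy hys
    by_cases hex : ∃ x ∈ B, x ∈ C.side K X v
    · obtain ⟨x, hx, hxs⟩ := hex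
      have hadj : C.AdjOn K x w := by
        refine hB.mono fun t ht => ?_
        simp only [Finset.mem_union, Finset.mem_insert] at ht ⊢
        obtain ht | ht := ht
        · exact Or.inr (Or.inr ht)
        · obtain rfl | ht' := Finset.mem_insert.1 (hBV ht)
          · exact Or.inr (Or.inl rfl)
          · exact Or.inl (huniq _ ht _ hx ht' hxs)
      exact hwo (mem_oside_of_adj hxs hwX hadj)
    · push Not at hex
      refine h.single w hwX (hB.mono fun t ht => ?_)
      rw [Finset.mem_union] at ht
      rw [Finset.mem_insert]
      obtain ht | ht := ht
      · exact Or.inr ht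
      · exact Or.inl ((Finset.mem_insert.1 (hBV ht)).resolve_right (hex t ht))
  refine ⟨fun hm => key v (Finset.mem_insert_self _ _) (hm.mono (Finset.subset_insert _ _)),
    fun x hx => key x (Finset.mem_insert_of_mem hx), fun x hx => ?_⟩
  rw [Finset.mem_sdiff, Finset.mem_union, not_or] at hx
  obtain ⟨y, hy, hxy⟩ := h.nbr x hx.1
  refine ⟨y, ?_, hxy.mono Finset.subset_union_left⟩
  rw [Finset.mem_sdiff, Finset.mem_union, not_or]
  exact ⟨hy, fun h => hx.2.2 (mem_oside_of_adj h hx.1 hxy.symm),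
    fun h => hx.2.1 (mem_side_of_adj h hx.1 hxy.symm)⟩

/-- A probability vector on the members disjoint from `K` that is centred on `X`: every element of
`X` is in a random member with probability one half. -/
structure IsCentred (C : Clutter α) (K X : Finset α) (w : Finset α → ℝ) : Prop where
  nonneg : ∀ A ∈ C.members, 0 ≤ w A
  sum_eq : ∑ A ∈ C.members, w A = 1
  disjoint : ∀ A ∈ C.members, w A ≠ 0 → Disjoint A K
  half : ∀ x ∈ X, ∑ A ∈ C.members with x ∈ A, w A = 1 / 2

theorem mem_of_adjOn {K A : Finset α} {x y : α} (h : C.AdjOn K x y) (hA : A ∈ C.members)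
    (hAK : Disjoint A K) (hx : x ∉ A) : y ∈ A := by
  obtain ⟨t, ht⟩ := h A hA
  simp only [Finset.mem_inter, Finset.mem_insert] at ht
  obtain ⟨ht, rfl | rfl | ht'⟩ := ht
  · exact absurd ht hx
  · exact ht
  · exact absurd ht' (Finset.disjoint_left.1 hAK ht)

theorem IsCentred.sum_filter_eq_zero {K X : Finset α} {w : Finset α → ℝ} (h : C.IsCentred K X w)
    {x : α} (hx : x ∈ K) : ∑ A ∈ C.members with x ∈ A, w A = 0 := by
  refine Finset.sum_eq_zero fun A hA => ?_
  rw [Finset.mem_filter] at hA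
  by_contra hne
  exact Finset.disjoint_left.1 (h.disjoint A hA.1 hne) hA.2 hx

theorem IsCentred.sum_filter_eq_one {K X : Finset α} {w : Finset α → ℝ} (h : C.IsCentred K X w)
    {x y : α} (hxy : C.AdjOn K x y) (hx : x ∈ K) : ∑ A ∈ C.members with y ∈ A, w A = 1 := by
  rw [← h.sum_eq, Finset.sum_filter]
  refine Finset.sum_congr rfl fun A hA => ?_
  split_ifs with hy
  · rfl
  · by_contra hne
    have hd := h.disjoint A hA (Ne.symm hne)
    exact hy (mem_of_adjOn hxy hA hd fun hxA => Finset.disjoint_left.1 hd hxA hx)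

/-- An element of `K₁` lies in no member weighted by `w₁` and, having a neighbour in `K₂`, in every
member weighted by `w₂`; its average probability is 1/2. -/
theorem IsCentred.average {K K₁ K₂ X X' : Finset α} {w₁ w₂ : Finset α → ℝ}
    (h₁ : C.IsCentred (K ∪ K₁) X' w₁) (h₂ : C.IsCentred (K ∪ K₂) X' w₂)
    (h : ∀ x ∈ X, x ∈ X' ∨ (x ∈ K₁ ∧ ∃ y ∈ K₂, C.AdjOn K y x) ∨
      (x ∈ K₂ ∧ ∃ y ∈ K₁, C.AdjOn K y x)) :
    C.IsCentred K X (fun A => (w₁ A + w₂ A) / 2) := by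
  constructor
  · intro A hA
    have := h₁.nonneg A hA
    have := h₂.nonneg A hA
    positivity
  · rw [← Finset.sum_div, Finset.sum_add_distrib, h₁.sum_eq, h₂.sum_eq]
    norm_num
  · intro A hA hne
    by_cases h1 : w₁ A = 0
    · have h2 : w₂ A ≠ 0 := fun h2 => hne (by simp [h1, h2])
      exact (h₂.disjoint A hA h2).mono_right Finset.subset_union_left
    · exact (h₁.disjoint A hA h1).mono_right Finset.subset_union_left
  · intro x hx
    rw [← Finset.sum_div, Finset.sum_add_distrib]
    obtain hx | ⟨hx, y, hy, hyx⟩ | ⟨hx, y, hy, hyx⟩ := h x hx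
    · rw [h₁.half x hx, h₂.half x hx]
      norm_num
    · rw [h₁.sum_filter_eq_zero (Finset.mem_union_right _ hx), h₂.sum_filter_eq_one
        (hyx.mono Finset.subset_union_left) (Finset.mem_union_right _ hy)]
      norm_num
    · rw [h₂.sum_filter_eq_zero (Finset.mem_union_right _ hx), h₁.sum_filter_eq_one
        (hyx.mono Finset.subset_union_left) (Finset.mem_union_right _ hy)]
      norm_num

/-- Induction on `X.card`: for one component, delete either side and contract the other, then
average the two vectors obtained. For empty `X`, a point mass on a member avoiding `K` works. -/
theorem IsTangledOn.exists_isCentred (hC : C.IsClean) {K X : Finset α} (h : C.IsTangledOn K X) :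
    ∃ w, C.IsCentred K X w := by
  induction hn : X.card using Nat.strong_induction_on generalizing K X with
  | _ n ih =>
  subst hn
  obtain rfl | ⟨v, hv⟩ := X.eq_empty_or_nonempty
  · obtain ⟨A₀, hA₀, hd⟩ := not_meets_iff.1 h.not_meets
    refine ⟨fun A => if A = A₀ then 1 else 0, ?_, ?_, ?_, by simp⟩
    · intro A _
      positivity
    · simp [hA₀]
    · intro A _ hne
      obtain rfl : A = A₀ := by
        by_contra h
        exact hne (if_neg h)
      exact hd
  · obtain ⟨u, hu, hvu⟩ := h.nbr v hv
    have huo := mem_oside_of_adj (self_mem_side hv) hu hvu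
    have hvo : v ∈ C.oside K X u := mem_oside_of_adj (self_mem_side hu) hv hvu.symm
    have hsu := side_eq_of_mem_oside hv huo
    have hou : C.oside K X u = C.side K X v := (side_eq_of_mem_oside hu hvo).symm
    have hlt : (X \ (C.side K X v ∪ C.oside K X v)).card < X.card := by
      refine Finset.card_lt_card ⟨Finset.sdiff_subset, fun hsub => ?_⟩
      have := hsub hv
      simp [self_mem_side hv] at this
    have h1 := h.delete_side hC hv
    have h2 := h.delete_side hC hu
    rw [hsu, hou, Finset.union_comm (C.oside K X v)] at h2
    obtain ⟨w₁, hw₁⟩ := ih _ hlt h1 rfl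
    obtain ⟨w₂, hw₂⟩ := ih _ hlt h2 rfl
    refine ⟨_, hw₁.average hw₂ fun x hx => ?_⟩
    by_cases hxs : x ∈ C.side K X v
    · right; left
      refine ⟨hxs, ?_⟩
      rw [← hou] at hxs
      obtain ⟨-, y, hy, hyx⟩ := mem_oside.1 hxs
      exact ⟨y, hsu ▸ hy, hyx⟩
    by_cases hxo : x ∈ C.oside K X v
    · right; right
      exact ⟨hxo, (mem_oside.1 hxo).2⟩
    · left
      simp [hx, hxs, hxo]

end Clutter

/-! ### Alternating members; uncorrelated signs in the simplex case -/

namespace Clutter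

variable {α : Type*} [DecidableEq α] {C : Clutter α}

/-- The set `A` contains exactly one of the two ends of every edge of the graph of `C`. -/
def Alternates (C : Clutter α) (A : Finset α) : Prop :=
  ∀ x ∈ C.ground, ∀ y ∈ C.ground, C.AdjOn ∅ x y → (x ∈ A ↔ y ∉ A)

/-- The set `A` contains exactly one of the two sides of the component of `v`. -/
def AlternatesAt (C : Clutter α) (A : Finset α) (v : α) : Prop :=
  ∀ x ∈ C.side ∅ C.ground v, ∀ y ∈ C.oside ∅ C.ground v, C.AdjOn ∅ x y → (x ∈ A ↔ y ∉ A)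

theorem Alternates.at {A : Finset α} (h : C.Alternates A) (v : α) : C.AlternatesAt A v :=
  fun x hx y hy hxy => h x (side_subset hx) y (oside_subset hy) hxy

theorem AlternatesAt.mem_side {A : Finset α} {v x : α} (h : C.AlternatesAt A v)
    (hv : v ∈ C.ground) (hx : x ∈ C.side ∅ C.ground v) : x ∈ A ↔ v ∈ A := by
  suffices hs : x ∈ C.side ∅ C.ground v ∧ (x ∈ A ↔ v ∈ A) from hs.2
  have hvx := (Clutter.mem_side.1 hx).2
  clear hx
  induction hvx with
  | refl => exact ⟨self_mem_side hv, Iff.rfl⟩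
  | tail _ hbc ih =>
    obtain ⟨hc, s, hs, hbs, hsc⟩ := hbc
    have hso := mem_oside_of_adj ih.1 hs hbs
    have hcs := mem_side_of_adj hso hc hsc
    have h1 := h _ ih.1 _ hso hbs
    have h2 := h _ hcs _ hso hsc.symm
    exact ⟨hcs, by tauto⟩

theorem AlternatesAt.mem_oside {A : Finset α} {v x : α} (h : C.AlternatesAt A v)
    (hv : v ∈ C.ground) (hx : x ∈ C.oside ∅ C.ground v) : x ∈ A ↔ v ∉ A := by
  obtain ⟨-, y, hy, hyx⟩ := Clutter.mem_oside.1 hx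
  have h1 := h y hy x hx hyx
  have h2 := h.mem_side hv hy
  tauto

/-- A member of positive weight contains at least one end of the edge, and the expected number of
ends is 1/2 + 1/2 = 1, so it contains exactly one. -/
theorem IsCentred.alternates {K X A : Finset α} {w : Finset α → ℝ} (h : C.IsCentred K X w)
    (hA : A ∈ C.members) (hwA : w A ≠ 0) {x y : α} (hx : x ∈ X) (hy : y ∈ X)
    (hxy : C.AdjOn K x y) : x ∈ A ↔ y ∉ A := by
  constructor
  · intro hxA hyA
    have hsum : ∑ B ∈ C.members, w B * ((if x ∈ B then 1 else 0) + (if y ∈ B then 1 else 0) - 1)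
        = 0 := by
      simp only [mul_sub, mul_add, Finset.sum_sub_distrib, Finset.sum_add_distrib, mul_ite,
        mul_one, mul_zero, ← Finset.sum_filter, h.half x hx, h.half y hy, h.sum_eq]
      norm_num
    rw [Finset.sum_eq_zero_iff_of_nonneg] at hsum
    · have := hsum A hA
      simp [hxA, hyA, hwA] at this
    · intro B hB
      by_cases hwB : w B = 0
      · simp [hwB]
      · refine mul_nonneg (h.nonneg B hB) ?_
        by_cases hxB : x ∈ B
        · split_ifs <;> norm_num
        · simp [hxB, mem_of_adjOn hxy hB (h.disjoint B hB hwB) hxB]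
  · intro hyA
    exact mem_of_adjOn hxy.symm hA (h.disjoint A hA hwA) hyA

theorem IsCentred.alternates_of_forall {K X A : Finset α} {w : Finset α → ℝ}
    (h : C.IsCentred K X w)
    (hKX : ∀ x ∈ C.ground, ∀ y ∈ C.ground, C.AdjOn ∅ x y → (x ∈ X ∧ y ∈ X) ∨ x ∈ K ∨ y ∈ K)
    (hA : A ∈ C.members) (hwA : w A ≠ 0) : C.Alternates A := by
  intro x hx y hy hxy
  have hd := h.disjoint A hA hwA
  obtain ⟨hx', hy'⟩ | hxK | hyK := hKX x hx y hy hxy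
  · exact h.alternates hA hwA hx' hy' (hxy.mono (Finset.empty_subset _))
  · have hxA : x ∉ A := fun h => Finset.disjoint_left.1 hd h hxK
    have := mem_of_adjOn hxy hA (Finset.disjoint_empty_right A) hxA
    tauto
  · have hyA : y ∉ A := fun h => Finset.disjoint_left.1 hd h hyK
    have := mem_of_adjOn hxy.symm hA (Finset.disjoint_empty_right A) hyA
    tauto

/-- The elements `p` and `q` lie in different components of the graph of `C`. -/
def Indep (C : Clutter α) (p q : α) : Prop :=
  q ∉ C.side ∅ C.ground p ∧ q ∉ C.oside ∅ C.ground p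

theorem mem_side_comm {p q : α} (hp : p ∈ C.ground) (hq : q ∈ C.side ∅ C.ground p) :
    p ∈ C.side ∅ C.ground q := by
  rw [side_eq_of_mem hp hq]
  exact self_mem_side hp

theorem mem_oside_comm {p q : α} (hp : p ∈ C.ground) (hq : q ∈ C.oside ∅ C.ground p) :
    p ∈ C.oside ∅ C.ground q := by
  obtain ⟨hqg, y, hy, hyq⟩ := mem_oside.1 hq
  rw [← side_eq_of_mem_oside hqg (mem_oside_of_adj (self_mem_side hqg) (side_subset hy) hyq.symm),
    side_eq_of_mem hp hy]
  exact self_mem_side hp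

theorem Indep.symm {p q : α} (hq : q ∈ C.ground) (h : C.Indep p q) : C.Indep q p :=
  ⟨fun h' => h.1 (mem_side_comm hq h'), fun h' => h.2 (mem_oside_comm hq h')⟩

theorem oside_eq_of_mem_oside {p q : α} (hp : p ∈ C.ground) (hq : q ∈ C.oside ∅ C.ground p) :
    C.oside ∅ C.ground q = C.side ∅ C.ground p :=
  (side_eq_of_mem_oside (oside_subset hq) (mem_oside_comm hp hq)).symm

/-- The sign of `x` with respect to `A`: `1` if `x` is in `A` and `-1` otherwise. -/
noncomputable def sgn (A : Finset α) (x : α) : ℝ := if x ∈ A then 1 else -1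

theorem IsCentred.sum_sgn {K X : Finset α} {w : Finset α → ℝ} (h : C.IsCentred K X w) {x : α}
    (hx : x ∈ X) : ∑ A ∈ C.members, w A * sgn A x = 0 := by
  have h1 : ∀ A, w A * sgn A x = 2 * (if x ∈ A then w A else 0) - w A := by
    intro A
    rw [sgn]
    split_ifs <;> ring
  simp only [h1, Finset.sum_sub_distrib, ← Finset.mul_sum, ← Finset.sum_filter, h.half x hx,
    h.sum_eq]
  norm_num

/-- The clutter is tangled and clean, and the members of the core are affinely independent. -/
structure IsSimplicial (C : Clutter α) : Prop where
  clean : C.IsClean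
  tangled : C.IsTangledOn ∅ C.ground
  indep : ∀ c : Finset α → ℝ, (∀ A ∈ C.members, c A ≠ 0 → A ∈ C.core.members) →
    ∑ A ∈ C.members, c A = 0 → (∀ v ∈ C.ground, ∑ A ∈ C.members with v ∈ A, c A = 0) →
    ∀ A ∈ C.members, c A = 0

section

variable {v p q t : α}

/-- Doubling a centred vector gives a fractional packing of value two. -/
theorem IsCentred.mem_core {w : Finset α → ℝ} (h : C.IsCentred ∅ C.ground w) {A : Finset α}
    (hA : A ∈ C.members) (hwA : w A ≠ 0) : A ∈ C.core.members := by
  classical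
  simp only [core, Finset.mem_filter]
  refine ⟨hA, fun B => 2 * w B, ⟨fun B hB => ?_, fun v hv => ?_⟩, ?_, ?_⟩
  · have := h.nonneg B hB
    positivity
  · have := h.half v hv
    rw [← Finset.mul_sum]
    linarith
  · rw [← Finset.mul_sum, h.sum_eq]
    norm_num
  · have := (h.nonneg A hA).lt_of_ne' hwA
    positivity

theorem IsTangledOn.exists_slice (hC : C.IsClean) (hT : C.IsTangledOn ∅ C.ground)
    (hv : v ∈ C.ground) : ∃ w, C.IsCentred (C.side ∅ C.ground v)
      (C.ground \ (C.side ∅ C.ground v ∪ C.oside ∅ C.ground v)) w := by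
  have h := hT.delete_side hC hv
  rw [Finset.empty_union] at h
  exact h.exists_isCentred hC

theorem slice_adj : ∀ x ∈ C.ground, ∀ y ∈ C.ground, C.AdjOn ∅ x y →
    (x ∈ C.ground \ (C.side ∅ C.ground v ∪ C.oside ∅ C.ground v) ∧
      y ∈ C.ground \ (C.side ∅ C.ground v ∪ C.oside ∅ C.ground v)) ∨
      x ∈ C.side ∅ C.ground v ∨ y ∈ C.side ∅ C.ground v := by
  intro x hx y hy hxy
  have h1 : x ∈ C.side ∅ C.ground v → y ∈ C.oside ∅ C.ground v := fun h =>
    mem_oside_of_adj h hy hxy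
  have h2 : x ∈ C.oside ∅ C.ground v → y ∈ C.side ∅ C.ground v := fun h =>
    mem_side_of_adj h hy hxy
  have h3 : y ∈ C.oside ∅ C.ground v → x ∈ C.side ∅ C.ground v := fun h =>
    mem_side_of_adj h hx hxy.symm
  simp only [Finset.mem_sdiff, Finset.mem_union]
  tauto

theorem average_slices {w₁ w₂ : Finset α → ℝ} {u : α} (hv : v ∈ C.ground)
    (hu : u ∈ C.oside ∅ C.ground v)
    (h₁ : C.IsCentred (C.side ∅ C.ground v)
      (C.ground \ (C.side ∅ C.ground v ∪ C.oside ∅ C.ground v)) w₁)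
    (h₂ : C.IsCentred (C.side ∅ C.ground u)
      (C.ground \ (C.side ∅ C.ground u ∪ C.oside ∅ C.ground u)) w₂) :
    C.IsCentred ∅ C.ground (fun A => (w₁ A + w₂ A) / 2) := by
  have hou := oside_eq_of_mem_oside hv hu
  have hsu := side_eq_of_mem_oside hv hu
  rw [hou, hsu, Finset.union_comm (C.oside _ _ _)] at h₂
  refine IsCentred.average (K₁ := C.side ∅ C.ground v) (K₂ := C.oside ∅ C.ground v)
    (by rwa [Finset.empty_union]) (by rwa [Finset.empty_union]) fun x hx => ?_
  by_cases hxs : x ∈ C.side ∅ C.ground v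
  · right; left
    have h := hxs
    rw [← hou] at h
    obtain ⟨-, y, hy, hyx⟩ := mem_oside.1 h
    exact ⟨hxs, y, hsu ▸ hy, hyx⟩
  by_cases hxo : x ∈ C.oside ∅ C.ground v
  · right; right
    exact ⟨hxo, (mem_oside.1 hxo).2⟩
  · left
    simp [hx, hxs, hxo]

/-- A member that alternates has positive weight in some centred probability vector. -/
theorem IsTangledOn.exists_isCentred_pos (hC : C.IsClean) (hT : C.IsTangledOn ∅ C.ground)
    {A : Finset α} (hA : A ∈ C.members) (hAlt : C.Alternates A) :
    ∃ w, C.IsCentred ∅ C.ground w ∧ 0 < w A := by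
  have hAg := C.subset_ground A hA
  have hslice : ∀ v ∈ C.ground, ∃ w, C.IsCentred (C.side ∅ C.ground v)
      (C.ground \ (C.side ∅ C.ground v ∪ C.oside ∅ C.ground v)) w :=
    fun v hv => hT.exists_slice hC hv
  choose! W hW using hslice
  -- Mix the point mass at `A` with the slices avoiding the side of `v`, for `v ∈ A`, with weights
  -- `k v` that sum to 1 over each side. The slices belonging to a side contained in `A` have total
  -- weight 1 and avoid that side, so they cancel the bias that `A` creates there. `T` is the total
  -- mass.
  obtain ⟨k, hk⟩ : ∃ k : α → ℝ, ∀ v, k v = ((C.side ∅ C.ground v).card : ℝ)⁻¹ :=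
    ⟨_, fun _ => rfl⟩
  have hk0 : ∀ v, 0 ≤ k v := fun v => by rw [hk]; positivity
  obtain ⟨T, hTdef⟩ : ∃ T : ℝ, T = 1 + ∑ v ∈ A, k v := ⟨_, rfl⟩
  have hTpos : 0 < T := by
    have := Finset.sum_nonneg fun v (_ : v ∈ A) => hk0 v
    linarith
  have hksum : ∀ v ∈ C.ground, ∑ x ∈ C.side ∅ C.ground v, k x = 1 := by
    intro v hv
    have h1 : ∀ x ∈ C.side ∅ C.ground v, k x = k v := fun x hx => by
      rw [hk, hk, side_eq_of_mem hv hx]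
    have h2 : ((C.side ∅ C.ground v).card : ℝ) ≠ 0 := by
      have := Finset.card_pos.2 ⟨v, self_mem_side (C := C) (K := ∅) hv⟩
      positivity
    rw [Finset.sum_congr rfl h1, Finset.sum_const, nsmul_eq_mul, hk]
    exact mul_inv_cancel₀ h2
  have hnn : ∀ v ∈ A, ∀ B ∈ C.members, 0 ≤ W v B := fun v hv B hB => (hW v (hAg hv)).nonneg B hB
  obtain ⟨w, hw⟩ : ∃ w : Finset α → ℝ,
      ∀ B, w B = ((if B = A then 1 else 0) + ∑ v ∈ A, k v * W v B) / T := ⟨_, fun _ => rfl⟩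
  have hsw : ∀ s ⊆ C.members, ∑ B ∈ s, w B =
      ((if A ∈ s then 1 else 0) + ∑ v ∈ A, k v * ∑ B ∈ s, W v B) / T := by
    intro s _
    rw [Finset.sum_congr rfl fun B _ => hw B, ← Finset.sum_div, Finset.sum_add_distrib,
      Finset.sum_comm]
    rw [Finset.sum_ite_eq' s A (fun _ => (1 : ℝ)), Finset.sum_congr rfl fun v _ =>
      (Finset.mul_sum s (W v) (k v)).symm]
  have hsum0 : ∀ B ∈ C.members, 0 ≤ ∑ v ∈ A, k v * W v B := fun B hB =>
    Finset.sum_nonneg fun v hv => mul_nonneg (hk0 v) (hnn v hv B hB)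
  refine ⟨w, ⟨fun B hB => ?_, ?_, fun _ _ _ => Finset.disjoint_empty_right _, fun z hz => ?_⟩, ?_⟩
  · have := hsum0 B hB
    rw [hw]
    refine div_nonneg (add_nonneg ?_ this) hTpos.le
    split_ifs <;> norm_num
  · rw [hsw _ subset_rfl, if_pos hA, div_eq_one_iff_eq hTpos.ne', hTdef]
    congr 1
    refine Finset.sum_congr rfl fun v hv => ?_
    rw [(hW v (hAg hv)).sum_eq, mul_one]
  · rw [hsw _ (Finset.filter_subset _ _)]
    by_cases hzA : z ∈ A
    · have hsA : C.side ∅ C.ground z ⊆ A := fun x hx => ((hAlt.at z).mem_side hz hx).2 hzA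
      have h1 : ∀ v ∈ A, k v * ∑ B ∈ C.members with z ∈ B, W v B =
          1 / 2 * k v - 1 / 2 * (if v ∈ C.side ∅ C.ground z then k v else 0) := by
        intro v hv
        have hvg := hAg hv
        split_ifs with hvz
        · rw [(hW v hvg).sum_filter_eq_zero (mem_side_comm hz hvz)]
          ring
        · rw [(hW v hvg).half z]
          · ring
          · simp only [Finset.mem_sdiff, Finset.mem_union, not_or]
            refine ⟨hz, fun h => hvz (mem_side_comm hvg h), fun h => ?_⟩
            have := (hAlt.at v).mem_oside hvg h
            tauto
      rw [Finset.sum_congr rfl h1, Finset.sum_sub_distrib, ← Finset.mul_sum, ← Finset.mul_sum,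
        ← Finset.sum_filter, Finset.filter_mem_eq_inter, Finset.inter_eq_right.2 hsA, hksum z hz,
        if_pos (by simp [hA, hzA]), div_eq_iff hTpos.ne', hTdef]
      ring
    · have hsA : C.oside ∅ C.ground z ⊆ A := fun x hx => ((hAlt.at z).mem_oside hz hx).2 hzA
      have h1 : ∀ v ∈ A, k v * ∑ B ∈ C.members with z ∈ B, W v B =
          1 / 2 * k v + 1 / 2 * (if v ∈ C.oside ∅ C.ground z then k v else 0) := by
        intro v hv
        have hvg := hAg hv
        split_ifs with hvz
        · obtain ⟨-, y, hy, hyz⟩ := mem_oside.1 (mem_oside_comm hz hvz)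
          rw [(hW v hvg).sum_filter_eq_one (hyz.mono (Finset.empty_subset _)) hy]
          ring
        · rw [(hW v hvg).half z]
          · ring
          · simp only [Finset.mem_sdiff, Finset.mem_union, not_or]
            refine ⟨hz, fun h => ?_, fun h => hvz (mem_oside_comm hvg h)⟩
            have := (hAlt.at v).mem_side hvg h
            tauto
      obtain ⟨u, hu, hzu⟩ := hT.nbr z hz
      have huo := mem_oside_of_adj (self_mem_side hz) hu hzu
      have hk1 : ∑ x ∈ C.oside ∅ C.ground z, k x = 1 := by
        rw [← side_eq_of_mem_oside hz huo]
        exact hksum u hu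
      rw [Finset.sum_congr rfl h1, Finset.sum_add_distrib, ← Finset.mul_sum, ← Finset.mul_sum,
        ← Finset.sum_filter, Finset.filter_mem_eq_inter, Finset.inter_eq_right.2 hsA, hk1,
        if_neg (by simp [hzA]), div_eq_iff hTpos.ne', hTdef]
      ring
  · have := hsum0 A hA
    rw [hw, if_pos rfl]
    exact div_pos (by linarith) hTpos

/-- The difference of two centred vectors is an affine dependence among members of the core. -/
theorem IsSimplicial.eq_of_isCentred (h : C.IsSimplicial) {w w' : Finset α → ℝ}
    (hw : C.IsCentred ∅ C.ground w) (hw' : C.IsCentred ∅ C.ground w') :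
    ∀ A ∈ C.members, w A = w' A := by
  intro A hA
  have := h.indep (fun A => w A - w' A) (fun B hB hne => ?_) ?_ (fun v hv => ?_) A hA
  · linarith
  · by_cases h0 : w B = 0
    · exact hw'.mem_core hB fun h0' => hne (by simp [h0, h0'])
    · exact hw.mem_core hB h0
  · rw [Finset.sum_sub_distrib, hw.sum_eq, hw'.sum_eq, sub_self]
  · rw [Finset.sum_sub_distrib, hw.half v hv, hw'.half v hv, sub_self]

/-- Each alternating member has positive weight in some centred vector, and there is only one
centred vector. -/
theorem IsSimplicial.exists_pos (h : C.IsSimplicial) :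
    ∃ l, C.IsCentred ∅ C.ground l ∧ ∀ A ∈ C.members, (0 < l A ↔ C.Alternates A) := by
  obtain ⟨l, hl⟩ := h.tangled.exists_isCentred h.clean
  refine ⟨l, hl, fun A hA => ⟨fun hlA => hl.alternates_of_forall
    (fun x hx y hy _ => Or.inl ⟨hx, hy⟩) hA hlA.ne', fun hAlt => ?_⟩⟩
  obtain ⟨w, hw, hwA⟩ := h.tangled.exists_isCentred_pos h.clean hA hAlt
  rwa [h.eq_of_isCentred hl hw A hA]

/-- By uniqueness `l` is the average of two slices, one for each side of the component of `p`. On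
each slice the sign of `p` is constant while the sign of `q` has mean zero. -/
theorem IsSimplicial.sum_sgn_mul_sgn (h : C.IsSimplicial) {l : Finset α → ℝ}
    (hl : C.IsCentred ∅ C.ground l) (hp : p ∈ C.ground) (hq : q ∈ C.ground) (hpq : C.Indep p q) :
    ∑ A ∈ C.members, l A * (sgn A p * sgn A q) = 0 := by
  obtain ⟨u, hu, hpu⟩ := h.tangled.nbr p hp
  have huo := mem_oside_of_adj (self_mem_side hp) hu hpu
  obtain ⟨w₁, hw₁⟩ := h.tangled.exists_slice h.clean hp
  obtain ⟨w₂, hw₂⟩ := h.tangled.exists_slice h.clean hu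
  have heq := h.eq_of_isCentred hl (average_slices hp huo hw₁ hw₂)
  have h1 : ∀ A ∈ C.members, w₁ A * (sgn A p * sgn A q) = - (w₁ A * sgn A q) := by
    intro A hA
    by_cases h0 : w₁ A = 0
    · simp [h0]
    · have : p ∉ A := fun h' => Finset.disjoint_left.1 (hw₁.disjoint A hA h0) h' (self_mem_side hp)
      rw [sgn, if_neg this]
      ring
  have h2 : ∀ A ∈ C.members, w₂ A * (sgn A p * sgn A q) = w₂ A * sgn A q := by
    intro A hA
    by_cases h0 : w₂ A = 0
    · simp [h0]
    · have : p ∈ A := mem_of_adjOn hpu.symm hA (Finset.disjoint_empty_right _)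
        fun h' => Finset.disjoint_left.1 (hw₂.disjoint A hA h0) h' (self_mem_side hu)
      rw [sgn, if_pos this]
      ring
  have hq1 : q ∈ C.ground \ (C.side ∅ C.ground p ∪ C.oside ∅ C.ground p) := by
    simp [hq, hpq.1, hpq.2]
  have hq2 : q ∈ C.ground \ (C.side ∅ C.ground u ∪ C.oside ∅ C.ground u) := by
    rw [side_eq_of_mem_oside hp huo, oside_eq_of_mem_oside hp huo]
    simp [hq, hpq.1, hpq.2]
  calc ∑ A ∈ C.members, l A * (sgn A p * sgn A q)
      = ∑ A ∈ C.members, (w₁ A * (sgn A p * sgn A q) + w₂ A * (sgn A p * sgn A q)) / 2 := by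
        refine Finset.sum_congr rfl fun A hA => ?_
        rw [heq A hA]
        ring
    _ = 0 := by
        rw [← Finset.sum_div, Finset.sum_add_distrib, Finset.sum_congr rfl h1,
          Finset.sum_congr rfl h2, Finset.sum_neg_distrib, hw₁.sum_sgn hq1, hw₂.sum_sgn hq2]
        norm_num

end

end Clutter

/-! ### Lines of components -/

namespace Clutter

variable {α : Type*} [DecidableEq α] {C : Clutter α} {p q t p' q' t' w v : α} {A : Finset α}

/-- The elements `p`, `q`, `t` lie in different components, and every alternating member contains
one or three of them. -/
structure Line (C : Clutter α) (p q t : α) : Prop where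
  mem₁ : p ∈ C.ground
  mem₂ : q ∈ C.ground
  mem₃ : t ∈ C.ground
  indep₁₂ : C.Indep p q
  indep₁₃ : C.Indep p t
  indep₂₃ : C.Indep q t
  iff : ∀ A ∈ C.members, C.Alternates A → ((p ∈ A ↔ q ∈ A) ↔ t ∈ A)

theorem Line.rotate (h : C.Line p q t) : C.Line q t p :=
  ⟨h.mem₂, h.mem₃, h.mem₁, h.indep₂₃, h.indep₁₂.symm h.mem₂, h.indep₁₃.symm h.mem₃,
    fun A hA hAlt => by have := h.iff A hA hAlt; tauto⟩

theorem Line.swap (h : C.Line p q t) : C.Line q p t :=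
  ⟨h.mem₂, h.mem₁, h.mem₃, h.indep₁₂.symm h.mem₂, h.indep₂₃, h.indep₁₃,
    fun A hA hAlt => by have := h.iff A hA hAlt; tauto⟩

theorem Indep.of_mem_side (hp : p ∈ C.ground) (hp' : p' ∈ C.side ∅ C.ground p)
    (h : C.Indep p q) : C.Indep p' q := by
  rw [Indep, side_eq_of_mem hp hp', oside_eq_of_mem hp hp']
  exact h

theorem Indep.of_mem_oside (hp : p ∈ C.ground) (hp' : p' ∈ C.oside ∅ C.ground p)
    (h : C.Indep p q) : C.Indep p' q := by
  rw [Indep, side_eq_of_mem_oside hp hp', oside_eq_of_mem_oside hp hp']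
  exact ⟨h.2, h.1⟩

theorem Line.of_mem_side (h : C.Line p q t) (hp' : p' ∈ C.side ∅ C.ground p) : C.Line p' q t :=
  ⟨side_subset hp', h.mem₂, h.mem₃, h.indep₁₂.of_mem_side h.mem₁ hp',
    h.indep₁₃.of_mem_side h.mem₁ hp', h.indep₂₃, fun A hA hAlt => by
      rw [(hAlt.at p).mem_side h.mem₁ hp']
      exact h.iff A hA hAlt⟩

/-- A line says that the product of three signs is 1, which survives reversing two of them. -/
theorem Line.flip (h : C.Line p q t) (hp' : p' ∈ C.oside ∅ C.ground p)
    (hq' : q' ∈ C.oside ∅ C.ground q) : C.Line p' q' t :=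
  ⟨oside_subset hp', oside_subset hq', h.mem₃,
    (((h.indep₁₂.of_mem_oside h.mem₁ hp').symm h.mem₂).of_mem_oside h.mem₂ hq').symm
      (oside_subset hp'),
    h.indep₁₃.of_mem_oside h.mem₁ hp', h.indep₂₃.of_mem_oside h.mem₂ hq', fun A hA hAlt => by
      rw [(hAlt.at p).mem_oside h.mem₁ hp', (hAlt.at q).mem_oside h.mem₂ hq']
      have := h.iff A hA hAlt
      tauto⟩

theorem AlternatesAt.disjoint_side (h : C.AlternatesAt A v) (hv : v ∈ C.ground) (hvA : v ∉ A) :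
    Disjoint A (C.side ∅ C.ground v) :=
  Finset.disjoint_right.2 fun _ hx hxA => hvA ((h.mem_side hv hx).1 hxA)

theorem IsTangledOn.exists_mem_oside (hT : C.IsTangledOn ∅ C.ground) (hv : v ∈ C.ground) :
    ∃ u, u ∈ C.oside ∅ C.ground v := by
  obtain ⟨u, hu, hvu⟩ := hT.nbr v hv
  exact ⟨u, mem_oside_of_adj (self_mem_side hv) hu hvu⟩

/-- With p, q, t denoting the signs, (1 - p)(1 - q)(1 - t) vanishes on the support of `l`. Taking
expectations, the linear and quadratic terms drop out, so E[pqt] = 1, which forces pqt = 1 on every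
alternating member. -/
theorem IsSimplicial.line_of_forall (h : C.IsSimplicial) (hp : p ∈ C.ground) (hq : q ∈ C.ground)
    (ht : t ∈ C.ground) (hpq : C.Indep p q) (hpt : C.Indep p t) (hqt : C.Indep q t)
    (hno : ∀ A ∈ C.members, C.Alternates A → p ∈ A ∨ q ∈ A ∨ t ∈ A) : C.Line p q t := by
  obtain ⟨l, hl, hpos⟩ := h.exists_pos
  refine ⟨hp, hq, ht, hpq, hpt, hqt, ?_⟩
  have hsq : ∀ A : Finset α, ∀ x, sgn A x = 1 ∨ sgn A x = -1 := fun A x => by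
    rw [sgn]
    split_ifs <;> simp
  have h0 : ∑ A ∈ C.members, l A * ((1 - sgn A p) * (1 - sgn A q) * (1 - sgn A t)) = 0 := by
    refine Finset.sum_eq_zero fun A hA => ?_
    by_cases hlA : l A = 0
    · simp [hlA]
    · have := hno A hA ((hpos A hA).1 ((hl.nonneg A hA).lt_of_ne' hlA))
      obtain h | h | h := this <;> simp [sgn, h]
  have h1 : ∑ A ∈ C.members, l A * (1 - sgn A p * sgn A q * sgn A t) = 0 := by
    have hexp : ∀ A, l A * (1 - sgn A p * sgn A q * sgn A t) =
        l A * ((1 - sgn A p) * (1 - sgn A q) * (1 - sgn A t)) + l A * sgn A p + l A * sgn A q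
          + l A * sgn A t - l A * (sgn A p * sgn A q) - l A * (sgn A p * sgn A t)
          - l A * (sgn A q * sgn A t) := fun A => by ring
    simp only [hexp, Finset.sum_add_distrib, Finset.sum_sub_distrib, h0, hl.sum_sgn hp,
      hl.sum_sgn hq, hl.sum_sgn ht, h.sum_sgn_mul_sgn hl hp hq hpq, h.sum_sgn_mul_sgn hl hp ht hpt,
      h.sum_sgn_mul_sgn hl hq ht hqt]
    norm_num
  rw [Finset.sum_eq_zero_iff_of_nonneg] at h1
  · intro A hA hAlt
    have h2 := (mul_eq_zero.1 (h1 A hA)).resolve_left ((hpos A hA).2 hAlt).ne'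
    by_cases h3 : p ∈ A <;> by_cases h4 : q ∈ A <;> by_cases h5 : t ∈ A <;>
      simp [sgn, h3, h4, h5] at h2 ⊢
  · intro A hA
    refine mul_nonneg (hl.nonneg A hA) ?_
    obtain h3 | h3 := hsq A p <;> obtain h4 | h4 := hsq A q <;> obtain h5 | h5 := hsq A t <;>
      rw [h3, h4, h5] <;> norm_num

theorem IsSimplicial.exists_alternates (h : C.IsSimplicial) :
    ∃ A ∈ C.members, C.Alternates A := by
  obtain ⟨l, hl, hpos⟩ := h.exists_pos
  by_contra! hcon
  have : ∑ A ∈ C.members, l A = 0 := Finset.sum_eq_zero fun A hA => by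
    by_contra hne
    exact hcon A hA ((hpos A hA).1 ((hl.nonneg A hA).lt_of_ne' hne))
  rw [hl.sum_eq] at this
  norm_num at this

/-- Elements with equal signs have correlation 1, whereas different components have correlation 0
and opposite sides have opposite signs. -/
theorem IsSimplicial.mem_side_of_forall (h : C.IsSimplicial) (ht : t ∈ C.ground)
    (hw : w ∈ C.ground) (hiff : ∀ A ∈ C.members, C.Alternates A → (w ∈ A ↔ t ∈ A)) :
    w ∈ C.side ∅ C.ground t := by
  by_contra hcon
  by_cases hwo : w ∈ C.oside ∅ C.ground t
  · obtain ⟨A, hA, hAlt⟩ := h.exists_alternates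
    have h1 := hiff A hA hAlt
    have h2 := (hAlt.at t).mem_oside ht hwo
    tauto
  · obtain ⟨l, hl, hpos⟩ := h.exists_pos
    have h1 := h.sum_sgn_mul_sgn hl ht hw ⟨hcon, hwo⟩
    have h2 : ∑ A ∈ C.members, l A * (sgn A t * sgn A w) = ∑ A ∈ C.members, l A := by
      refine Finset.sum_congr rfl fun A hA => ?_
      by_cases hlA : l A = 0
      · simp [hlA]
      · have := hiff A hA ((hpos A hA).1 ((hl.nonneg A hA).lt_of_ne' hlA))
        by_cases htA : t ∈ A <;> simp [sgn, this, htA]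
    rw [h1, hl.sum_eq] at h2
    norm_num at h2

theorem IsSimplicial.line_of_meets (h : C.IsSimplicial) (hp : p ∈ C.ground) (hq : q ∈ C.ground)
    (hw : w ∈ C.ground) (hpq : C.Indep p q) (hpw : C.Indep p w) (hqw : C.Indep q w)
    (hm : C.Meets (insert w (C.side ∅ C.ground p ∪ C.side ∅ C.ground q))) : C.Line p q w := by
  refine h.line_of_forall hp hq hw hpq hpw hqw fun A hA hAlt => ?_
  by_contra! hcon
  obtain ⟨x, hx⟩ := hm A hA
  simp only [Finset.mem_inter, Finset.mem_insert, Finset.mem_union] at hx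
  obtain ⟨hxA, rfl | hx | hx⟩ := hx
  · exact hcon.2.2 hxA
  · exact hcon.1 (((hAlt.at p).mem_side hp hx).1 hxA)
  · exact hcon.2.1 (((hAlt.at q).mem_side hq hx).1 hxA)

/-- Such a `w` also forms a line with `p` and `q`, and two signs on a line determine the third. -/
theorem IsSimplicial.mem_side_of_meets (h : C.IsSimplicial) (hl : C.Line p q t)
    (hw : w ∈ C.ground) (hpw : C.Indep p w) (hqw : C.Indep q w)
    (hm : C.Meets (insert w (C.side ∅ C.ground p ∪ C.side ∅ C.ground q))) :
    w ∈ C.side ∅ C.ground t := by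
  have hl' := h.line_of_meets hl.mem₁ hl.mem₂ hw hl.indep₁₂ hpw hqw hm
  refine h.mem_side_of_forall hl.mem₃ hw fun A hA hAlt => ?_
  rw [← hl.iff A hA hAlt, hl'.iff A hA hAlt]

/-- Otherwise every member in the slice avoiding the side of `p` would contain `q`, instead of half
of them by weight. -/
theorem IsSimplicial.not_meets_side_union (h : C.IsSimplicial) (hp : p ∈ C.ground)
    (hq : q ∈ C.ground) (hpq : C.Indep p q) :
    ¬ C.Meets (C.side ∅ C.ground p ∪ C.side ∅ C.ground q) := by
  intro hm
  obtain ⟨w, hw⟩ := h.tangled.exists_slice h.clean hp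
  have h1 := hw.half q (by simp [hq, hpq.1, hpq.2])
  rw [Finset.sum_filter, Finset.sum_congr rfl (g := w), hw.sum_eq] at h1
  · norm_num at h1
  · intro A hA
    by_cases hwA : w A = 0
    · simp [hwA]
    · have hAlt := hw.alternates_of_forall slice_adj hA hwA
      have hd := hw.disjoint A hA hwA
      rw [if_pos]
      by_contra hqA
      have hd' := (hAlt.at q).disjoint_side hq hqA
      exact not_meets_iff.2 ⟨A, hA, Finset.disjoint_union_right.2 ⟨hd, hd'⟩⟩ hm

/-- The elements of the ground set in the components other than those of `p` and `q`. -/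
noncomputable def outside (C : Clutter α) (p q : α) : Finset α :=
  C.ground \ ((C.side ∅ C.ground p ∪ C.oside ∅ C.ground p) ∪
    (C.side ∅ C.ground q ∪ C.oside ∅ C.ground q))

theorem mem_outside {x : α} : x ∈ C.outside p q ↔ x ∈ C.ground ∧ C.Indep p x ∧ C.Indep q x := by
  simp only [outside, Finset.mem_sdiff, Finset.mem_union, Indep]
  tauto

theorem Indep.adj {x y : α} (hx : x ∈ C.ground) (hpx : C.Indep p x)
    (hxy : C.AdjOn ∅ x y) : C.Indep p y :=
  ⟨fun hy => hpx.2 (mem_oside_of_adj hy hx hxy.symm), fun hy =>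
    hpx.1 (mem_side_of_adj hy hx hxy.symm)⟩

/-- Hypothesis `hs` is exactly what is missing for the clutter to stay tangled after deleting both
sides and contracting their opposites. -/
theorem IsSimplicial.exists_double_slice (h : C.IsSimplicial) (hp : p ∈ C.ground)
    (hq : q ∈ C.ground) (hpq : C.Indep p q)
    (hs : ∀ x ∈ C.ground, C.Indep p x → C.Indep q x →
      ¬ C.Meets (insert x (C.side ∅ C.ground p ∪ C.side ∅ C.ground q))) :
    ∃ w, C.IsCentred (C.side ∅ C.ground p ∪ C.side ∅ C.ground q) (C.outside p q) w ∧
      ∀ A ∈ C.members, w A ≠ 0 → C.Alternates A := by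
  have hT : C.IsTangledOn (C.side ∅ C.ground p ∪ C.side ∅ C.ground q) (C.outside p q) := by
    refine ⟨h.not_meets_side_union hp hq hpq, fun x hx => ?_, fun x hx => ?_⟩
    · rw [mem_outside] at hx
      exact hs x hx.1 hx.2.1 hx.2.2
    · rw [mem_outside] at hx
      obtain ⟨y, hy, hxy⟩ := h.tangled.nbr x hx.1
      exact ⟨y, mem_outside.2 ⟨hy, hx.2.1.adj hx.1 hxy, hx.2.2.adj hx.1 hxy⟩,
        hxy.mono (Finset.empty_subset _)⟩
  obtain ⟨w, hw⟩ := hT.exists_isCentred h.clean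
  refine ⟨w, hw, fun A hA hwA => hw.alternates_of_forall (fun x hx y hy hxy => ?_) hA hwA⟩
  have h1 := slice_adj (v := p) x hx y hy hxy
  have h2 := slice_adj (v := q) x hx y hy hxy
  simp only [outside, Finset.mem_sdiff, Finset.mem_union] at h1 h2 ⊢
  tauto

/-- Any two components lie on a line. -/
theorem IsSimplicial.exists_line (h : C.IsSimplicial) (hp : p ∈ C.ground) (hq : q ∈ C.ground)
    (hpq : C.Indep p q) : ∃ t, C.Line p q t := by
  obtain ⟨p', hp'⟩ := h.tangled.exists_mem_oside hp
  obtain ⟨q', hq'⟩ := h.tangled.exists_mem_oside hq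
  have hp'' := mem_oside_comm hp hp'
  have hq'' := mem_oside_comm hq hq'
  have hp'g := oside_subset hp'
  have hq'g := oside_subset hq'
  -- Without a line through the two components, double slices exist for all four choices of one side
  -- from each.
  by_contra! hcon
  have hflip : ∀ t, ¬ C.Line p' q t := fun t ht => by
    obtain ⟨t', ht'⟩ := h.tangled.exists_mem_oside ht.mem₃
    exact hcon t' (ht.rotate.rotate.flip ht' hp'').rotate
  have hp'q := hpq.of_mem_oside hp hp'
  have hpq' : C.Indep p q' := ((hpq.symm hq).of_mem_oside hq hq').symm hp
  have hp'q' : C.Indep p' q' := hpq'.of_mem_oside hp hp'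
  obtain ⟨w₁, hw₁, ha₁⟩ := h.exists_double_slice hp hq hpq fun x hx h1 h2 hm =>
    hcon x (h.line_of_meets hp hq hx hpq h1 h2 hm)
  obtain ⟨w₂, hw₂, ha₂⟩ := h.exists_double_slice hp'g hq hp'q fun x hx h1 h2 hm =>
    hflip x (h.line_of_meets hp'g hq hx hp'q h1 h2 hm)
  obtain ⟨w₃, hw₃, ha₃⟩ := h.exists_double_slice hp hq'g hpq' fun x hx h1 h2 hm => by
    obtain ⟨x', hx'⟩ := h.tangled.exists_mem_oside hx
    exact hcon x' ((h.line_of_meets hp hq'g hx hpq' h1 h2 hm).rotate.flip hq'' hx').rotate.rotate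
  obtain ⟨w₄, hw₄, ha₄⟩ := h.exists_double_slice hp'g hq'g hp'q' fun x hx h1 h2 hm =>
    hcon x ((h.line_of_meets hp'g hq'g hx hp'q' h1 h2 hm).flip hp'' hq'')
  have hsp := side_eq_of_mem_oside hp hp'
  have hsq := side_eq_of_mem_oside hq hq'
  have hout : ∀ a b, (∀ x, C.Indep p x → C.Indep a x) → (∀ x, C.Indep q x → C.Indep b x) →
      ∀ x ∈ C.outside p q, x ∈ C.outside a b := by
    intro a b ha hb x hx
    rw [mem_outside] at hx ⊢
    exact ⟨hx.1, ha x hx.2.1, hb x hx.2.2⟩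
  have hpp' : ∀ x, C.Indep p x → C.Indep p' x := fun x hx => hx.of_mem_oside hp hp'
  have hqq' : ∀ x, C.Indep q x → C.Indep q' x := fun x hx => hx.of_mem_oside hq hq'
  rw [hsp] at hw₂ hw₄
  rw [hsq] at hw₃ hw₄
  have hcore : ∀ A ∈ C.members, C.Alternates A → A ∈ C.core.members := by
    intro A hA hAlt
    obtain ⟨l, hl, hlA⟩ := h.tangled.exists_isCentred_pos h.clean hA hAlt
    exact hl.mem_core hA hlA.ne'
  -- The signs + - - + cancel the total mass and all marginals, and the four supports are disjoint,
  -- so affine independence would make `w₁` vanish.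
  have hzero := h.indep (fun A => w₁ A - w₂ A - w₃ A + w₄ A) ?_ ?_ ?_
  · have h1 : ∃ A ∈ C.members, w₁ A ≠ 0 := by
      by_contra! hcon
      have := hw₁.sum_eq
      rw [Finset.sum_eq_zero hcon] at this
      norm_num at this
    obtain ⟨A, hA, hwA⟩ := h1
    have hd := Finset.disjoint_union_right.1 (hw₁.disjoint A hA hwA)
    have hpA : p ∉ A := Finset.disjoint_right.1 hd.1 (self_mem_side hp)
    have hqA : q ∉ A := Finset.disjoint_right.1 hd.2 (self_mem_side hq)
    have hAlt := ha₁ A hA hwA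
    have hp'A : p' ∈ A := ((hAlt.at p).mem_oside hp hp').2 hpA
    have hq'A : q' ∈ A := ((hAlt.at q).mem_oside hq hq').2 hqA
    have e2 : w₂ A = 0 := by
      by_contra hne
      exact Finset.disjoint_left.1 (hw₂.disjoint A hA hne) hp'A (Finset.mem_union_left _ hp')
    have e3 : w₃ A = 0 := by
      by_contra hne
      exact Finset.disjoint_left.1 (hw₃.disjoint A hA hne) hq'A (Finset.mem_union_right _ hq')
    have e4 : w₄ A = 0 := by
      by_contra hne
      exact Finset.disjoint_left.1 (hw₄.disjoint A hA hne) hp'A (Finset.mem_union_left _ hp')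
    have := hzero A hA
    simp only [e2, e3, e4, sub_zero, add_zero] at this
    exact hwA this
  · intro A hA hne
    apply hcore A hA
    by_contra hAlt
    apply hne
    have e1 : w₁ A = 0 := by_contra fun h => hAlt (ha₁ A hA h)
    have e2 : w₂ A = 0 := by_contra fun h => hAlt (ha₂ A hA h)
    have e3 : w₃ A = 0 := by_contra fun h => hAlt (ha₃ A hA h)
    have e4 : w₄ A = 0 := by_contra fun h => hAlt (ha₄ A hA h)
    simp [e1, e2, e3, e4]
  · simp only [Finset.sum_add_distrib, Finset.sum_sub_distrib, hw₁.sum_eq, hw₂.sum_eq, hw₃.sum_eq,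
      hw₄.sum_eq]
    norm_num
  · intro v hv
    simp only [Finset.sum_add_distrib, Finset.sum_sub_distrib]
    have hone : ∀ {K X : Finset α} {w : Finset α → ℝ} {x y : α}, C.IsCentred K X w →
        C.AdjOn ∅ x y → x ∈ K → ∑ A ∈ C.members with y ∈ A, w A = 1 :=
      fun hw hxy hx => hw.sum_filter_eq_one (hxy.mono (Finset.empty_subset _)) hx
    by_cases hvp : C.Indep p v
    · by_cases hvq : C.Indep q v
      · have ho : v ∈ C.outside p q := mem_outside.2 ⟨hv, hvp, hvq⟩
        rw [hw₁.half v ho, hw₂.half v (hout _ _ hpp' (fun _ h => h) v ho),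
          hw₃.half v (hout _ _ (fun _ h => h) hqq' v ho), hw₄.half v (hout _ _ hpp' hqq' v ho)]
        norm_num
      · obtain hvs | hvo : v ∈ C.side ∅ C.ground q ∨ v ∈ C.oside ∅ C.ground q := by
          rw [Indep] at hvq
          tauto
        · have hvs' := hvs
          rw [← oside_eq_of_mem_oside hq hq'] at hvs'
          obtain ⟨-, y, hy, hyv⟩ := mem_oside.1 hvs'
          rw [hsq] at hy
          rw [hw₁.sum_filter_eq_zero (Finset.mem_union_right _ hvs),
            hw₂.sum_filter_eq_zero (Finset.mem_union_right _ hvs),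
            hone hw₃ hyv (Finset.mem_union_right _ hy),
            hone hw₄ hyv (Finset.mem_union_right _ hy)]
          norm_num
        · obtain ⟨-, y, hy, hyv⟩ := mem_oside.1 hvo
          rw [hw₃.sum_filter_eq_zero (Finset.mem_union_right _ hvo),
            hw₄.sum_filter_eq_zero (Finset.mem_union_right _ hvo),
            hone hw₁ hyv (Finset.mem_union_right _ hy),
            hone hw₂ hyv (Finset.mem_union_right _ hy)]
          norm_num
    · obtain hvs | hvo : v ∈ C.side ∅ C.ground p ∨ v ∈ C.oside ∅ C.ground p := by
        rw [Indep] at hvp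
        tauto
      · have hvs' := hvs
        rw [← oside_eq_of_mem_oside hp hp'] at hvs'
        obtain ⟨-, y, hy, hyv⟩ := mem_oside.1 hvs'
        rw [hsp] at hy
        rw [hw₁.sum_filter_eq_zero (Finset.mem_union_left _ hvs),
          hw₃.sum_filter_eq_zero (Finset.mem_union_left _ hvs),
          hone hw₂ hyv (Finset.mem_union_left _ hy),
          hone hw₄ hyv (Finset.mem_union_left _ hy)]
        norm_num
      · obtain ⟨-, y, hy, hyv⟩ := mem_oside.1 hvo
        rw [hw₂.sum_filter_eq_zero (Finset.mem_union_left _ hvo),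
          hw₄.sum_filter_eq_zero (Finset.mem_union_left _ hvo),
          hone hw₁ hyv (Finset.mem_union_left _ hy),
          hone hw₃ hyv (Finset.mem_union_left _ hy)]
        norm_num

/-- The union of three sides that form a line is a cover. -/
theorem IsSimplicial.meets_of_line (h : C.IsSimplicial) (hl : C.Line p q t) :
    C.Meets (C.side ∅ C.ground p ∪ C.side ∅ C.ground q ∪ C.side ∅ C.ground t) := by
  by_contra hcon
  -- Any single element completing the sides of `p` and `q` would lie on the side of `t`, so the
  -- double slice exists. Its members avoid `p` and `q`, hence all contain `t`, contradicting
  -- probability 1/2.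
  obtain ⟨w, hw, ha⟩ := h.exists_double_slice hl.mem₁ hl.mem₂ hl.indep₁₂ fun x hx h1 h2 hm => by
    refine hcon (hm.mono (Finset.insert_subset ?_ Finset.subset_union_left))
    exact Finset.mem_union_right _ (h.mem_side_of_meets hl hx h1 h2 hm)
  have h1 := hw.half t (mem_outside.2 ⟨hl.mem₃, hl.indep₁₃, hl.indep₂₃⟩)
  rw [Finset.sum_filter, Finset.sum_congr rfl (g := w), hw.sum_eq] at h1
  · norm_num at h1
  · intro A hA
    by_cases hwA : w A = 0
    · simp [hwA]
    · have hd := Finset.disjoint_union_right.1 (hw.disjoint A hA hwA)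
      have hpA : p ∉ A := Finset.disjoint_right.1 hd.1 (self_mem_side hl.mem₁)
      have hqA : q ∉ A := Finset.disjoint_right.1 hd.2 (self_mem_side hl.mem₂)
      have := hl.iff A hA (ha A hA hwA)
      rw [if_pos (by tauto)]

/-- The parity of a line extends to members that alternate only on its three components, as happens
when single elements are deleted. The three sides form a cover, so they cannot all be missed;
flipping pairs of sides excludes the other wrong patterns. -/
theorem IsSimplicial.mem_iff_of_line (h : C.IsSimplicial) (hl : C.Line p q t) (hA : A ∈ C.members)
    (hp : C.AlternatesAt A p) (hq : C.AlternatesAt A q) (ht : C.AlternatesAt A t) :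
    (p ∈ A ↔ q ∈ A) ↔ t ∈ A := by
  have key : ∀ a b c, C.Line a b c → C.AlternatesAt A a → C.AlternatesAt A b →
      C.AlternatesAt A c → a ∉ A → b ∉ A → c ∉ A → False := by
    intro a b c hl ha hb hc haA hbA hcA
    refine not_meets_iff.2 ⟨A, hA, ?_⟩ (h.meets_of_line hl)
    simp only [Finset.disjoint_union_right]
    exact ⟨⟨ha.disjoint_side hl.mem₁ haA, hb.disjoint_side hl.mem₂ hbA⟩,
      hc.disjoint_side hl.mem₃ hcA⟩
  have hflip : ∀ a, a ∈ C.ground → C.AlternatesAt A a → a ∈ A →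
      ∃ a' ∈ C.oside ∅ C.ground a, a' ∉ A ∧ C.AlternatesAt A a' := by
    intro a ha haA hmem
    obtain ⟨a', ha'⟩ := h.tangled.exists_mem_oside ha
    refine ⟨a', ha', by rw [haA.mem_oside ha ha']; tauto, ?_⟩
    intro x hx y hy hxy
    rw [side_eq_of_mem_oside ha ha'] at hx
    rw [oside_eq_of_mem_oside ha ha'] at hy
    have := haA y hy x hx hxy.symm
    tauto
  have key2 : ∀ a b c, C.Line a b c → C.AlternatesAt A a → C.AlternatesAt A b →
      C.AlternatesAt A c → a ∈ A → b ∈ A → c ∉ A → False := by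
    intro a b c hl ha hb hc haA hbA hcA
    obtain ⟨a', ha', haA', haa⟩ := hflip a hl.mem₁ ha haA
    obtain ⟨b', hb', hbA', hbb⟩ := hflip b hl.mem₂ hb hbA
    exact key a' b' c (hl.flip ha' hb') haa hbb hc haA' hbA' hcA
  have h1 := key p q t hl hp hq ht
  have h2 := key2 p q t hl hp hq ht
  have h3 := key2 q t p hl.rotate hq ht hp
  have h4 := key2 t p q hl.rotate.rotate ht hp hq
  tauto

end Clutter

/-! ### Fano planes of components -/

namespace Clutter

variable {α : Type*} [DecidableEq α] {C : Clutter α} {a b c d e f g : α}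

theorem Line.reverse {p q t : α} (h : C.Line p q t) : C.Line p t q := h.swap.rotate

theorem Line.congr {p q t p' q' t' : α} (h : C.Line p q t) (hp : p' ∈ C.side ∅ C.ground p)
    (hq : q' ∈ C.side ∅ C.ground q) (ht : t' ∈ C.side ∅ C.ground t) : C.Line p' q' t' :=
  (((h.of_mem_side hp).rotate.of_mem_side hq).rotate.of_mem_side ht).rotate

/-- Seven elements in different components such that the seven lines of a Fano plane are lines. -/
structure Fano (C : Clutter α) (a b c d e f g : α) : Prop where
  abc : C.Line a b c
  ade : C.Line a d e
  afg : C.Line a f g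
  bdg : C.Line b d g
  bef : C.Line b e f
  cdf : C.Line c d f
  ceg : C.Line c e g

namespace Fano

theorem congr {a' b' c' d' e' f' g' : α} (h : C.Fano a b c d e f g)
    (ha : a' ∈ C.side ∅ C.ground a) (hb : b' ∈ C.side ∅ C.ground b)
    (hc : c' ∈ C.side ∅ C.ground c) (hd : d' ∈ C.side ∅ C.ground d)
    (he : e' ∈ C.side ∅ C.ground e) (hf : f' ∈ C.side ∅ C.ground f)
    (hg : g' ∈ C.side ∅ C.ground g) : C.Fano a' b' c' d' e' f' g' :=
  ⟨h.abc.congr ha hb hc, h.ade.congr ha hd he, h.afg.congr ha hf hg, h.bdg.congr hb hd hg,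
    h.bef.congr hb he hf, h.cdf.congr hc hd hf, h.ceg.congr hc he hg⟩

/-- Every line other than `abc` meets `abc` in one point, so exactly two of its signs are reversed.
-/
theorem flip {d' e' f' g' : α} (h : C.Fano a b c d e f g)
    (hd : d' ∈ C.oside ∅ C.ground d) (he : e' ∈ C.oside ∅ C.ground e)
    (hf : f' ∈ C.oside ∅ C.ground f) (hg : g' ∈ C.oside ∅ C.ground g) :
    C.Fano a b c d' e' f' g' :=
  ⟨h.abc, (h.ade.rotate.flip hd he).rotate.rotate, (h.afg.rotate.flip hf hg).rotate.rotate,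
    (h.bdg.rotate.flip hd hg).rotate.rotate, (h.bef.rotate.flip he hf).rotate.rotate,
    (h.cdf.rotate.flip hd hf).rotate.rotate, (h.ceg.rotate.flip he hg).rotate.rotate⟩

/-- This and the following relabellings are collineations of the Fano plane; they carry statements
about one line or point to the others. -/
theorem swap_lines (h : C.Fano a b c d e f g) : C.Fano a d e b c f g :=
  ⟨h.ade, h.abc, h.afg, h.bdg.swap, h.cdf.swap, h.bef.swap, h.ceg.swap⟩

theorem swap_lines' (h : C.Fano a b c d e f g) : C.Fano a b c f g d e :=
  ⟨h.abc, h.afg, h.ade, h.bef.reverse, h.bdg.reverse, h.cdf.reverse, h.ceg.reverse⟩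

theorem swap_bc (h : C.Fano a b c d e f g) : C.Fano a c b d e g f :=
  ⟨h.abc.reverse, h.ade, h.afg.reverse, h.cdf, h.ceg, h.bdg, h.bef⟩

theorem lead_b (h : C.Fano a b c d e f g) : C.Fano b a c e f g d :=
  ⟨h.abc.swap, h.bef, h.bdg.reverse, h.ade.reverse, h.afg, h.ceg, h.cdf.reverse⟩

theorem lead_c (h : C.Fano a b c d e f g) : C.Fano c a b d f g e :=
  ⟨h.abc.rotate.rotate, h.cdf, h.ceg.reverse, h.ade, h.afg, h.bdg, h.bef.reverse⟩

theorem lead_d (h : C.Fano a b c d e f g) : C.Fano d a e b g f c :=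
  ⟨h.ade.swap, h.bdg.swap, h.cdf.rotate, h.abc, h.afg.reverse, h.bef.swap, h.ceg.rotate⟩

end Fano

/-- The vertex set of the component of `v` in the graph of `C`. -/
noncomputable def comp (C : Clutter α) (v : α) : Finset α :=
  C.side ∅ C.ground v ∪ C.oside ∅ C.ground v

theorem self_mem_comp {v : α} (hv : v ∈ C.ground) : v ∈ C.comp v :=
  Finset.mem_union_left _ (self_mem_side hv)

theorem Indep.of_mem_comp {p v x : α} (hp : p ∈ C.ground) (hv : v ∈ C.ground) (h : C.Indep p v)
    (hx : x ∈ C.comp v) : x ∈ C.ground ∧ C.Indep p x := by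
  rw [comp, Finset.mem_union] at hx
  obtain hx | hx := hx
  · exact ⟨side_subset hx, ((h.symm hv).of_mem_side hv hx).symm hp⟩
  · exact ⟨oside_subset hx, ((h.symm hv).of_mem_oside hv hx).symm hp⟩

/-- Unlike the slices, `K` may contain single elements rather than whole sides. The members of
positive weight then need to alternate only on the components listed in `Y`. -/
theorem IsSimplicial.exists_isCentred_comps (h : C.IsSimplicial) {K Y : Finset α}
    (hY : Y ⊆ C.ground) (hne : Y.Nonempty)
    (hs : ∀ v ∈ Y, ∀ x ∈ C.comp v, ¬ C.Meets (insert x K)) :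
    ∃ w, C.IsCentred K (Y.biUnion C.comp) w ∧
      ∀ A ∈ C.members, w A ≠ 0 → ∀ v ∈ Y, C.AlternatesAt A v := by
  have hT : C.IsTangledOn K (Y.biUnion C.comp) := by
    refine ⟨fun hm => ?_, fun x hx => ?_, fun x hx => ?_⟩
    · obtain ⟨v, hv⟩ := hne
      exact hs v hv v (self_mem_comp (hY hv)) (hm.mono (Finset.subset_insert _ _))
    · obtain ⟨v, hv, hx⟩ := Finset.mem_biUnion.1 hx
      exact hs v hv x hx
    · obtain ⟨v, hv, hx⟩ := Finset.mem_biUnion.1 hx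
      have hxg : x ∈ C.ground := by
        rw [comp, Finset.mem_union] at hx
        exact hx.elim (fun h => side_subset h) (fun h => oside_subset h)
      obtain ⟨y, hy, hxy⟩ := h.tangled.nbr x hxg
      refine ⟨y, Finset.mem_biUnion.2 ⟨v, hv, ?_⟩, hxy.mono (Finset.empty_subset _)⟩
      rw [comp, Finset.mem_union] at hx ⊢
      exact hx.elim (fun h => Or.inr (mem_oside_of_adj h hy hxy))
        (fun h => Or.inl (mem_side_of_adj h hy hxy))
  obtain ⟨w, hw⟩ := hT.exists_isCentred h.clean
  refine ⟨w, hw, fun A hA hwA v hv x hx y hy hxy => ?_⟩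
  exact hw.alternates hA hwA (Finset.mem_biUnion.2 ⟨v, hv, Finset.mem_union_left _ hx⟩)
    (Finset.mem_biUnion.2 ⟨v, hv, Finset.mem_union_right _ hy⟩) (hxy.mono (Finset.empty_subset _))

theorem alternatesAt_of_disjoint {A : Finset α} {v : α} (hA : A ∈ C.members)
    (hd : Disjoint A (C.side ∅ C.ground v)) : C.AlternatesAt A v := by
  intro x hx y _ hxy
  have hxA := Finset.disjoint_right.1 hd hx
  have := mem_of_adjOn hxy hA (Finset.disjoint_empty_right _) hxA
  tauto

theorem IsCentred.exists_notMem {K X : Finset α} {w : Finset α → ℝ} (h : C.IsCentred K X w)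
    {x : α} (hx : x ∈ X) : ∃ A ∈ C.members, w A ≠ 0 ∧ x ∉ A := by
  by_contra! hcon
  have h1 := h.half x hx
  rw [Finset.sum_filter, Finset.sum_congr rfl (g := w), h.sum_eq] at h1
  · norm_num at h1
  · intro A hA
    by_cases hwA : w A = 0
    · simp [hwA]
    · rw [if_pos (hcon A hA hwA)]

/-- The expected number of the three elements in a random member is 3/2, less than two. -/
theorem IsCentred.exists_two_notMem {K X : Finset α} {w : Finset α → ℝ} (h : C.IsCentred K X w)
    {x y z : α} (hx : x ∈ X) (hy : y ∈ X) (hz : z ∈ X) : ∃ A ∈ C.members, w A ≠ 0 ∧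
      ((x ∉ A ∧ y ∉ A) ∨ (x ∉ A ∧ z ∉ A) ∨ (y ∉ A ∧ z ∉ A)) := by
  by_contra! hcon
  have h1 : ∑ A ∈ C.members, w A * 2 ≤ ∑ A ∈ C.members, w A *
      ((if x ∈ A then 1 else 0) + (if y ∈ A then 1 else 0) + (if z ∈ A then 1 else 0)) := by
    refine Finset.sum_le_sum fun A hA => ?_
    by_cases hwA : w A = 0
    · simp [hwA]
    · refine mul_le_mul_of_nonneg_left ?_ (h.nonneg A hA)
      obtain ⟨h1, h2, h3⟩ := hcon A hA hwA
      split_ifs <;> first | norm_num; done | (exfalso; tauto)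
  simp only [mul_add, Finset.sum_add_distrib, mul_ite, mul_one, mul_zero, ← Finset.sum_filter,
    h.half x hx, h.half y hy, h.half z hz, ← Finset.sum_mul, h.sum_eq] at h1
  norm_num at h1

namespace Fano

/-- If an element of a side completes the sides of one line through it to a cover, then it does so
for every line through it. -/
theorem meets_of_meets (hF : C.Fano a b c d e f g) (h : C.IsSimplicial)
    (hm : C.Meets (insert a (C.side ∅ C.ground b ∪ C.side ∅ C.ground c))) :
    C.Meets (insert a (C.side ∅ C.ground d ∪ C.side ∅ C.ground e)) := by
  by_contra hcon
  have ha := hF.abc.mem₁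
  have hb := hF.abc.mem₂
  have hc := hF.abc.mem₃
  have hd := hF.ade.mem₂
  have he := hF.ade.mem₃
  have hf := hF.afg.mem₂
  have hg := hF.afg.mem₃
  -- A completing `x` would lie on the side of `e`, the third point of the line through `a` and `d`,
  -- giving the very cover assumed absent.
  have hs : ∀ v ∈ C.ground, C.Indep a v → C.Indep d v → ∀ x ∈ C.comp v,
      ¬ C.Meets (insert x (insert a (C.side ∅ C.ground d))) := by
    intro v hv hav hdv x hx hmx
    obtain ⟨hxg, hax⟩ := hav.of_mem_comp ha hv hx
    obtain ⟨-, hdx⟩ := hdv.of_mem_comp hd hv hx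
    have hxe := h.mem_side_of_meets hF.ade hxg hax hdx (hmx.mono ?_)
    · refine hcon (hmx.mono ?_)
      intro t ht
      simp only [Finset.mem_insert, Finset.mem_union] at ht ⊢
      obtain rfl | rfl | ht := ht <;> tauto
    · intro t ht
      simp only [Finset.mem_insert, Finset.mem_union] at ht ⊢
      obtain rfl | rfl | ht := ht
      · tauto
      · exact Or.inr (Or.inl (self_mem_side ha))
      · tauto
  obtain ⟨w, hw, halt⟩ := h.exists_isCentred_comps (K := insert a (C.side ∅ C.ground d))
    (Y := {b, c, e, f, g}) (by simp [Finset.insert_subset_iff, *]) (by simp) (by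
      intro v hv
      simp only [Finset.mem_insert, Finset.mem_singleton] at hv
      obtain rfl | rfl | rfl | rfl | rfl := hv
      · exact hs _ hb hF.abc.indep₁₂ (hF.bdg.indep₁₂.symm hd)
      · exact hs _ hc hF.abc.indep₁₃ (hF.cdf.indep₁₂.symm hd)
      · exact hs _ he hF.ade.indep₁₃ hF.ade.indep₂₃
      · exact hs _ hf hF.afg.indep₁₂ hF.cdf.indep₂₃
      · exact hs _ hg hF.afg.indep₁₃ hF.bdg.indep₂₃)
  have hX : ∀ v ∈ ({b, c, e, f, g} : Finset α), v ∈ C.ground →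
      v ∈ Finset.biUnion {b, c, e, f, g} C.comp := fun v hv hvg =>
    Finset.mem_biUnion.2 ⟨v, hv, self_mem_comp hvg⟩
  -- As `d ∉ A`, the lines avoiding `a` force an even number of `b`, `c`, `e` in `A`. Two are
  -- missing, so all three are, and `A` avoids the cover in `hm`.
  obtain ⟨A, hA, hwA, htwo⟩ := hw.exists_two_notMem (hX b (by simp) hb) (hX c (by simp) hc)
    (hX e (by simp) he)
  have hdis := hw.disjoint A hA hwA
  rw [Finset.disjoint_insert_right] at hdis
  have alb := halt A hA hwA b (by simp)
  have alc := halt A hA hwA c (by simp)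
  have ale := halt A hA hwA e (by simp)
  have alf := halt A hA hwA f (by simp)
  have alg := halt A hA hwA g (by simp)
  have ald := alternatesAt_of_disjoint hA hdis.2
  have hdA : d ∉ A := Finset.disjoint_right.1 hdis.2 (self_mem_side hd)
  have h1 := h.mem_iff_of_line hF.bdg hA alb ald alg
  have h2 := h.mem_iff_of_line hF.bef hA alb ale alf
  have h3 := h.mem_iff_of_line hF.cdf hA alc ald alf
  have h4 := h.mem_iff_of_line hF.ceg hA alc ale alg
  have h5 : b ∈ A ∨ c ∈ A := by
    by_contra! hbc
    refine not_meets_iff.2 ⟨A, hA, ?_⟩ hm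
    rw [Finset.disjoint_insert_right, Finset.disjoint_union_right]
    exact ⟨hdis.1, alb.disjoint_side hb hbc.1, alc.disjoint_side hc hbc.2⟩
  by_cases b ∈ A <;> by_cases c ∈ A <;> by_cases e ∈ A <;> simp_all

/-- Flipping `d`, `e`, `f`, `g` preserves the Fano plane and leaves the hypothesis untouched. -/
theorem meets_oside_of_meets (hF : C.Fano a b c d e f g) (h : C.IsSimplicial)
    (hm : C.Meets (insert a (C.side ∅ C.ground b ∪ C.side ∅ C.ground c))) :
    C.Meets (insert a (C.oside ∅ C.ground d ∪ C.oside ∅ C.ground e)) := by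
  obtain ⟨d', hd⟩ := h.tangled.exists_mem_oside hF.ade.mem₂
  obtain ⟨e', he⟩ := h.tangled.exists_mem_oside hF.ade.mem₃
  obtain ⟨f', hf⟩ := h.tangled.exists_mem_oside hF.afg.mem₂
  obtain ⟨g', hg⟩ := h.tangled.exists_mem_oside hF.afg.mem₃
  have := (hF.flip hd he hf hg).meets_of_meets h hm
  rwa [side_eq_of_mem_oside hF.ade.mem₂ hd, side_eq_of_mem_oside hF.ade.mem₃ he] at this

/-- A member missing `b` and alternating at `e` and `f` contains exactly one of them; likewise one
missing `d` separates `c` from `f`. So `c` and `e` agree, and the line `ceg` forces `g` into the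
member. -/
theorem meets_pair_side (hF : C.Fano a b c d e f g) (h : C.IsSimplicial)
    (hb₁ : C.Meets (insert b (C.side ∅ C.ground e ∪ C.side ∅ C.ground f)))
    (hb₂ : C.Meets (insert b (C.oside ∅ C.ground e ∪ C.oside ∅ C.ground f)))
    (hd₁ : C.Meets (insert d (C.side ∅ C.ground c ∪ C.side ∅ C.ground f)))
    (hd₂ : C.Meets (insert d (C.oside ∅ C.ground c ∪ C.oside ∅ C.ground f))) :
    C.Meets (insert b (insert d (C.side ∅ C.ground g))) := by
  by_contra hcon
  have hb := hF.abc.mem₂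
  have hc := hF.abc.mem₃
  have hd := hF.ade.mem₂
  have he := hF.ade.mem₃
  have hf := hF.afg.mem₂
  have hg := hF.afg.mem₃
  have hs : ∀ v ∈ C.ground, C.Indep b v → C.Indep d v → ∀ x ∈ C.comp v,
      ¬ C.Meets (insert x {b, d}) := by
    intro v hv hbv hdv x hx hmx
    obtain ⟨hxg, hbx⟩ := hbv.of_mem_comp hb hv hx
    obtain ⟨-, hdx⟩ := hdv.of_mem_comp hd hv hx
    have hxg := h.mem_side_of_meets hF.bdg hxg hbx hdx (hmx.mono ?_)
    · refine hcon (hmx.mono ?_)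
      intro t ht
      simp only [Finset.mem_insert, Finset.mem_singleton] at ht ⊢
      obtain rfl | rfl | rfl := ht <;> tauto
    · intro t ht
      simp only [Finset.mem_insert, Finset.mem_singleton, Finset.mem_union] at ht ⊢
      obtain rfl | rfl | rfl := ht
      · tauto
      · exact Or.inr (Or.inl (self_mem_side hb))
      · exact Or.inr (Or.inr (self_mem_side hd))
  obtain ⟨w, hw, halt⟩ := h.exists_isCentred_comps (K := {b, d})
    (Y := {c, e, f, g}) (by simp [Finset.insert_subset_iff, *]) (by simp) (by
      intro v hv
      simp only [Finset.mem_insert, Finset.mem_singleton] at hv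
      obtain rfl | rfl | rfl | rfl := hv
      · exact hs _ hc hF.abc.indep₂₃ (hF.cdf.indep₁₂.symm hd)
      · exact hs _ he hF.bef.indep₁₂ hF.ade.indep₂₃
      · exact hs _ hf hF.bef.indep₁₃ hF.cdf.indep₂₃
      · exact hs _ hg hF.bdg.indep₁₃ hF.bdg.indep₂₃)
  obtain ⟨A, hA, hwA, hgA⟩ := hw.exists_notMem (x := g)
    (Finset.mem_biUnion.2 ⟨g, by simp, self_mem_comp hg⟩)
  have hdis := hw.disjoint A hA hwA
  simp only [Finset.disjoint_insert_right, Finset.disjoint_singleton_right] at hdis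
  have alc := halt A hA hwA c (by simp)
  have ale := halt A hA hwA e (by simp)
  have alf := halt A hA hwA f (by simp)
  have alg := halt A hA hwA g (by simp)
  have h4 := h.mem_iff_of_line hF.ceg hA alc ale alg
  have hside : ∀ {v x y : α}, v ∉ A → x ∈ C.ground → y ∈ C.ground → C.AlternatesAt A x →
      C.AlternatesAt A y → C.Meets (insert v (C.side ∅ C.ground x ∪ C.side ∅ C.ground y)) →
      C.Meets (insert v (C.oside ∅ C.ground x ∪ C.oside ∅ C.ground y)) → (x ∈ A ↔ y ∉ A) := by
    intro v x y hv hx hy alx aly h1 h2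
    obtain ⟨s, hs⟩ := h1 A hA
    obtain ⟨t, ht⟩ := h2 A hA
    simp only [Finset.mem_inter, Finset.mem_insert, Finset.mem_union] at hs ht
    have hsv : s ≠ v := by
      rintro rfl
      exact hv hs.1
    have htv : t ≠ v := by
      rintro rfl
      exact hv ht.1
    have e1 : x ∈ A ∨ y ∈ A := hs.2.resolve_left hsv |>.imp
      (fun h => (alx.mem_side hx h).1 hs.1) (fun h => (aly.mem_side hy h).1 hs.1)
    have e2 : x ∉ A ∨ y ∉ A := ht.2.resolve_left htv |>.imp
      (fun h => (alx.mem_oside hx h).1 ht.1) (fun h => (aly.mem_oside hy h).1 ht.1)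
    exact ⟨fun h => e2.resolve_left (not_not.2 h), fun h => e1.resolve_right h⟩
  have h1 := hside hdis.1 he hf ale alf hb₁ hb₂
  have h2 := hside hdis.2 hc hf alc alf hd₁ hd₂
  exact hgA (h4.1 (h2.trans h1.symm))

end Fano

end Clutter

/-! ### Choosing single elements so that the lines become covers -/

namespace Clutter

variable {α : Type*} [DecidableEq α] {C : Clutter α} {a b c d e f g : α}

/-- Otherwise the pairs form a triangle, an odd closed walk. -/
theorem IsClean.meets_of_pairs (hC : C.IsClean) {K : Finset α} {x y z : α} (hxy : C.AdjOn K x y)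
    (hyz : C.AdjOn K y z) (hxz : C.AdjOn K x z) :
    C.Meets (insert x K) ∨ C.Meets (insert y K) ∨ C.Meets (insert z K) := by
  by_contra! hcon
  refine hC.no_odd_closed_walk (K := K) 3 (by decide)
    (fun i => if i = 1 then y else if i = 2 then z else x) rfl ?_ ?_
  · intro i hi
    interval_cases i
    exacts [hxy, hyz, hxz.symm]
  · intro i hi
    interval_cases i
    exacts [hcon.1, hcon.2.1, hcon.2.2, hcon.1]

/-- Otherwise `v` and its three neighbours, which jointly but not pairwise complete a cover, give a
delta. -/
theorem IsClean.meets_of_star (hC : C.IsClean) {K : Finset α} {v x y z : α} (hx : C.AdjOn K v x)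
    (hy : C.AdjOn K v y) (hz : C.AdjOn K v z) (hxyz : C.Meets (K ∪ {x, y, z})) :
    C.Meets (insert v K) ∨ C.AdjOn K x y ∨ C.AdjOn K y z ∨ C.AdjOn K x z := by
  by_contra! hcon
  obtain ⟨hv, hxy, hyz, hxz⟩ := hcon
  have hu : ∀ s t, K ∪ {s, t} = insert s (insert t K) := fun s t => by
    ext r
    simp only [Finset.mem_union, Finset.mem_insert, Finset.mem_singleton]
    tauto
  have hne : x ≠ y ∧ y ≠ z ∧ x ≠ z := by
    refine ⟨?_, ?_, ?_⟩ <;> rintro rfl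
    · exact hyz (by rw [AdjOn, ← hu]; simpa using hxyz)
    · exact hxy (by rw [AdjOn, ← hu]; simpa using hxyz)
    · exact hyz (by rw [AdjOn, ← hu]; simpa [Finset.pair_comm] using hxyz)
  have hvne : ∀ s, C.AdjOn K v s → v ≠ s := by
    rintro s hs rfl
    rw [AdjOn, Finset.insert_idem] at hs
    exact hv hs
  refine hC.no_delta (K := K) (M := {x, y, z}) (a := v) ?_ ?_ hxyz ?_ hv ?_
  · simp [hvne x hx, hvne y hy, hvne z hz]
  · rw [Finset.card_eq_three.2 ⟨x, y, z, hne.1, hne.2.2, hne.2.1, rfl⟩]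
    norm_num
  · simp [hx, hy, hz]
  · intro t ht hm
    simp only [Finset.mem_insert, Finset.mem_singleton] at ht
    obtain rfl | rfl | rfl := ht
    · refine hyz (hm.mono ?_)
      rw [← hu]
      refine Finset.union_subset_union_right fun s hs => ?_
      simp only [Finset.mem_erase, Finset.mem_insert, Finset.mem_singleton] at hs ⊢
      tauto
    · refine hxz (hm.mono ?_)
      rw [← hu]
      refine Finset.union_subset_union_right fun s hs => ?_
      simp only [Finset.mem_erase, Finset.mem_insert, Finset.mem_singleton] at hs ⊢
      tauto
    · refine hxy (hm.mono ?_)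
      rw [← hu]
      refine Finset.union_subset_union_right fun s hs => ?_
      simp only [Finset.mem_erase, Finset.mem_insert, Finset.mem_singleton] at hs ⊢
      tauto

namespace Fano

/-- An alternating member missing `d`, `e`, `f` contains `a` and hence misses `g`. If the complement
of the line `abc` were a cover, `d`, `e`, `f` would thus form a line, and `f` would share a side
with `a`, the third point of the line through `d` and `e`. -/
theorem not_meets_defg (hF : C.Fano a b c d e f g) (h : C.IsSimplicial) :
    ¬ C.Meets {d, e, f, g} := by
  intro hm
  have hl : C.Line d e f := by
    refine h.line_of_forall hF.ade.mem₂ hF.ade.mem₃ hF.afg.mem₂ hF.ade.indep₂₃ hF.cdf.indep₂₃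
      hF.bef.indep₂₃ fun A hA hAlt => ?_
    by_contra! hcon
    obtain ⟨t, ht⟩ := hm A hA
    simp only [Finset.mem_inter, Finset.mem_insert, Finset.mem_singleton] at ht
    obtain ⟨htA, rfl | rfl | rfl | rfl⟩ := ht
    · exact hcon.1 htA
    · exact hcon.2.1 htA
    · exact hcon.2.2 htA
    · have h1 := hF.ade.iff A hA hAlt
      have h2 := hF.afg.iff A hA hAlt
      tauto
  refine hF.afg.indep₁₂.1 (h.mem_side_of_forall hF.afg.mem₁ hF.afg.mem₂ fun A hA hAlt => ?_)
  have h1 := hF.ade.iff A hA hAlt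
  have h2 := hl.iff A hA hAlt
  tauto

theorem not_meets_bcfg (hF : C.Fano a b c d e f g) (h : C.IsSimplicial) :
    ¬ C.Meets {b, c, f, g} := hF.swap_lines.not_meets_defg h

theorem not_meets_bcde (hF : C.Fano a b c d e f g) (h : C.IsSimplicial) :
    ¬ C.Meets {b, c, d, e} := hF.swap_lines'.swap_lines.not_meets_defg h

theorem not_meets_acef (hF : C.Fano a b c d e f g) (h : C.IsSimplicial) :
    ¬ C.Meets {a, c, e, f} := hF.lead_b.not_meets_bcde h

theorem not_meets_acgd (hF : C.Fano a b c d e f g) (h : C.IsSimplicial) :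
    ¬ C.Meets {a, c, g, d} := hF.lead_b.not_meets_bcfg h

theorem not_meets_abge (hF : C.Fano a b c d e f g) (h : C.IsSimplicial) :
    ¬ C.Meets {a, b, g, e} := hF.lead_c.not_meets_bcfg h

theorem not_meets_abdf (hF : C.Fano a b c d e f g) (h : C.IsSimplicial) :
    ¬ C.Meets {a, b, d, f} := hF.lead_c.not_meets_bcde h

/-- If three lines that form a triangle are covers, then the line through the other three elements
of the triangle is a cover. -/
theorem meets_afg (hF : C.Fano a b c d e f g) (h : C.IsSimplicial) (habc : C.Meets {a, b, c})
    (hbdg : C.Meets {b, d, g}) (hcdf : C.Meets {c, d, f}) : C.Meets {a, f, g} := by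
  have hC := h.clean
  have n1 := hF.not_meets_abdf h
  have n2 := hF.not_meets_acef h
  have n3 := hF.not_meets_abge h
  have n4 := hF.not_meets_acgd h
  have n5 := hF.not_meets_defg h
  have n6 := hF.not_meets_bcfg h
  -- Split according to which of `b`, `c`, `d` completes `{a, f, g}` to a cover. Two of them
  -- together with a given line, or all pairs when none does, form a triangle; exactly one gives a
  -- star. The conclusions are ruled out by the complements of lines in `n1` to `n6`, by `hafg`, or
  -- by the case assumptions.
  by_contra hafg
  have sub : ∀ {S : Finset α} (T : Finset α), ¬ C.Meets T → S ⊆ T → C.Meets S → False :=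
    fun T hT hST hS => hT (hS.mono hST)
  by_cases h1 : C.Meets {a, b, f, g}
  · have h3 : ¬ C.Meets {a, d, f, g} := fun hm => by
      rcases hC.meets_of_pairs (K := {a, g}) (x := b) (y := d) (z := f)
        (hbdg.mono (by simp [Finset.insert_subset_iff]))
        (hm.mono (by simp [Finset.insert_subset_iff]))
        (h1.mono (by simp [Finset.insert_subset_iff])) with hm | hm | hm
      · exact sub _ n3 (by simp [Finset.insert_subset_iff]) hm
      · exact sub _ n4 (by simp [Finset.insert_subset_iff]) hm
      · exact sub _ hafg (by simp [Finset.insert_subset_iff]) hm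
    have h2 : ¬ C.Meets {a, c, f, g} := fun hm => by
      rcases hC.meets_of_pairs (K := {a, f}) (x := b) (y := c) (z := g)
        (habc.mono (by simp [Finset.insert_subset_iff]))
        (hm.mono (by simp [Finset.insert_subset_iff]))
        (h1.mono (by simp [Finset.insert_subset_iff])) with hm | hm | hm
      · exact sub _ n1 (by simp [Finset.insert_subset_iff]) hm
      · exact sub _ n2 (by simp [Finset.insert_subset_iff]) hm
      · exact sub _ hafg (by simp [Finset.insert_subset_iff]) hm
    rcases hC.meets_of_star (K := {a, g}) (v := b) (x := c) (y := d) (z := f)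
      (habc.mono (by simp [Finset.insert_subset_iff]))
      (hbdg.mono (by simp [Finset.insert_subset_iff]))
      (h1.mono (by simp [Finset.insert_subset_iff]))
      (hcdf.mono (by simp [Finset.insert_subset_iff])) with hm | hm | hm | hm
    · exact sub _ n3 (by simp [Finset.insert_subset_iff]) hm
    · exact sub _ n4 (by simp [Finset.insert_subset_iff]) hm
    · exact sub _ h3 (by simp [Finset.insert_subset_iff]) hm
    · exact sub _ h2 (by simp [Finset.insert_subset_iff]) hm
  by_cases h2 : C.Meets {a, c, f, g}
  · have h3 : ¬ C.Meets {a, d, f, g} := fun hm => by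
      rcases hC.meets_of_pairs (K := {a, f}) (x := c) (y := d) (z := g)
        (hcdf.mono (by simp [Finset.insert_subset_iff]))
        (hm.mono (by simp [Finset.insert_subset_iff]))
        (h2.mono (by simp [Finset.insert_subset_iff])) with hm | hm | hm
      · exact sub _ n2 (by simp [Finset.insert_subset_iff]) hm
      · exact sub _ n1 (by simp [Finset.insert_subset_iff]) hm
      · exact sub _ hafg (by simp [Finset.insert_subset_iff]) hm
    rcases hC.meets_of_star (K := {a, f}) (v := c) (x := b) (y := d) (z := g)
      (habc.mono (by simp [Finset.insert_subset_iff]))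
      (hcdf.mono (by simp [Finset.insert_subset_iff]))
      (h2.mono (by simp [Finset.insert_subset_iff]))
      (hbdg.mono (by simp [Finset.insert_subset_iff])) with hm | hm | hm | hm
    · exact sub _ n2 (by simp [Finset.insert_subset_iff]) hm
    · exact sub _ n1 (by simp [Finset.insert_subset_iff]) hm
    · exact sub _ h3 (by simp [Finset.insert_subset_iff]) hm
    · exact sub _ h1 (by simp [Finset.insert_subset_iff]) hm
  have h3 : ¬ C.Meets {a, d, f, g} := fun hm => by
    rcases hC.meets_of_star (K := {f, g}) (v := d) (x := a) (y := b) (z := c)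
      (hm.mono (by simp [Finset.insert_subset_iff]))
      (hbdg.mono (by simp [Finset.insert_subset_iff]))
      (hcdf.mono (by simp [Finset.insert_subset_iff]))
      (habc.mono (by simp [Finset.insert_subset_iff])) with hm | hm | hm | hm
    · exact sub _ n5 (by simp [Finset.insert_subset_iff]) hm
    · exact sub _ h1 (by simp) hm
    · exact sub _ n6 (by simp) hm
    · exact sub _ h2 (by simp) hm
  rcases hC.meets_of_pairs (K := {a, f, g}) (x := b) (y := c) (z := d)
    (habc.mono (by simp [Finset.insert_subset_iff]))
    (hcdf.mono (by simp [Finset.insert_subset_iff]))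
    (hbdg.mono (by simp [Finset.insert_subset_iff])) with hm | hm | hm
  · exact sub _ h1 (by simp [Finset.insert_subset_iff]) hm
  · exact sub _ h2 (by simp [Finset.insert_subset_iff]) hm
  · exact sub _ h3 (by simp [Finset.insert_subset_iff]) hm

end Fano

/-- A smallest cover inside `W ∪ C.side ∅ C.ground v` uses at most one element of the side, because
`W` avoids the opposite side. -/
theorem IsSimplicial.exists_mem_side (h : C.IsSimplicial) {v : α} {W : Finset α}
    (hv : v ∈ C.ground) (hW : Disjoint (C.oside ∅ C.ground v) W)
    (hm : C.Meets (W ∪ C.side ∅ C.ground v)) :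
    ∃ v' ∈ C.side ∅ C.ground v, C.Meets (insert v' W) := by
  rw [← Finset.empty_union (W ∪ _)] at hm
  obtain ⟨B, hBV, hB, hmin⟩ := exists_smallest hm
  have hdis := h.clean.disjoint_side_oside h.tangled.single hv
  have huniq := fun x y hxB hx hyB hy => h.clean.eq_of_mem_side (x := x) (y := y) h.tangled.single
    hv Finset.subset_union_right (Finset.disjoint_union_right.2 ⟨hW, hdis.symm⟩) hBV hB hmin hxB hx
    hyB hy
  rw [Finset.empty_union] at hB
  by_cases hex : ∃ x ∈ B, x ∈ C.side ∅ C.ground v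
  · obtain ⟨x, hxB, hx⟩ := hex
    refine ⟨x, hx, hB.mono fun t ht => ?_⟩
    obtain htW | hts := Finset.mem_union.1 (hBV ht)
    · exact Finset.mem_insert_of_mem htW
    · rw [huniq t x ht hts hxB hx]
      exact Finset.mem_insert_self _ _
  · push Not at hex
    refine ⟨v, self_mem_side hv, hB.mono fun t ht => ?_⟩
    exact Finset.mem_insert_of_mem ((Finset.mem_union.1 (hBV ht)).resolve_right (hex t ht))

theorem Indep.disjoint_oside {p v : α} (hp : p ∈ C.ground) (hv : v ∈ C.ground)
    (h : C.Indep p v) : Disjoint (C.oside ∅ C.ground v) (C.side ∅ C.ground p) := by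
  rw [Finset.disjoint_left]
  intro x hx hx'
  exact (h.of_mem_comp hp hv (Finset.mem_union_right _ hx)).2.1 hx'

end Clutter

namespace Clutter

variable {α : Type*} [DecidableEq α] {C : Clutter α} {a b c d e f g : α}

theorem Indep.ne {p q : α} (hp : p ∈ C.ground) (h : C.Indep p q) : p ≠ q := by
  rintro rfl
  exact h.1 (self_mem_side hp)

theorem Indep.notMem_oside {p v x : α} (hp : p ∈ C.ground) (hv : v ∈ C.ground)
    (h : C.Indep p v) (hx : x ∈ C.side ∅ C.ground p) : x ∉ C.oside ∅ C.ground v := fun hx' =>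
  Finset.disjoint_left.1 (h.disjoint_oside hp hv) hx' hx

theorem IsSimplicial.exists_mem_side_line (h : C.IsSimplicial) {p q t : α} (hl : C.Line p q t)
    (hm : C.Meets (insert p (insert q (C.side ∅ C.ground t)))) :
    ∃ t' ∈ C.side ∅ C.ground t, C.Meets {p, q, t'} := by
  obtain ⟨t', ht', hm'⟩ := h.exists_mem_side (W := {p, q}) hl.mem₃ (by
    simp only [Finset.disjoint_insert_right, Finset.disjoint_singleton_right]
    exact ⟨hl.indep₁₃.notMem_oside hl.mem₁ hl.mem₃ (self_mem_side hl.mem₁),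
      hl.indep₂₃.notMem_oside hl.mem₂ hl.mem₃ (self_mem_side hl.mem₂)⟩)
    (hm.mono fun x hx => by
      simp only [Finset.mem_insert, Finset.mem_union, Finset.mem_singleton] at hx ⊢
      tauto)
  refine ⟨t', ht', hm'.mono ?_⟩
  simp [Finset.insert_subset_iff]

theorem IsSimplicial.exists_mem_side_line₂ (h : C.IsSimplicial) {p q t : α} (hl : C.Line p q t)
    (hm : C.Meets (insert p (C.side ∅ C.ground q ∪ C.side ∅ C.ground t))) :
    ∃ q' ∈ C.side ∅ C.ground q, ∃ t' ∈ C.side ∅ C.ground t, C.Meets {p, q', t'} := by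
  obtain ⟨q', hq', hm'⟩ := h.exists_mem_side (W := insert p (C.side ∅ C.ground t)) hl.mem₂ (by
    rw [Finset.disjoint_insert_right]
    exact ⟨hl.indep₁₂.notMem_oside hl.mem₁ hl.mem₂ (self_mem_side hl.mem₁),
      (hl.indep₂₃.symm hl.mem₃).disjoint_oside hl.mem₃ hl.mem₂⟩)
    (hm.mono fun x hx => by
      simp only [Finset.mem_insert, Finset.mem_union] at hx ⊢
      tauto)
  obtain ⟨t', ht', hm''⟩ := h.exists_mem_side_line
    (hl.congr (self_mem_side hl.mem₁) hq' (self_mem_side hl.mem₃)) (hm'.mono (by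
      rw [Finset.insert_comm]))
  exact ⟨q', hq', t', ht', hm''⟩

theorem IsSimplicial.exists_mem_side_line₃ (h : C.IsSimplicial) {p q t : α} (hl : C.Line p q t) :
    ∃ p' ∈ C.side ∅ C.ground p, ∃ q' ∈ C.side ∅ C.ground q, ∃ t' ∈ C.side ∅ C.ground t,
      C.Meets {p', q', t'} := by
  obtain ⟨p', hp', hm'⟩ := h.exists_mem_side
    (W := C.side ∅ C.ground q ∪ C.side ∅ C.ground t) hl.mem₁ (by
    rw [Finset.disjoint_union_right]
    exact ⟨(hl.indep₁₂.symm hl.mem₂).disjoint_oside hl.mem₂ hl.mem₁,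
      (hl.indep₁₃.symm hl.mem₃).disjoint_oside hl.mem₃ hl.mem₁⟩)
    ((h.meets_of_line hl).mono fun x hx => by
      simp only [Finset.mem_union] at hx ⊢
      tauto)
  exact ⟨p', hp', h.exists_mem_side_line₂ (hl.of_mem_side hp') hm'⟩

namespace Fano

theorem lead_b' (h : C.Fano a b c d e f g) : C.Fano b a c d g f e :=
  ⟨h.abc.swap, h.bdg, h.bef.reverse, h.ade, h.afg.reverse, h.cdf, h.ceg.reverse⟩

/-- In every side of a Fano plane there is an element such that the seven lines are covers. -/
theorem exists_meets {a₀ b₀ c₀ d₀ e₀ f₀ g₀ : α} (hF : C.Fano a₀ b₀ c₀ d₀ e₀ f₀ g₀) (h : C.IsSimplicial) :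
    ∃ a b c d e f g, C.Fano a b c d e f g ∧ C.Meets {a, b, c} ∧ C.Meets {a, d, e} ∧
      C.Meets {a, f, g} ∧ C.Meets {b, d, g} ∧ C.Meets {b, e, f} ∧ C.Meets {c, d, f} ∧
      C.Meets {c, e, g} := by
  obtain ⟨a, ha, b, hb, c, hc, habc⟩ := h.exists_mem_side_line₃ hF.abc
  replace hF := hF.congr ha hb hc (self_mem_side hF.ade.mem₂) (self_mem_side hF.ade.mem₃)
    (self_mem_side hF.afg.mem₂) (self_mem_side hF.afg.mem₃)
  clear ha hb hc
  have hlift : ∀ {x y z : α}, y ∈ C.ground → z ∈ C.ground → C.Meets {x, y, z} →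
      C.Meets (insert x (C.side ∅ C.ground y ∪ C.side ∅ C.ground z)) := fun {x y z} hy hz hm =>
    hm.mono (Finset.insert_subset_insert _
      (by simp [Finset.insert_subset_iff, self_mem_side hy, self_mem_side hz]))
  obtain ⟨d, hd, e, he, hade⟩ := h.exists_mem_side_line₂ hF.ade
    (hF.meets_of_meets h (hlift hF.abc.mem₂ hF.abc.mem₃ habc))
  replace hF := hF.congr (self_mem_side hF.abc.mem₁) (self_mem_side hF.abc.mem₂)
    (self_mem_side hF.abc.mem₃) hd he (self_mem_side hF.afg.mem₂) (self_mem_side hF.afg.mem₃)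
  clear hd he
  -- Each of `b`, `c`, `d` already lies on a chosen line, so it completes the sides, and also the
  -- opposite sides, of the other lines through it. This is the input needed to choose `g` and `f`.
  have mb := hlift hF.abc.mem₁ hF.abc.mem₃ (x := b) (habc.mono (by simp [Finset.insert_subset_iff]))
  have mc := hlift hF.abc.mem₁ hF.abc.mem₂ (x := c) (habc.mono (by simp [Finset.insert_subset_iff]))
  have md := hlift hF.ade.mem₁ hF.ade.mem₃ (x := d) (hade.mono (by simp [Finset.insert_subset_iff]))
  have d1 := hF.lead_d.meets_of_meets h md
  have d2 := hF.lead_d.meets_oside_of_meets h md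
  have d3 := hF.lead_d.swap_lines'.meets_of_meets h md
  have d4 := hF.lead_d.swap_lines'.meets_oside_of_meets h md
  have b1 := hF.lead_b.meets_of_meets h mb
  have b2 := hF.lead_b.meets_oside_of_meets h mb
  have c1 := hF.lead_c.swap_lines'.meets_of_meets h mc
  have c2 := hF.lead_c.swap_lines'.meets_oside_of_meets h mc
  rw [Finset.union_comm] at d3 d4 c1 c2
  obtain ⟨g, hg, hbdg⟩ := h.exists_mem_side_line hF.bdg (hF.meets_pair_side h b1 b2 d3 d4)
  obtain ⟨f, hf, hcdf⟩ := h.exists_mem_side_line hF.cdf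
    (hF.swap_bc.meets_pair_side h c1 c2 d1 d2)
  replace hF := hF.congr (self_mem_side hF.abc.mem₁) (self_mem_side hF.abc.mem₂)
    (self_mem_side hF.abc.mem₃) (self_mem_side hF.ade.mem₂) (self_mem_side hF.ade.mem₃) hf hg
  -- Each of the lines `afg`, `bef`, `ceg` follows from a triangle among the four lines already
  -- known to be covers.
  refine ⟨a, b, c, d, e, f, g, hF, habc, hade, hF.meets_afg h habc hbdg hcdf, hbdg, ?_, hcdf, ?_⟩
  · exact (hF.lead_b'.meets_afg h (habc.mono (by simp [Finset.insert_subset_iff])) hade hcdf).mono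
      (by simp [Finset.insert_subset_iff])
  · exact (hF.lead_c.meets_afg h (habc.mono (by simp [Finset.insert_subset_iff])) hade hbdg).mono
      (by simp [Finset.insert_subset_iff])

end Fano

/-- If `s` and `t` shared a component, the product of their signs, hence that of `x` and `y`, would
be constant, putting `x` and `y` in one component too. -/
theorem IsSimplicial.indep_of_iff (h : C.IsSimplicial) {x y s t : α} (hx : x ∈ C.ground)
    (hy : y ∈ C.ground) (hs : s ∈ C.ground) (hxy : C.Indep x y)
    (hiff : ∀ A ∈ C.members, C.Alternates A → ((s ∈ A ↔ t ∈ A) ↔ (x ∈ A ↔ y ∈ A))) :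
    C.Indep s t := by
  refine ⟨fun hst => hxy.1 (h.mem_side_of_forall hx hy fun A hA hAlt => ?_), fun hst => ?_⟩
  · have h1 := hiff A hA hAlt
    have h2 := (hAlt.at s).mem_side hs hst
    tauto
  · obtain ⟨x', hx'⟩ := h.tangled.exists_mem_oside hx
    apply hxy.2
    rw [← side_eq_of_mem_oside hx hx']
    refine h.mem_side_of_forall (oside_subset hx') hy fun A hA hAlt => ?_
    have h1 := hiff A hA hAlt
    have h2 := (hAlt.at s).mem_oside hs hst
    have h3 := (hAlt.at x).mem_oside hx hx'
    tauto

set_option linter.unusedSimpArgs false in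
-- The signs of `a`, `b` and a `d` off their line generate the plane: `c`, `e`, `g` are the products
-- ab, ad, bd, and `f` is abd. The remaining independences and lines are identities between such
-- products.
theorem IsSimplicial.exists_fano (h : C.IsSimplicial) (hrank : ∀ x y z, ∃ v ∈ C.ground,
    (x ∈ C.ground → C.Indep x v) ∧ (y ∈ C.ground → C.Indep y v) ∧ (z ∈ C.ground → C.Indep z v))
    (hne : C.ground.Nonempty) : ∃ a b c d e f g, C.Fano a b c d e f g := by
  obtain ⟨a, ha⟩ := hne
  obtain ⟨b, hb, hab, -⟩ := hrank a a a
  obtain ⟨c, abc⟩ := h.exists_line ha hb (hab ha)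
  have hc := abc.mem₃
  obtain ⟨d, hd, had, hbd, hcd⟩ := hrank a b c
  replace hab := hab ha
  replace had := had ha
  replace hbd := hbd hb
  replace hcd := hcd hc
  obtain ⟨e, ade⟩ := h.exists_line ha hd had
  have he := ade.mem₃
  obtain ⟨g, bdg⟩ := h.exists_line hb hd hbd
  have hg := bdg.mem₃
  have hbe : C.Indep b e := h.indep_of_iff hc hd hb hcd fun A hA hAlt => by
    have h1 := abc.iff A hA hAlt
    have h2 := ade.iff A hA hAlt
    tauto
  obtain ⟨f, bef⟩ := h.exists_line hb he hbe
  have hf := bef.mem₃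
  have key : ∀ A ∈ C.members, C.Alternates A → ((a ∈ A ↔ b ∈ A) ↔ c ∈ A) ∧
      ((a ∈ A ↔ d ∈ A) ↔ e ∈ A) ∧ ((b ∈ A ↔ d ∈ A) ↔ g ∈ A) ∧ ((b ∈ A ↔ e ∈ A) ↔ f ∈ A) :=
    fun A hA hAlt => ⟨abc.iff A hA hAlt, ade.iff A hA hAlt, bdg.iff A hA hAlt, bef.iff A hA hAlt⟩
  have haf : C.Indep a f := h.indep_of_iff hb hd ha hbd fun A hA hAlt => by
    obtain ⟨h1, h2, h3, h4⟩ := key A hA hAlt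
    simp only [← h1, ← h2, ← h3, ← h4]
    by_cases a ∈ A <;> by_cases b ∈ A <;> by_cases d ∈ A <;> simp [*]
  have hag : C.Indep a g := h.indep_of_iff hc hd ha hcd fun A hA hAlt => by
    obtain ⟨h1, h2, h3, h4⟩ := key A hA hAlt
    simp only [← h1, ← h2, ← h3, ← h4]
    by_cases a ∈ A <;> by_cases b ∈ A <;> by_cases d ∈ A <;> simp [*]
  have hfg : C.Indep f g := h.indep_of_iff hd he hf ade.indep₂₃ fun A hA hAlt => by
    obtain ⟨h1, h2, h3, h4⟩ := key A hA hAlt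
    simp only [← h1, ← h2, ← h3, ← h4]
    by_cases a ∈ A <;> by_cases b ∈ A <;> by_cases d ∈ A <;> simp [*]
  have hcf : C.Indep c f := h.indep_of_iff ha he hc ade.indep₁₃ fun A hA hAlt => by
    obtain ⟨h1, h2, h3, h4⟩ := key A hA hAlt
    simp only [← h1, ← h2, ← h3, ← h4]
    by_cases a ∈ A <;> by_cases b ∈ A <;> by_cases d ∈ A <;> simp [*]
  have hdf : C.Indep d f := h.indep_of_iff ha hb hd hab fun A hA hAlt => by
    obtain ⟨h1, h2, h3, h4⟩ := key A hA hAlt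
    simp only [← h1, ← h2, ← h3, ← h4]
    by_cases a ∈ A <;> by_cases b ∈ A <;> by_cases d ∈ A <;> simp [*]
  have hce : C.Indep c e := h.indep_of_iff hb hd hc hbd fun A hA hAlt => by
    obtain ⟨h1, h2, h3, h4⟩ := key A hA hAlt
    simp only [← h1, ← h2, ← h3, ← h4]
    by_cases a ∈ A <;> by_cases b ∈ A <;> by_cases d ∈ A <;> simp [*]
  have hcg : C.Indep c g := h.indep_of_iff ha hd hc had fun A hA hAlt => by
    obtain ⟨h1, h2, h3, h4⟩ := key A hA hAlt
    simp only [← h1, ← h2, ← h3, ← h4]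
    by_cases a ∈ A <;> by_cases b ∈ A <;> by_cases d ∈ A <;> simp [*]
  have heg : C.Indep e g := h.indep_of_iff ha hb he hab fun A hA hAlt => by
    obtain ⟨h1, h2, h3, h4⟩ := key A hA hAlt
    simp only [← h1, ← h2, ← h3, ← h4]
    by_cases a ∈ A <;> by_cases b ∈ A <;> by_cases d ∈ A <;> simp [*]
  have afg : C.Line a f g := ⟨ha, hf, hg, haf, hag, hfg, fun A hA hAlt => by
    obtain ⟨h1, h2, h3, h4⟩ := key A hA hAlt
    simp only [← h1, ← h2, ← h3, ← h4]
    by_cases a ∈ A <;> by_cases b ∈ A <;> by_cases d ∈ A <;> simp [*]⟩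
  have cdf : C.Line c d f := ⟨hc, hd, hf, hcd, hcf, hdf, fun A hA hAlt => by
    obtain ⟨h1, h2, h3, h4⟩ := key A hA hAlt
    simp only [← h1, ← h2, ← h3, ← h4]
    by_cases a ∈ A <;> by_cases b ∈ A <;> by_cases d ∈ A <;> simp [*]⟩
  have ceg : C.Line c e g := ⟨hc, he, hg, hce, hcg, heg, fun A hA hAlt => by
    obtain ⟨h1, h2, h3, h4⟩ := key A hA hAlt
    simp only [← h1, ← h2, ← h3, ← h4]
    by_cases a ∈ A <;> by_cases b ∈ A <;> by_cases d ∈ A <;> simp [*]⟩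
  exact ⟨a, b, c, d, e, f, g, abc, ade, afg, bdg, bef, cdf, ceg⟩

end Clutter

/-! ### Recognising 𝕃₇ as a minor -/

namespace Clutter

variable {α : Type*} [DecidableEq α] {C : Clutter α} {a b c d e f g : α}

set_option maxRecDepth 10000 in
theorem exists_subset_of_meets_fanoLines : ∀ U ∈ fanoLines.ground.powerset,
    (∀ L ∈ fanoLines.members, ¬ Disjoint L U) → ∃ L ∈ fanoLines.members, L ⊆ U := by
  decide +kernel

/-- Contract everything outside the seven elements. A subset contains a member of the minor iff its
complement in the seven is not a cover. As 𝕃₇ is its own blocker, `h₁` and `h₂` say that this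
happens iff the subset contains a line. -/
theorem exists_isMinor_isIsomorphic_fanoLines {φ : ℕ → α}
    (hinj : Set.InjOn φ fanoLines.ground) (hground : ∀ i ∈ fanoLines.ground, φ i ∈ C.ground)
    (h₁ : ∀ L ∈ fanoLines.members, C.Meets (L.image φ))
    (h₂ : ∀ L ∈ fanoLines.members, ¬ C.Meets ((fanoLines.ground \ L).image φ)) :
    ∃ D : Clutter α, D.IsMinor C ∧ D.IsIsomorphic fanoLines := by
  set V := fanoLines.ground with hV
  set X := V.image φ with hX
  have hXC : X ⊆ C.ground := Finset.image_subset_iff.2 hground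
  have himg : ∀ U ⊆ V, X \ U.image φ = (V \ U).image φ := fun U hU =>
    (Finset.image_sdiff_of_injOn hinj hU).symm
  have key : ∀ U ⊆ V, ¬ C.Meets (∅ ∪ X \ U.image φ) ↔ ∃ L ∈ fanoLines.members, L ⊆ U := by
    intro U hU
    rw [Finset.empty_union, himg U hU]
    constructor
    · intro hn
      refine exists_subset_of_meets_fanoLines U (Finset.mem_powerset.2 hU) fun L hL hd => hn ?_
      exact (h₁ L hL).mono (Finset.image_subset_image fun x hx => Finset.mem_sdiff.2
        ⟨fanoLines.subset_ground L hL hx, Finset.disjoint_left.1 hd hx⟩)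
    · rintro ⟨L, hL, hLU⟩ hm
      exact h₂ L hL (hm.mono (Finset.image_subset_image (Finset.sdiff_subset_sdiff le_rfl hLU)))
  have hmem : (C.minorOn ∅ X).members = fanoLines.members.image (fun L => L.image φ) := by
    ext T
    rw [mem_minorOn, Finset.mem_image]
    constructor
    · rintro ⟨hTX, hn, hmin⟩
      obtain ⟨U, hU, rfl⟩ := Finset.subset_image_iff.1 hTX
      obtain ⟨L, hL, hLU⟩ := (key U hU).1 hn
      exact ⟨L, hL, hmin _ (Finset.image_subset_image hLU)
        ((key L (fanoLines.subset_ground L hL)).2 ⟨L, hL, subset_rfl⟩)⟩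
    · rintro ⟨L, hL, rfl⟩
      have hLV := fanoLines.subset_ground L hL
      refine ⟨Finset.image_subset_image hLV, (key L hLV).2 ⟨L, hL, subset_rfl⟩, fun T' hT' hn => ?_⟩
      obtain ⟨U, hU, rfl⟩ := Finset.subset_image_iff.1 hT'
      obtain ⟨L', hL', hLU⟩ := (key U (hU.trans hLV)).1 hn
      have : L' = L := by_contra fun hne => fanoLines.antichain hL' hL hne (hLU.trans hU)
      rw [← this] at hU ⊢
      rw [subset_antisymm hU hLU]
  refine ⟨C.minorOn ∅ X, minorOn_isMinor .., Function.invFunOn φ V, ?_, ?_⟩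
  · rw [minorOn_ground hXC (Finset.disjoint_empty_right _), hX, Finset.coe_image]
    exact hinj.bijOn_image.symm hinj.bijOn_image.invOn_invFunOn.symm
  · rw [hmem, Finset.image_image]
    conv_lhs => rw [← Finset.image_id (s := fanoLines.members)]
    refine Finset.image_congr fun L hL => ?_
    have hLV := fanoLines.subset_ground L hL
    simp only [id, Function.comp, Finset.image_image]
    conv_lhs => rw [← Finset.image_id (s := L)]
    exact Finset.image_congr fun x hx => (hinj.leftInvOn_invFunOn (hLV hx)).symm

theorem Fano.exists_isMinor (hF : C.Fano a b c d e f g) (h : C.IsSimplicial)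
    (habc : C.Meets {a, b, c}) (hade : C.Meets {a, d, e}) (hafg : C.Meets {a, f, g})
    (hbdg : C.Meets {b, d, g}) (hbef : C.Meets {b, e, f}) (hcdf : C.Meets {c, d, f})
    (hceg : C.Meets {c, e, g}) : ∃ D : Clutter α, D.IsMinor C ∧ D.IsIsomorphic fanoLines := by
  have ha := hF.abc.mem₁
  have hb := hF.abc.mem₂
  have hc := hF.abc.mem₃
  have hd := hF.ade.mem₂
  have he := hF.ade.mem₃
  have hf := hF.afg.mem₂
  have hg := hF.afg.mem₃
  have hne : ∀ {x y z : α}, C.Line x y z → x ≠ y ∧ x ≠ z ∧ y ≠ z := fun {x y z} hl =>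
    ⟨hl.indep₁₂.ne hl.mem₁, hl.indep₁₃.ne hl.mem₁, hl.indep₂₃.ne hl.mem₂⟩
  obtain ⟨n1, n2, n3⟩ := hne hF.abc
  obtain ⟨n4, n5, n6⟩ := hne hF.ade
  obtain ⟨n7, n8, n9⟩ := hne hF.afg
  obtain ⟨n10, n11, n12⟩ := hne hF.bdg
  obtain ⟨n13, n14, n15⟩ := hne hF.bef
  obtain ⟨n16, n17, n18⟩ := hne hF.cdf
  obtain ⟨n19, n20, n21⟩ := hne hF.ceg
  refine exists_isMinor_isIsomorphic_fanoLines
    (φ := fun i => match i with | 1 => a | 2 => b | 3 => c | 4 => d | 5 => e | 6 => f | _ => g)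
    ?_ ?_ ?_ ?_
  · intro x hx y hy hxy
    simp only [fanoLines, Finset.coe_insert, Finset.coe_singleton, Set.mem_insert_iff,
      Set.mem_singleton_iff] at hx hy
    rcases hx with rfl | rfl | rfl | rfl | rfl | rfl | rfl <;>
    rcases hy with rfl | rfl | rfl | rfl | rfl | rfl | rfl <;> first | rfl | simp_all
  · simp [fanoLines, ha, hb, hc, hd, he, hf, hg]
  · simp [fanoLines, habc, hade, hafg, hbdg, hbef, hcdf, hceg]
  · simp only [fanoLines, Finset.forall_mem_insert, Finset.mem_singleton, forall_eq]
    refine ⟨fun hm => hF.not_meets_defg h (hm.mono ?_), fun hm => hF.not_meets_bcfg h (hm.mono ?_),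
      fun hm => hF.not_meets_bcde h (hm.mono ?_), fun hm => hF.not_meets_acgd h (hm.mono ?_),
      fun hm => hF.not_meets_acef h (hm.mono ?_), fun hm => hF.not_meets_abge h (hm.mono ?_),
      fun hm => hF.not_meets_abdf h (hm.mono ?_)⟩ <;>
    simp [Finset.image_subset_iff]

end Clutter

/-! ### Affine independence from the simplex hypothesis -/

theorem mem_extremePoints_convexHull_realPoints {n : ℕ} {S : Finset (Fin n → Bool)}
    {x : Fin n → ℝ} (hx : x ∈ realPoints S) :
    x ∈ (convexHull ℝ (realPoints S)).extremePoints ℝ := by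
  have hcube : convexHull ℝ (realPoints S) ⊆ Set.Icc 0 1 := by
    refine convexHull_min ?_ (convex_Icc 0 1)
    rintro _ ⟨p, -, rfl⟩
    constructor <;> intro i <;> by_cases h : p i <;> simp [h]
  refine mem_extremePoints.2 ⟨subset_convexHull ℝ _ hx, fun y hy z hz hxyz => ?_⟩
  obtain ⟨r, s, hr, hs, hrs, rfl⟩ := hxyz
  -- In each coordinate the point is an endpoint of the interval [0, 1], so it is not strictly
  -- between two different values.
  have hyz : ∀ i, y i = (r • y + s • z) i ∧ z i = (r • y + s • z) i := by
    intro i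
    have hy₀ := (hcube hy).1 i
    have hy₁ := (hcube hy).2 i
    have hz₀ := (hcube hz).1 i
    have hz₁ := (hcube hz).2 i
    obtain ⟨p, -, hp⟩ := hx
    have hpi := congrFun hp i
    simp only [Pi.zero_apply, Pi.one_apply, Pi.add_apply, Pi.smul_apply, smul_eq_mul] at *
    split_ifs at hpi with hi
    · have h1 : r * (1 - y i) + s * (1 - z i) = 0 := by linarith
      have h2 := mul_nonneg hr.le (sub_nonneg.2 hy₁)
      have h3 := mul_nonneg hs.le (sub_nonneg.2 hz₁)
      have h4 : r * (1 - y i) = 0 := by linarith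
      have h5 : s * (1 - z i) = 0 := by linarith
      have h6 := (mul_eq_zero.1 h4).resolve_left hr.ne'
      have h7 := (mul_eq_zero.1 h5).resolve_left hs.ne'
      constructor <;> linarith
    · have h2 := mul_nonneg hr.le hy₀
      have h3 := mul_nonneg hs.le hz₀
      have h4 : r * y i = 0 := by linarith
      have h5 : s * z i = 0 := by linarith
      have h6 := (mul_eq_zero.1 h4).resolve_left hr.ne'
      have h7 := (mul_eq_zero.1 h5).resolve_left hs.ne'
      constructor <;> linarith
  exact ⟨funext fun i => (hyz i).1, funext fun i => (hyz i).2⟩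

/-- All 0-1 points are extreme in their hull, hence among the affinely independent vertices of the
simplex. -/
theorem IsSimplex.eq_zero_of_sum_eq_zero {n : ℕ} {S : Finset (Fin n → Bool)}
    (h : IsSimplex (convexHull ℝ (realPoints S))) {c : (Fin n → Bool) → ℝ}
    (h₀ : ∑ p ∈ S, c p = 0) (h₁ : ∀ i, ∑ p ∈ S with p i = true, c p = 0) :
    ∀ p ∈ S, c p = 0 := by
  obtain ⟨m, s, hs⟩ := h
  have hsub : realPoints S ⊆ Set.range s.points := fun x hx =>
    extremePoints_convexHull_subset (hs ▸ mem_extremePoints_convexHull_realPoints hx)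
  have hind := s.independent.range.mono hsub
  let φ : S ↪ realPoints S := ⟨fun p => ⟨_, p.1, p.2, rfl⟩, fun p q hpq => by
    ext i
    have := congrFun (congrArg Subtype.val hpq) i
    by_cases hp : p.1 i <;> by_cases hq : q.1 i <;> simp_all⟩
  have h' := affineIndependent_iff.1 (hind.comp_embedding φ) Finset.univ (fun p => c p.1)
    (by rw [← h₀]; exact Finset.sum_coe_sort S c) (by
      ext i
      rw [Finset.sum_apply, Pi.zero_apply, ← h₁ i, Finset.sum_filter, ← Finset.sum_coe_sort S]
      refine Finset.sum_congr rfl fun p _ => ?_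
      change c p.1 * (if p.1 i = true then (1 : ℝ) else 0) = _
      rw [mul_ite, mul_one, mul_zero])
  exact fun p hp => h' ⟨p, hp⟩ (Finset.mem_univ _)

/-! ### Translating setcore, tangledness and rank -/

namespace Clutter

variable {α : Type*} [DecidableEq α] {C : Clutter α}

/-- Members of the core correspond to points of `S`, and a copy of the cuboid element `(i, true)`
reads off coordinate `i`. A dependence of core members with zero marginals is thus an affine
dependence of `S`. -/
theorem eq_zero_of_isDuplication_cuboid {n : ℕ} {S : Finset (Fin n → Bool)}
    (hS : C.core.IsDuplication (cuboid S)) (hsimplex : IsSimplex (convexHull ℝ (realPoints S)))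
    (c : Finset α → ℝ) (hc : ∀ A ∈ C.members, c A ≠ 0 → A ∈ C.core.members)
    (h₀ : ∑ A ∈ C.members, c A = 0)
    (h₁ : ∀ v ∈ C.ground, ∑ A ∈ C.members with v ∈ A, c A = 0) :
    ∀ A ∈ C.members, c A = 0 := by
  classical
  obtain ⟨f, -, hsurj, hmem⟩ := hS
  have hmem' : C.core.members =
      S.image (fun p => C.ground.filter (fun v => p (f v).1 = (f v).2)) := by
    rw [hmem, cuboid, Finset.image_image]
    refine Finset.image_congr fun p _ => ?_
    ext v
    simp [core]
  set m : (Fin n → Bool) → Finset α := fun p => C.ground.filter (fun v => p (f v).1 = (f v).2)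
    with hm
  have hcore : C.core.members ⊆ C.members := Finset.filter_subset _ _
  have hv : ∀ i, ∃ v ∈ C.ground, ∀ p, v ∈ m p ↔ p i = true := by
    intro i
    obtain ⟨v, hv, hfv⟩ := hsurj (show (i, true) ∈ ((cuboid S).ground : Set _) by simp [cuboid])
    refine ⟨v, hv, fun p => ?_⟩
    have hv' : v ∈ C.ground := hv
    simp [hm, hv', hfv]
  have hinj : Set.InjOn m S := by
    intro p _ q _ hpq
    ext i
    obtain ⟨v, -, hv⟩ := hv i
    have := hv p
    rw [hpq, hv q] at this
    exact Bool.eq_iff_iff.2 this.symm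
  have h := hsimplex.eq_zero_of_sum_eq_zero (c := fun p => c (m p)) (by
    rw [← Finset.sum_image (f := c) hinj, ← hmem', ← h₀]
    exact Finset.sum_subset hcore fun A hA hA' => by_contra fun h => hA' (hc A hA h)) (by
    intro i
    obtain ⟨v, hvC, hv⟩ := hv i
    rw [← h₁ v hvC, Finset.sum_filter, Finset.sum_filter]
    have : ∀ p, (if p i = true then c (m p) else 0) =
        (fun A => if v ∈ A then c A else 0) (m p) := fun p => by simp only [hv p]
    rw [Finset.sum_congr rfl fun p _ => this p,
      ← Finset.sum_image (f := fun A => if v ∈ A then c A else 0) hinj, ← hmem']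
    refine Finset.sum_subset hcore fun A hA hA' => ?_
    have : c A = 0 := by_contra fun h => hA' (hc A hA h)
    simp [this])
  intro A hA
  by_contra hne
  have := hc A hA hne
  rw [hmem', Finset.mem_image] at this
  obtain ⟨p, hp, rfl⟩ := this
  exact hne (h p hp)

theorem IsTangled.two_le_card (h : C.IsTangled) {B : Finset α} (hB : C.IsCover B) :
    2 ≤ B.card := by
  have h2 : C.coveringNumber ≤ (B.card : ℕ∞) := iInf_le _ (⟨B, hB⟩ : {B // C.IsCover B})
  rw [h.1] at h2
  exact_mod_cast h2

theorem IsTangled.isTangledOn (h : C.IsTangled) : C.IsTangledOn ∅ C.ground where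
  not_meets hm := by
    have := h.two_le_card ⟨Finset.empty_subset _, hm⟩
    simp at this
  single x hx hm := by
    have := h.two_le_card ⟨Finset.insert_subset hx (Finset.empty_subset _), hm⟩
    simp at this
  nbr x hx := by
    obtain ⟨B, ⟨hB, hcard⟩, hxB⟩ := h.2 x hx
    have hcard : B.card = 2 := by
      rw [h.1] at hcard
      exact_mod_cast hcard
    obtain ⟨y, z, -, rfl⟩ := Finset.card_eq_two.1 hcard
    have hy : y ∈ C.ground := hB.1 (by simp)
    have hz : z ∈ C.ground := hB.1 (by simp)
    rw [Finset.mem_insert, Finset.mem_singleton] at hxB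
    obtain rfl | rfl := hxB
    · exact ⟨z, hz, hB.2⟩
    · exact ⟨y, hy, AdjOn.symm (K := ∅) hB.2⟩

theorem IsTangled.coverGraph_adj (h : C.IsTangled) {x y : α} (hx : x ∈ C.ground)
    (hy : y ∈ C.ground) (hxy : C.AdjOn ∅ x y) : C.coverGraph.Adj ⟨x, hx⟩ ⟨y, hy⟩ := by
  have hne : x ≠ y := hxy.ne (h.isTangledOn.single y hy)
  refine ⟨fun h => hne (congrArg Subtype.val h), ⟨?_, hxy⟩, ?_⟩
  · simp [Finset.insert_subset_iff, hx, hy]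
  · rw [h.1, Finset.card_pair hne]
    rfl

theorem IsTangled.reachable_of_mem_side (h : C.IsTangled) {x y : α} (hx : x ∈ C.ground)
    (hy : y ∈ C.side ∅ C.ground x) :
    C.coverGraph.Reachable ⟨x, hx⟩ ⟨y, side_subset hy⟩ := by
  obtain ⟨hyC, hr⟩ := mem_side.1 hy
  suffices ∃ hy : y ∈ C.ground, C.coverGraph.Reachable ⟨x, hx⟩ ⟨y, hy⟩ from this.2
  clear hy hyC
  induction hr with
  | refl => exact ⟨hx, SimpleGraph.Reachable.refl _⟩
  | tail _ hbc ih =>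
    obtain ⟨hb, ih⟩ := ih
    obtain ⟨hc, t, ht, hbt, htc⟩ := hbc
    exact ⟨hc, (ih.trans (h.coverGraph_adj hb ht hbt).reachable).trans
      (h.coverGraph_adj ht hc htc).reachable⟩

theorem IsTangled.indep_of_not_reachable (h : C.IsTangled) {x y : α} (hx : x ∈ C.ground)
    (hy : y ∈ C.ground) (hxy : ¬ C.coverGraph.Reachable ⟨x, hx⟩ ⟨y, hy⟩) : C.Indep x y := by
  refine ⟨fun hy' => hxy (h.reachable_of_mem_side hx hy'), fun hy' => hxy ?_⟩
  obtain ⟨-, z, hz, hzy⟩ := mem_oside.1 hy'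
  exact (h.reachable_of_mem_side hx hz).trans (h.coverGraph_adj (side_subset hz) hy hzy).reachable

theorem ground_nonempty_of_rank_pos (h : 0 < C.rank) : C.ground.Nonempty := by
  obtain ⟨⟨v, hv⟩⟩ := (Nat.card_pos_iff.1 h).1
  exact ⟨v, hv⟩

/-- More than three components leave one that avoids any given three; this provides the point off a
line that starts the Fano plane. -/
theorem IsTangled.exists_indep (h : C.IsTangled) (hrank : 3 < C.rank) (x y z : α) :
    ∃ v ∈ C.ground, (x ∈ C.ground → C.Indep x v) ∧ (y ∈ C.ground → C.Indep y v) ∧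
      (z ∈ C.ground → C.Indep z v) := by
  classical
  obtain ⟨u, hu⟩ := ground_nonempty_of_rank_pos (by omega : 0 < C.rank)
  have hfin : Finite C.coverGraph.ConnectedComponent := (Nat.card_pos_iff.1 (by
    change 0 < C.rank
    omega)).2
  have := Fintype.ofFinite C.coverGraph.ConnectedComponent
  let κ : α → C.coverGraph.ConnectedComponent := fun x =>
    if hx : x ∈ C.ground then C.coverGraph.connectedComponentMk ⟨x, hx⟩
    else C.coverGraph.connectedComponentMk ⟨u, hu⟩
  have hlt : ({κ x, κ y, κ z} : Finset _).card <
      (Finset.univ : Finset C.coverGraph.ConnectedComponent).card := by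
    refine Finset.card_le_three.trans_lt ?_
    rwa [Finset.card_univ, ← Nat.card_eq_fintype_card]
  obtain ⟨w, -, hc⟩ := Finset.exists_mem_notMem_of_card_lt_card hlt
  obtain ⟨⟨v, hv⟩, rfl⟩ := w.exists_rep
  change C.coverGraph.connectedComponentMk ⟨v, hv⟩ ∉ _ at hc
  have key : ∀ w, C.coverGraph.connectedComponentMk ⟨v, hv⟩ ≠ κ w → w ∈ C.ground → C.Indep w v := by
    intro w hw hwC
    refine h.indep_of_not_reachable hwC hv fun hr => hw ?_
    rw [show κ w = C.coverGraph.connectedComponentMk ⟨w, hwC⟩ from dif_pos hwC]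
    exact (SimpleGraph.ConnectedComponent.sound hr).symm
  exact ⟨v, hv, key x fun he => hc (by simp [← he]), key y fun he => hc (by simp [← he]),
    key z fun he => hc (by simp [← he])⟩

end Clutter

theorem mainTheorem3 {α : Type*} [DecidableEq α] (C : Clutter α)
    (hclean : C.IsClean) (htangled : C.IsTangled)
    (S : Finset (Fin C.rank → Bool)) (hS : C.IsSetcore S)
    (hsimplex : IsSimplex (convexHull ℝ (realPoints S)))
    (hrank : 3 < C.rank) :
    ∃ D : Clutter α, D.IsMinor C ∧ D.IsIsomorphic Clutter.fanoLines := by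
  have h : C.IsSimplicial := ⟨hclean, htangled.isTangledOn,
    Clutter.eq_zero_of_isDuplication_cuboid hS hsimplex⟩
  obtain ⟨a, b, c, d, e, f, g, hF⟩ := h.exists_fano (htangled.exists_indep hrank)
    (Clutter.ground_nonempty_of_rank_pos (by omega))
  obtain ⟨a, b, c, d, e, f, g, hF, habc, hade, hafg, hbdg, hbef, hcdf, hceg⟩ := hF.exists_meets h
  exact hF.exists_isMinor h habc hade hafg hbdg hbef hcdf hceg
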